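/- For a function \(f\) put \(\mathcal L f(z)=\frac1{z^2}\frac{d}{dz}\bigl(z^2\frac{df}{dz}\bigr)\). For \(n\ge 0\), call \(S(n)>0\) a scale factor of the Lane--Emden equation of index \(n\) if there is a function \(\Theta\), continuous on \([0,\pi]\), \(C^2\) on \((0,\pi)\) and positive on \([0,\pi)\), with \[ \mathcal L[S(n)\Theta]+(S(n)\Theta)^n=0\ \text{ on }(0,\pi),\qquad \Theta(0)=1,\quad \Theta'(0)=0,\quad \Theta(\pi)=0 . \] Let the expansions \(S(n)=\sum_i n^i S_0^{(i)}\), \(\Theta(z)=\sum_i n^i\Theta_0^{(i)}(z)\) about \(n=0\) be determined up to third order by inserting them into the equation, equating to zero the coefficients of \(n^0,n^1,n^2,n^3\) on \((0,\pi)\), and imposing \(\Theta_0^{(i)}(0)=\delta_{0i}\), \(\frac{d\Theta_0^{(i)}}{dz}(0)=0\), \(\Theta_0^{(i)}(\pi)=0\) for \(0\le i\le 3\) (with \(\Theta_0^{(i)}\) continuous on \([0,\pi]\) and \(C^2\) on \((0,\pi)\)). This system is solvable. For every solution of it the following holds. For all sufficiently small \(n\ge0\) there is exactly one scale factor \(S(n)\),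 and \[ S(n)=S_0^{(0)}+nS_0^{(1)}+n^2S_0^{(2)}+n^3S_0^{(3)}+O(n^4)\qquad(n\to0^+). \] Moreover, \[ \begin{aligned} S_0^{(3)}={}&\frac{18113}{324}\pi^2-\frac{46}{27}\pi^4-\Bigl(\frac{212}{27}\pi^2+\frac{14}{9}\pi^4\Bigr)\ln2-\frac{68}{9}\pi^2\ln^22-\frac{16}{9}\pi^2\ln^32-\frac{47}{3}\pi^2\zeta(3)\\ &+\Bigl(-\frac{257}{54}\pi^2+\frac{7}{18}\pi^4+\frac49\pi^2\ln2+\frac43\pi^2\ln^22\Bigr)\ln\frac{\pi^2}{6}\\ &+\Bigl(\frac{13}{36}\pi^2-\frac13\pi^2\ln2\Bigr)\ln^2\frac{\pi^2}{6}+\frac1{36}\pi^2\ln^3\frac{\pi^2}{6}, \end{aligned} \] and \(S_0^{(3)}\approx0.002686585492882264\), with all the digits shown correct, that is, up to an error of at most \(5\cdot10^{-19}\). -/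

import Mathlib

open Filter Topology Asymptotics

noncomputable section

namespace LaneEmden

/-- The radial Laplacian `(1 / z²) d/dz (z² df/dz)`. -/
def radialLaplacian (f : ℝ → ℝ) (z : ℝ) : ℝ :=
  deriv (fun t => t ^ 2 * deriv f t) z / z ^ 2

/-- `Θ` is a scaled polytrope function of index `n` with scale factor `s`: it solves the scaled
Lane-Emden equation `ℒ[s Θ] + (s Θ)ⁿ = 0` on `(0, π)`, with `Θ(0) = 1`, `Θ'(0) = 0`, and
its first zero is at `π`. -/
structure IsScaledPolytrope (n s : ℝ) (Θ : ℝ → ℝ) : Prop where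
  continuousOn : ContinuousOn Θ (Set.Icc 0 Real.pi)
  contDiffOn : ContDiffOn ℝ 2 Θ (Set.Ioo 0 Real.pi)
  pos : ∀ z ∈ Set.Ico 0 Real.pi, 0 < Θ z
  value_zero : Θ 0 = 1
  deriv_zero : HasDerivWithinAt Θ 0 (Set.Ici 0) 0
  value_pi : Θ Real.pi = 0
  equation : ∀ z ∈ Set.Ioo 0 Real.pi,
    radialLaplacian (fun t => s * Θ t) z + (s * Θ z) ^ n = 0

/-- `s` is an eigenvalue `S(n)` of the scaled Lane-Emden problem of index `n`. -/
def IsScaleFactor (n s : ℝ) : Prop :=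
  0 < s ∧ ∃ Θ : ℝ → ℝ, IsScaledPolytrope n s Θ

/-- The coefficient of `nⁱ` in the expansion in powers of `n` of `(u₀ + n u₁ + n² u₂ + ⋯)ⁿ`. Terms
of the series beyond `u i` do not contribute. For `u 0 > 0` the coefficients for `i = 0, 1, 2`
are `1`, `log u₀` and `u₁ / u₀ + (log u₀)² / 2`. -/
def powerCoeff (u : ℕ → ℝ) (i : ℕ) : ℝ :=
  iteratedDeriv i (fun n : ℝ => (∑ j ∈ Finset.range (i + 1), u j * n ^ j) ^ n) 0
    / (Nat.factorial i : ℝ)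

/-- The coefficient of `nⁱ` in the product `S(n) Θ(z)` of the series `∑ⱼ nʲ S j` and `∑ⱼ nʲ Θ j z`. -/
def productCoeff (S : ℕ → ℝ) (Θ : ℕ → ℝ → ℝ) (i : ℕ) (z : ℝ) : ℝ :=
  ∑ j ∈ Finset.range (i + 1), S j * Θ (i - j) z

/-- `S 0, …, S N` and `Θ 0, …, Θ N` solve the perturbation problem about `n = 0` up to order `N`:
the series `S(n) = ∑ nⁱ S i` and `Θ(z) = ∑ nⁱ Θ i z` satisfy the equation
`ℒ[S Θ] + (S Θ)ⁿ = 0` in each of the orders `n⁰, …, nᴺ`, and `Θ i` satisfies the boundary conditions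
`Θ i 0 = δ_{0 i}`, `(Θ i)'(0) = 0`, `Θ i π = 0`. -/
structure IsPerturbationSolution (N : ℕ) (S : ℕ → ℝ) (Θ : ℕ → ℝ → ℝ) : Prop where
  continuousOn : ∀ i ≤ N, ContinuousOn (Θ i) (Set.Icc 0 Real.pi)
  contDiffOn : ∀ i ≤ N, ContDiffOn ℝ 2 (Θ i) (Set.Ioo 0 Real.pi)
  value_zero : ∀ i ≤ N, Θ i 0 = if i = 0 then 1 else 0
  deriv_zero : ∀ i ≤ N, HasDerivWithinAt (Θ i) 0 (Set.Ici 0) 0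
  value_pi : ∀ i ≤ N, Θ i Real.pi = 0
  equation : ∀ i ≤ N, ∀ z ∈ Set.Ioo 0 Real.pi,
    radialLaplacian (productCoeff S Θ i) z + powerCoeff (fun j => productCoeff S Θ j z) i = 0

end LaneEmden

end

/-! Write w = SΘ and let T = `green` invert −ℒ with regularity at 0 and value 0 at π. The scaled
problem is then the fixed-point equation w = T(wⁿ), and S = w(0). T is linear and order preserving,
so w ↦ T(wⁿ) is monotone and homogeneous of degree n. It therefore contracts Thompson's metric sup
|log w − log v| by the factor n. For 0 ≤ n < 1 Banach's theorem gives exactly one fixed point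
(`exists_scaleFactor`), and an approximate fixed point with error ε lies within ε/(1 − n) of it
(`Comparable.stability`).

The formal expansion is triangular: at order i the product series solves ℒu = −f with a source f
built from lower orders only. Its coefficients are forced to be `groundProfile`, `green source₁`,
`green source₂`, `green source₃`, and S_i is their value at 0. The cubic polynomial in n with these
coefficients satisfies the fixed-point equation up to relative error O(n⁴), uniformly up to π
(`exists_approximant_bound`), so stability turns the formal expansion into a genuine one. The
sources contain powers of log u, singular at π, where u is the ground profile. They are controlled
by an integrable weight, and every potential is bounded by a multiple of u.

For the closed form, the third coefficient is π² ∫₀¹ x(1 − x) f₃(πx) dx. The first-order potential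
is explicit. The second-order potential enters only linearly and is eliminated by Green's identity
against (1 + x) log(1 + x) − 2x log 2 (`Admissible.integral_green_identity`). The remaining
integrand is an elementary derivative plus four logarithmic integrals (`thirdIntegrand_eq`), which
polylogarithms at ±1 and the substitution (1 − x)/(1 + x) reduce to π², log 2 and ζ(3). The decimal
value follows from rational enclosures of π, log 2, ζ(3) and log(π²/6). -/

noncomputable section

namespace LaneEmden

/-! ### The radial Poisson problem: solution operator, comparison bounds, uniqueness. -/

section

open MeasureTheory Set

/-- A source term for the radial Poisson problem: continuous on `[0, π)` and integrable. -/
structure Admissible (f : ℝ → ℝ) : Prop where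
  cont : ContinuousOn f (Ico 0 Real.pi)
  integrable : IntervalIntegrable f volume 0 Real.pi

/-- The mass `∫₀ᵗ x² f(x) dx`. -/
def radialMass (f : ℝ → ℝ) (t : ℝ) : ℝ := ∫ x in (0 : ℝ)..t, x ^ 2 * f x

/-- The flux `t⁻² ∫₀ᵗ x² f(x) dx`. -/
def radialFlux (f : ℝ → ℝ) (t : ℝ) : ℝ := radialMass f t / t ^ 2

/-- The solution of `ℒ u = -f`, `u(π) = 0` that is regular at the origin. -/
def green (f : ℝ → ℝ) (z : ℝ) : ℝ := ∫ t in z..Real.pi, radialFlux f t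

/-- The solution of `ℒ u = -1`. -/
def groundProfile (z : ℝ) : ℝ := (Real.pi ^ 2 - z ^ 2) / 6

theorem groundProfile_pos {z : ℝ} (hz : z ∈ Ico 0 Real.pi) : 0 < groundProfile z := by
  have := hz.1; have := hz.2
  unfold groundProfile; nlinarith

theorem continuous_groundProfile : Continuous groundProfile := by
  unfold groundProfile; fun_prop

theorem groundProfile_pi : groundProfile Real.pi = 0 := by simp [groundProfile]

namespace Admissible

variable {f g : ℝ → ℝ}

theorem add (hf : Admissible f) (hg : Admissible g) : Admissible (fun z => f z + g z) :=
  ⟨hf.cont.add hg.cont, hf.integrable.add hg.integrable⟩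

theorem const_mul (hf : Admissible f) (c : ℝ) : Admissible (fun z => c * f z) :=
  ⟨continuousOn_const.mul hf.cont, hf.integrable.const_mul c⟩

theorem of_continuousOn (hf : ContinuousOn f (Icc 0 Real.pi)) : Admissible f :=
  ⟨hf.mono Ico_subset_Icc_self, ContinuousOn.intervalIntegrable (by
    rwa [uIcc_of_le Real.pi_pos.le])⟩

theorem of_abs_le (hf : ContinuousOn f (Ico 0 Real.pi)) (hg : Admissible g)
    (h : ∀ z ∈ Ico 0 Real.pi, |f z| ≤ g z) : Admissible f := by
  refine ⟨hf, ?_⟩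
  have hg' := hg.integrable
  rw [intervalIntegrable_iff_integrableOn_Ico_of_le Real.pi_pos.le] at hg' ⊢
  refine Integrable.mono' hg' (hf.aestronglyMeasurable measurableSet_Ico) ?_
  exact (ae_restrict_iff' measurableSet_Ico).2 (Eventually.of_forall h)

theorem sq_mul (hf : Admissible f) : Admissible (fun z => z ^ 2 * f z) :=
  ⟨by have := hf.cont; fun_prop, hf.integrable.continuousOn_mul (by fun_prop)⟩

theorem intervalIntegrable_mass (hf : Admissible f) {a b : ℝ} (ha : a ∈ Icc 0 Real.pi)
    (hb : b ∈ Icc 0 Real.pi) : IntervalIntegrable (fun z => z ^ 2 * f z) volume a b := by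
  refine hf.sq_mul.integrable.mono_set ?_
  rw [uIcc_of_le Real.pi_pos.le]
  exact uIcc_subset_Icc ha hb

theorem continuousOn_mass (hf : Admissible f) : ContinuousOn (radialMass f) (Icc 0 Real.pi) := by
  have := hf.sq_mul.integrable
  rw [intervalIntegrable_iff_integrableOn_Icc_of_le Real.pi_pos.le] at this
  have h := intervalIntegral.continuousOn_primitive_interval (a := 0) (b := Real.pi)
    (f := fun z => z ^ 2 * f z) (μ := volume) (by rwa [uIcc_of_le Real.pi_pos.le])
  rwa [uIcc_of_le Real.pi_pos.le] at h

theorem hasDerivAt_mass (hf : Admissible f) {z : ℝ} (hz : z ∈ Ioo 0 Real.pi) :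
    HasDerivAt (radialMass f) (z ^ 2 * f z) z := by
  have hc : ContinuousOn (fun z => z ^ 2 * f z) (Ioo 0 Real.pi) :=
    hf.sq_mul.cont.mono Ioo_subset_Ico_self
  refine intervalIntegral.integral_hasDerivAt_right
    (hf.intervalIntegrable_mass ⟨le_rfl, Real.pi_pos.le⟩ ⟨hz.1.le, hz.2.le⟩)
    (hc.stronglyMeasurableAtFilter isOpen_Ioo z hz) (hc.continuousAt (Ioo_mem_nhds hz.1 hz.2))

/-- Near 0 the source is bounded, so the factor x² gives order t³. Away from 0 the source may blow
up at π, but t³ is bounded below there and the mass is continuous, hence bounded. -/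
theorem exists_mass_le (hf : Admissible f) :
    ∃ C, 0 ≤ C ∧ ∀ t ∈ Icc 0 Real.pi, |radialMass f t| ≤ C * t ^ 3 := by
  have hpi := Real.pi_pos
  obtain ⟨m, hm⟩ := (isCompact_Icc (a := (0 : ℝ)) (b := Real.pi / 2)).exists_bound_of_continuousOn
    (hf.cont.mono (fun x hx => ⟨hx.1, by linarith [hx.2]⟩))
  obtain ⟨B, hB⟩ := (isCompact_Icc (a := (0 : ℝ)) (b := Real.pi)).exists_bound_of_continuousOn
    hf.continuousOn_mass
  have hm0 : 0 ≤ m := (norm_nonneg _).trans (hm 0 ⟨le_rfl, by positivity⟩)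
  have hB0 : 0 ≤ B := (norm_nonneg _).trans (hB 0 ⟨le_rfl, by positivity⟩)
  refine ⟨m + B / (Real.pi / 2) ^ 3, by positivity, fun t ht => ?_⟩
  have ht0 := ht.1
  rcases le_total t (Real.pi / 2) with h | h
  · have h1 : ‖radialMass f t‖ ≤ (t ^ 2 * m) * |t - 0| := by
      refine intervalIntegral.norm_integral_le_of_norm_le_const (fun x hx => ?_)
      rw [uIoc_of_le ht.1] at hx
      rw [norm_mul, Real.norm_of_nonneg (by positivity)]
      have := hm x ⟨hx.1.le, hx.2.trans h⟩
      have h2 : x ^ 2 ≤ t ^ 2 := pow_le_pow_left₀ hx.1.le hx.2 2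
      gcongr
    rw [sub_zero, abs_of_nonneg ht.1] at h1
    have : 0 ≤ B / (Real.pi / 2) ^ 3 * t ^ 3 := by positivity
    rw [← Real.norm_eq_abs]
    nlinarith
  · have h1 := hB t ht
    have h2 : (Real.pi / 2) ^ 3 ≤ t ^ 3 := pow_le_pow_left₀ (by positivity) h 3
    have h3 : B ≤ B / (Real.pi / 2) ^ 3 * t ^ 3 := by
      rw [div_mul_eq_mul_div, le_div_iff₀ (by positivity)]
      gcongr
    have : 0 ≤ m * t ^ 3 := by positivity
    rw [← Real.norm_eq_abs]
    nlinarith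

theorem exists_flux_le (hf : Admissible f) :
    ∃ C, 0 ≤ C ∧ ∀ t ∈ Icc 0 Real.pi, |radialFlux f t| ≤ C * t := by
  obtain ⟨C, hC, h⟩ := hf.exists_mass_le
  refine ⟨C, hC, fun t ht => ?_⟩
  rcases ht.1.eq_or_lt with h0 | h0
  · subst h0; simp [radialFlux]
  · rw [radialFlux, abs_div, abs_of_pos (by positivity : 0 < t ^ 2), div_le_iff₀ (by positivity)]
    calc _ ≤ _ := h t ht
      _ = _ := by ring

theorem continuousOn_flux (hf : Admissible f) : ContinuousOn (radialFlux f) (Icc 0 Real.pi) := by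
  intro t ht
  rcases ht.1.eq_or_lt with h0 | h0
  · subst h0
    obtain ⟨C, hC, h⟩ := hf.exists_flux_le
    -- Division by zero returns 0, which is also the limit of the flux by the linear bound.
    have : radialFlux f 0 = 0 := by simp [radialFlux]
    rw [ContinuousWithinAt, this]
    refine squeeze_zero_norm' (a := fun t => C * t)
      (eventually_nhdsWithin_of_forall fun t ht => h t ht) ?_
    have : Continuous fun t : ℝ => C * t := by fun_prop
    simpa using (this.tendsto 0).mono_left nhdsWithin_le_nhds
  · exact (hf.continuousOn_mass t ht).div (by fun_prop) (by positivity)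

theorem hasDerivAt_flux (hf : Admissible f) {z : ℝ} (hz : z ∈ Ioo 0 Real.pi) :
    HasDerivAt (radialFlux f) (f z - 2 * radialFlux f z / z) z := by
  have h0 := hz.1
  have := (hf.hasDerivAt_mass hz).div (hasDerivAt_pow 2 z) (by positivity)
  refine this.congr_deriv ?_
  unfold radialFlux
  field_simp
  ring

theorem intervalIntegrable_flux (hf : Admissible f) {a b : ℝ} (ha : a ∈ Icc 0 Real.pi)
    (hb : b ∈ Icc 0 Real.pi) : IntervalIntegrable (radialFlux f) volume a b :=
  (hf.continuousOn_flux.mono (uIcc_subset_Icc ha hb)).intervalIntegrable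

/-- Moves the variable to the upper endpoint, the form in which the fundamental theorem of calculus
is applied next. -/
theorem green_eq (hf : Admissible f) {z : ℝ} (hz : z ∈ Icc 0 Real.pi) :
    green f z = green f 0 - ∫ t in (0 : ℝ)..z, radialFlux f t := by
  have h0 : (0 : ℝ) ∈ Icc 0 Real.pi := ⟨le_rfl, Real.pi_pos.le⟩
  have h1 : Real.pi ∈ Icc 0 Real.pi := ⟨Real.pi_pos.le, le_rfl⟩
  rw [green, green, ← intervalIntegral.integral_add_adjacent_intervals
    (hf.intervalIntegrable_flux h0 hz) (hf.intervalIntegrable_flux hz h1)]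
  ring

theorem hasDerivWithinAt_green (hf : Admissible f) {z : ℝ} (hz : z ∈ Icc 0 Real.pi) :
    HasDerivWithinAt (green f) (-radialFlux f z) (Icc 0 Real.pi) z := by
  have h0 : (0 : ℝ) ∈ Icc 0 Real.pi := ⟨le_rfl, Real.pi_pos.le⟩
  have : Fact (z ∈ Icc 0 Real.pi) := ⟨hz⟩
  have h := intervalIntegral.integral_hasDerivWithinAt_right (f := radialFlux f)
    (s := Icc 0 Real.pi) (t := Icc 0 Real.pi) (hf.intervalIntegrable_flux h0 hz)
    (hf.continuousOn_flux.stronglyMeasurableAtFilter_nhdsWithin measurableSet_Icc z)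
    (hf.continuousOn_flux z hz)
  refine (h.const_sub (green f 0)).congr (fun y hy => ?_) ?_
  · exact hf.green_eq hy
  · exact hf.green_eq hz

theorem hasDerivAt_green (hf : Admissible f) {z : ℝ} (hz : z ∈ Ioo 0 Real.pi) :
    HasDerivAt (green f) (-radialFlux f z) z :=
  (hf.hasDerivWithinAt_green ⟨hz.1.le, hz.2.le⟩).hasDerivAt (Icc_mem_nhds hz.1 hz.2)

theorem continuousOn_green (hf : Admissible f) : ContinuousOn (green f) (Icc 0 Real.pi) :=
  fun _ hz => (hf.hasDerivWithinAt_green hz).continuousWithinAt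

theorem hasDerivWithinAt_green_zero (hf : Admissible f) :
    HasDerivWithinAt (green f) 0 (Ici 0) 0 := by
  have h0 : (0 : ℝ) ∈ Icc 0 Real.pi := ⟨le_rfl, Real.pi_pos.le⟩
  have := hf.hasDerivWithinAt_green h0
  rw [show -radialFlux f 0 = 0 by simp [radialFlux]] at this
  exact this.mono_of_mem_nhdsWithin (Icc_mem_nhdsGE Real.pi_pos)

theorem contDiffOn_green (hf : Admissible f) : ContDiffOn ℝ 2 (green f) (Ioo 0 Real.pi) := by
  have hd : ∀ z ∈ Ioo 0 Real.pi, deriv (green f) z = -radialFlux f z :=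
    fun z hz => (hf.hasDerivAt_green hz).deriv
  rw [show (2 : WithTop ℕ∞) = 1 + 1 by norm_num, contDiffOn_succ_iff_deriv_of_isOpen isOpen_Ioo]
  refine ⟨fun z hz => (hf.hasDerivAt_green hz).differentiableAt.differentiableWithinAt,
    by simp, ?_⟩
  refine ContDiffOn.congr ?_ hd
  rw [show (1 : WithTop ℕ∞) = 0 + 1 by norm_num, contDiffOn_succ_iff_deriv_of_isOpen isOpen_Ioo]
  refine ⟨fun z hz => (hf.hasDerivAt_flux hz).neg.differentiableAt.differentiableWithinAt,
    by simp, ?_⟩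
  rw [contDiffOn_zero]
  refine ContinuousOn.congr (f := fun z => -(f z - 2 * radialFlux f z / z)) ?_
    (fun z hz => (hf.hasDerivAt_flux hz).neg.deriv)
  have h1 := hf.cont.mono Ioo_subset_Ico_self
  have h2 := hf.continuousOn_flux.mono Ioo_subset_Icc_self
  exact (h1.sub ((continuousOn_const.mul h2).div continuousOn_id fun z hz => hz.1.ne')).neg

theorem radialLaplacian_green (hf : Admissible f) {z : ℝ} (hz : z ∈ Ioo 0 Real.pi) :
    radialLaplacian (green f) z = -f z := by
  have hz0 := hz.1
  have : (fun t => t ^ 2 * deriv (green f) t) =ᶠ[𝓝 z] fun t => -radialMass f t := by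
    filter_upwards [Ioo_mem_nhds hz.1 hz.2] with t ht
    have ht0 := ht.1
    rw [(hf.hasDerivAt_green ht).deriv, radialFlux]
    field_simp
  rw [radialLaplacian, this.deriv_eq, (hf.hasDerivAt_mass hz).fun_neg.deriv]
  field_simp

end Admissible

theorem green_pi (f : ℝ → ℝ) : green f Real.pi = 0 := by simp [green]

section order

variable {f g : ℝ → ℝ}

theorem radialMass_mono (hf : Admissible f) (hg : Admissible g)
    (h : ∀ z ∈ Ico 0 Real.pi, f z ≤ g z) {t : ℝ} (ht : t ∈ Icc 0 Real.pi) :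
    radialMass f t ≤ radialMass g t := by
  have h0 : (0 : ℝ) ∈ Icc 0 Real.pi := ⟨le_rfl, Real.pi_pos.le⟩
  refine intervalIntegral.integral_mono_on_of_le_Ioo ht.1 (hf.intervalIntegrable_mass h0 ht)
    (hg.intervalIntegrable_mass h0 ht) (fun x hx => ?_)
  have := h x ⟨hx.1.le, hx.2.trans_le ht.2⟩
  gcongr

/-- The comparison flux ct integrates over [z, π] to c(π² − z²)/2, which is 3c times the ground
profile. -/
theorem green_le_of_flux_le (hf : Admissible f) {c : ℝ}
    (h : ∀ t ∈ Icc 0 Real.pi, radialFlux f t ≤ c * t) {z : ℝ} (hz : z ∈ Icc 0 Real.pi) :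
    green f z ≤ 3 * c * groundProfile z := by
  have h1 : Real.pi ∈ Icc 0 Real.pi := ⟨Real.pi_pos.le, le_rfl⟩
  have := intervalIntegral.integral_mono_on hz.2 (hf.intervalIntegrable_flux hz h1)
    (Continuous.intervalIntegrable (by fun_prop : Continuous fun t : ℝ => c * t) _ _)
    (fun t ht => h t ⟨hz.1.trans ht.1, ht.2⟩)
  refine this.trans_eq ?_
  rw [intervalIntegral.integral_const_mul, integral_id, groundProfile]
  ring

theorem le_green_of_le_flux (hf : Admissible f) {c : ℝ}
    (h : ∀ t ∈ Icc 0 Real.pi, c * t ≤ radialFlux f t) {z : ℝ} (hz : z ∈ Icc 0 Real.pi) :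
    3 * c * groundProfile z ≤ green f z := by
  have h1 : Real.pi ∈ Icc 0 Real.pi := ⟨Real.pi_pos.le, le_rfl⟩
  have := intervalIntegral.integral_mono_on hz.2
    (Continuous.intervalIntegrable (by fun_prop : Continuous fun t : ℝ => c * t) _ _)
    (hf.intervalIntegrable_flux hz h1) (fun t ht => h t ⟨hz.1.trans ht.1, ht.2⟩)
  refine Eq.trans_le ?_ this
  rw [intervalIntegral.integral_const_mul, integral_id, groundProfile]
  ring

theorem green_mono (hf : Admissible f) (hg : Admissible g)
    (h : ∀ z ∈ Ico 0 Real.pi, f z ≤ g z) {z : ℝ} (hz : z ∈ Icc 0 Real.pi) :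
    green f z ≤ green g z := by
  have h1 : Real.pi ∈ Icc 0 Real.pi := ⟨Real.pi_pos.le, le_rfl⟩
  refine intervalIntegral.integral_mono_on hz.2 (hf.intervalIntegrable_flux hz h1)
    (hg.intervalIntegrable_flux hz h1) (fun t ht => ?_)
  have := radialMass_mono hf hg h (t := t) ⟨hz.1.trans ht.1, ht.2⟩
  unfold radialFlux
  gcongr

theorem green_add (hf : Admissible f) (hg : Admissible g) {z : ℝ} (hz : z ∈ Icc 0 Real.pi) :
    green (fun x => f x + g x) z = green f z + green g z := by
  have h0 : (0 : ℝ) ∈ Icc 0 Real.pi := ⟨le_rfl, Real.pi_pos.le⟩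
  have h1 : Real.pi ∈ Icc 0 Real.pi := ⟨Real.pi_pos.le, le_rfl⟩
  unfold green
  rw [← intervalIntegral.integral_add (hf.intervalIntegrable_flux hz h1)
    (hg.intervalIntegrable_flux hz h1)]
  refine intervalIntegral.integral_congr (fun t ht => ?_)
  rw [uIcc_of_le hz.2] at ht
  have ht' : t ∈ Icc 0 Real.pi := ⟨hz.1.trans ht.1, ht.2⟩
  simp only [radialFlux, radialMass]
  rw [← add_div, ← intervalIntegral.integral_add (hf.intervalIntegrable_mass h0 ht')
    (hg.intervalIntegrable_mass h0 ht')]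
  simp only [mul_add]

theorem green_const_mul (c : ℝ) (f : ℝ → ℝ) (z : ℝ) :
    green (fun x => c * f x) z = c * green f z := by
  unfold green
  rw [← intervalIntegral.integral_const_mul]
  congr 1; ext t
  simp only [radialFlux, radialMass]
  rw [mul_div_assoc', ← intervalIntegral.integral_const_mul]
  congr 2; ext x; ring

theorem exists_abs_green_le (hf : Admissible f) :
    ∃ C, 0 ≤ C ∧ ∀ z ∈ Icc 0 Real.pi, |green f z| ≤ C * groundProfile z := by
  obtain ⟨C, hC, h⟩ := hf.exists_flux_le
  refine ⟨3 * C, by positivity, fun z hz => abs_le.2 ⟨?_, ?_⟩⟩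
  · have := le_green_of_le_flux hf (c := -C)
      (fun t ht => by have := (abs_le.1 (h t ht)).1; linarith) hz
    linarith
  · exact green_le_of_flux_le hf (fun t ht => (abs_le.1 (h t ht)).2) hz

/-- A Hopf-type bound: a positive source has mass at least of order t³, so its potential leaves 0 at
π with non-zero slope. -/
theorem exists_le_green (hf : Admissible f) (hpos : ∀ z ∈ Ico 0 Real.pi, 0 < f z) :
    ∃ c, 0 < c ∧ ∀ z ∈ Icc 0 Real.pi, c * groundProfile z ≤ green f z := by
  have hpi := Real.pi_pos
  have h0 : (0 : ℝ) ∈ Icc 0 Real.pi := ⟨le_rfl, Real.pi_pos.le⟩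
  have hsub : Icc 0 (Real.pi / 2) ⊆ Ico 0 Real.pi := fun x hx => ⟨hx.1, by linarith [hx.2]⟩
  obtain ⟨y, hy, hmin⟩ := (isCompact_Icc (a := (0 : ℝ)) (b := Real.pi / 2)).exists_isMinOn
    ⟨0, by constructor <;> linarith⟩ (hf.cont.mono hsub)
  have hm : 0 < f y := hpos y (hsub hy)
  have hmass : ∀ t ∈ Icc 0 (Real.pi / 2), f y * (t ^ 3 / 3) ≤ radialMass f t := by
    intro t ht
    have ht' : t ∈ Icc 0 Real.pi := ⟨ht.1, by linarith [ht.2]⟩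
    have : ∫ x in (0 : ℝ)..t, f y * x ^ 2 = f y * (t ^ 3 / 3) := by
      rw [intervalIntegral.integral_const_mul, integral_pow]; norm_num
    rw [← this]
    refine intervalIntegral.integral_mono_on ht.1
      (Continuous.intervalIntegrable (by fun_prop) _ _)
      (hf.intervalIntegrable_mass h0 ht') (fun x hx => ?_)
    have : f y ≤ f x := hmin ⟨hx.1, hx.2.trans ht.2⟩
    nlinarith [sq_nonneg x]
  -- The mass at π/2 is at least f(y)(π/2)³/3 = f(y)π³/24. It does not decrease afterwards, so the
  -- mass is at least f(y)t³/24 on all of [0, π].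
  refine ⟨3 * (f y / 24), by positivity, fun z hz => le_green_of_le_flux hf (fun t ht => ?_) hz⟩
  rcases ht.1.eq_or_lt with h | h
  · subst h; simp [radialFlux]
  rw [radialFlux, le_div_iff₀ (by positivity)]
  have h8 : 0 < f y * t ^ 3 := by positivity
  rcases le_total t (Real.pi / 2) with h2 | h2
  · have := hmass t ⟨h.le, h2⟩
    nlinarith
  · have h3 := hmass (Real.pi / 2) ⟨by positivity, le_rfl⟩
    have hmem : Real.pi / 2 ∈ Icc 0 Real.pi := ⟨by positivity, by linarith⟩
    have h4 : radialMass f (Real.pi / 2) ≤ radialMass f t := by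
      have h6 : 0 ≤ ∫ x in (Real.pi / 2)..t, x ^ 2 * f x := by
        have := intervalIntegral.integral_mono_on_of_le_Ioo (f := fun _ => (0 : ℝ))
          (g := fun x => x ^ 2 * f x) (μ := volume) h2 (by simp)
          (hf.intervalIntegrable_mass hmem ht) (fun x hx => by
            have h7 := hpos x ⟨by linarith [hx.1], hx.2.trans_le ht.2⟩
            positivity)
        simpa using this
      unfold radialMass
      rw [← intervalIntegral.integral_add_adjacent_intervals
        (hf.intervalIntegrable_mass h0 hmem) (hf.intervalIntegrable_mass hmem ht)]
      linarith
    have h5 : t ^ 3 ≤ Real.pi ^ 3 := pow_le_pow_left₀ h.le ht.2 3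
    have : f y * t ^ 3 ≤ f y * Real.pi ^ 3 := by gcongr
    nlinarith

end order

theorem const_of_hasDerivAt_zero {d : ℝ → ℝ} {a b : ℝ} (h : ∀ z ∈ Ioo a b, HasDerivAt d 0 z)
    {x y : ℝ} (hx : x ∈ Ioo a b) (hy : y ∈ Ioo a b) : d x = d y :=
  isOpen_Ioo.is_const_of_deriv_eq_zero isPreconnected_Ioo
    (fun z hz => (h z hz).differentiableAt.differentiableWithinAt) (fun z hz => (h z hz).deriv)
    hx hy

theorem _root_.ContDiffOn.hasDerivAt_pair {u : ℝ → ℝ} {a b : ℝ} (hu : ContDiffOn ℝ 2 u (Ioo a b))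
    {z : ℝ} (hz : z ∈ Ioo a b) :
    HasDerivAt u (deriv u z) z ∧ HasDerivAt (deriv u) (deriv (deriv u) z) z := by
  have hn := Ioo_mem_nhds hz.1 hz.2
  have h := (contDiffOn_succ_iff_deriv_of_isOpen (n := 1) (𝕜 := ℝ) (f := u) isOpen_Ioo).1
    (by simpa [one_add_one_eq_two] using hu)
  exact ⟨((h.1 z hz).differentiableAt hn).hasDerivAt,
    ((h.2.2.differentiableOn (by norm_num) z hz).differentiableAt hn).hasDerivAt⟩

/-- A function whose radial Laplacian vanishes, continuous at the origin and zero at `π`, is zero. -/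
theorem eq_zero_of_radial_harmonic {d : ℝ → ℝ} (hc : ContinuousOn d (Icc 0 Real.pi))
    (hd : ContDiffOn ℝ 2 d (Ioo 0 Real.pi))
    (h : ∀ z ∈ Ioo 0 Real.pi, radialLaplacian d z = 0) (hpi : d Real.pi = 0) :
    ∀ z ∈ Icc 0 Real.pi, d z = 0 := by
  have hpp := Real.pi_pos
  have hmid : Real.pi / 2 ∈ Ioo 0 Real.pi := ⟨by linarith, by linarith⟩
  have h1 : ∀ z ∈ Ioo 0 Real.pi, HasDerivAt (fun t => t ^ 2 * deriv d t) 0 z := by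
    intro z hz
    have h2 := ((hasDerivAt_pow 2 z).mul (hd.hasDerivAt_pair hz).2)
    have h3 := h z hz
    have h4 : deriv (fun t => t ^ 2 * deriv d t) z = 0 := by
      have hz0 := hz.1
      unfold radialLaplacian at h3
      rcases div_eq_zero_iff.1 h3 with h5 | h5
      · exact h5
      · exact absurd h5 (by positivity)
    have h5 := h2.differentiableAt.hasDerivAt
    rw [← h4]; exact h5
  obtain ⟨c, hcdef⟩ : ∃ c, ∀ z ∈ Ioo 0 Real.pi, z ^ 2 * deriv d z = c :=
    ⟨_, fun z hz => const_of_hasDerivAt_zero h1 hz hmid⟩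
  have h2 : ∀ z ∈ Ioo 0 Real.pi, HasDerivAt (fun t => d t + c * t⁻¹) 0 z := by
    intro z hz
    have hz0 := hz.1
    refine ((hd.hasDerivAt_pair hz).1.add ((hasDerivAt_inv hz0.ne').const_mul c)).congr_deriv ?_
    rw [← hcdef z hz]; field_simp; ring
  obtain ⟨e, he⟩ : ∃ e, ∀ z ∈ Ioo 0 Real.pi, d z + c * z⁻¹ = e :=
    ⟨_, fun z hz => const_of_hasDerivAt_zero h2 hz hmid⟩
  have hcl : closure (Ioo 0 Real.pi) = Icc 0 Real.pi := closure_Ioo hpp.ne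
  -- On the open interval d = e − c/z. Multiplied by z, the relation extends by continuity to the
  -- closed interval: the value at 0 kills the singular solution c/z, and the value at π kills the
  -- constant.
  have h3 : EqOn (fun z => z * d z + c) (fun z => e * z) (Icc 0 Real.pi) := by
    refine EqOn.of_subset_closure (s := Ioo 0 Real.pi) (fun z hz => ?_)
      ((continuousOn_id.mul hc).add continuousOn_const) (by fun_prop) Ioo_subset_Icc_self
      hcl.ge
    have hz0 := hz.1
    simp only [← he z hz]; field_simp
  have hc0 : c = 0 := by simpa using h3 ⟨le_rfl, hpp.le⟩
  have he0 : e = 0 := by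
    have := h3 ⟨hpp.le, le_rfl⟩
    simp [hpi, hc0, hpp.ne'] at this
    exact this
  have h4 : EqOn d (fun _ => 0) (Icc 0 Real.pi) := by
    refine EqOn.of_subset_closure (s := Ioo 0 Real.pi) (fun z hz => ?_) hc (by fun_prop)
      Ioo_subset_Icc_self hcl.ge
    simpa [hc0, he0] using he z hz
  exact h4

theorem radialLaplacian_sub {u v : ℝ → ℝ} (hu : ContDiffOn ℝ 2 u (Ioo 0 Real.pi))
    (hv : ContDiffOn ℝ 2 v (Ioo 0 Real.pi)) {z : ℝ} (hz : z ∈ Ioo 0 Real.pi) :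
    radialLaplacian (fun t => u t - v t) z = radialLaplacian u z - radialLaplacian v z := by
  have h : (fun t => t ^ 2 * deriv (fun t => u t - v t) t) =ᶠ[𝓝 z]
      fun t => t ^ 2 * deriv u t - t ^ 2 * deriv v t := by
    filter_upwards [Ioo_mem_nhds hz.1 hz.2] with t ht
    rw [((hu.hasDerivAt_pair ht).1.fun_sub (hv.hasDerivAt_pair ht).1).deriv, mul_sub]
  unfold radialLaplacian
  rw [h.deriv_eq, ← sub_div]
  congr 1
  exact deriv_fun_sub ((hasDerivAt_pow 2 z).mul (hu.hasDerivAt_pair hz).2).differentiableAt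
    ((hasDerivAt_pow 2 z).mul (hv.hasDerivAt_pair hz).2).differentiableAt

theorem eqOn_green {u f : ℝ → ℝ} (hc : ContinuousOn u (Icc 0 Real.pi))
    (hu : ContDiffOn ℝ 2 u (Ioo 0 Real.pi)) (hf : Admissible f)
    (h : ∀ z ∈ Ioo 0 Real.pi, radialLaplacian u z + f z = 0) (hpi : u Real.pi = 0) :
    ∀ z ∈ Icc 0 Real.pi, u z = green f z := by
  intro z hz
  refine sub_eq_zero.1 (eq_zero_of_radial_harmonic (d := fun z => u z - green f z)
    (hc.sub hf.continuousOn_green) (hu.sub hf.contDiffOn_green) (fun z hz => ?_)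
    (by simp [hpi, green_pi]) z hz)
  rw [radialLaplacian_sub hu hf.contDiffOn_green hz, hf.radialLaplacian_green hz]
  linarith [h z hz]

theorem admissible_const (c : ℝ) : Admissible fun _ => c :=
  Admissible.of_continuousOn continuousOn_const

theorem green_one {z : ℝ} (hz : z ∈ Icc 0 Real.pi) : green (fun _ => 1) z = groundProfile z := by
  have hd : ∀ z, HasDerivAt groundProfile (-z / 3) z := by
    intro z
    refine (((hasDerivAt_pow 2 z).const_sub (Real.pi ^ 2)).div_const 6).congr_deriv ?_
    norm_num; ring
  refine (eqOn_green continuous_groundProfile.continuousOn ?_ (admissible_const 1) ?_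
    groundProfile_pi z hz).symm
  · unfold groundProfile; fun_prop
  · intro z hz
    have hz0 := hz.1
    have : (fun t => t ^ 2 * deriv groundProfile t) = fun t => -(t ^ 3) / 3 := by
      ext t; rw [(hd t).deriv]; ring
    rw [radialLaplacian, this, ((hasDerivAt_pow 3 z).fun_neg.div_const 3).deriv]
    field_simp; norm_num

end

/-! ### Contraction in Thompson's metric: existence and uniqueness of the scale factor. -/

section

open MeasureTheory Set

/-- Positive continuous functions on `[0, π)` at finite Thompson distance from `groundProfile`. -/
structure Comparable (w : ℝ → ℝ) : Prop where
  cont : ContinuousOn w (Ico 0 Real.pi)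
  pos : ∀ z ∈ Ico 0 Real.pi, 0 < w z
  bound : ∃ A, ∀ z ∈ Ico 0 Real.pi, |Real.log (w z) - Real.log (groundProfile z)| ≤ A

theorem groundProfile_le_two (z : ℝ) : groundProfile z ≤ 2 := by
  have := Real.pi_lt_d2
  have := Real.pi_pos
  unfold groundProfile
  nlinarith [sq_nonneg z]

theorem comparable_of_bounds {w : ℝ → ℝ} (hw : ContinuousOn w (Ico 0 Real.pi)) {c C : ℝ}
    (hc : 0 < c) (h1 : ∀ z ∈ Ico 0 Real.pi, c * groundProfile z ≤ w z)
    (h2 : ∀ z ∈ Ico 0 Real.pi, w z ≤ C * groundProfile z) : Comparable w := by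
  have hpos : ∀ z ∈ Ico 0 Real.pi, 0 < w z := fun z hz =>
    (mul_pos hc (groundProfile_pos hz)).trans_le (h1 z hz)
  refine ⟨hw, hpos, |Real.log c| + |Real.log C|, fun z hz => ?_⟩
  have hu := groundProfile_pos hz
  have hC : 0 < C := by
    have := (hpos z hz).trans_le (h2 z hz)
    exact pos_of_mul_pos_left this hu.le
  have e1 := Real.log_le_log (by positivity) (h1 z hz)
  have e2 := Real.log_le_log (hpos z hz) (h2 z hz)
  rw [Real.log_mul hc.ne' hu.ne'] at e1
  rw [Real.log_mul hC.ne' hu.ne'] at e2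
  have := neg_abs_le (Real.log c)
  have := le_abs_self (Real.log C)
  have := abs_nonneg (Real.log c)
  have := abs_nonneg (Real.log C)
  exact abs_le.2 ⟨by linarith, by linarith⟩

theorem comparable_green {f : ℝ → ℝ} (hf : Admissible f) (hpos : ∀ z ∈ Ico 0 Real.pi, 0 < f z) :
    Comparable (green f) := by
  obtain ⟨C, -, hC⟩ := exists_abs_green_le hf
  obtain ⟨c, hc, h⟩ := exists_le_green hf hpos
  exact comparable_of_bounds (hf.continuousOn_green.mono Ico_subset_Icc_self) hc
    (fun z hz => h z (Ico_subset_Icc_self hz))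
    (fun z hz => (le_abs_self _).trans (hC z (Ico_subset_Icc_self hz)))

namespace Comparable

variable {w v : ℝ → ℝ} {n : ℝ}

theorem rpow_pos (hw : Comparable w) : ∀ z ∈ Ico 0 Real.pi, 0 < w z ^ n :=
  fun z hz => Real.rpow_pos_of_pos (hw.pos z hz) n

theorem admissible_rpow (hw : Comparable w) (hn : 0 ≤ n) : Admissible fun z => w z ^ n := by
  obtain ⟨A, hA⟩ := hw.bound
  refine Admissible.of_abs_le (hw.cont.rpow_const fun z hz => Or.inl (hw.pos z hz).ne')
    (admissible_const ((Real.exp A * 2) ^ n)) (fun z hz => ?_)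
  rw [abs_of_pos (hw.rpow_pos z hz)]
  refine Real.rpow_le_rpow (hw.pos z hz).le ?_ hn
  have hu := groundProfile_pos hz
  have h1 : Real.log (w z) ≤ A + Real.log (groundProfile z) := by linarith [(abs_le.1 (hA z hz)).2]
  rw [Real.log_le_iff_le_exp (hw.pos z hz), Real.exp_add, Real.exp_log hu] at h1
  exact h1.trans (mul_le_mul_of_nonneg_left (groundProfile_le_two z) (Real.exp_pos A).le)

theorem green_rpow (hw : Comparable w) (hn : 0 ≤ n) : Comparable (green fun z => w z ^ n) :=
  comparable_green (hw.admissible_rpow hn) hw.rpow_pos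

theorem dist_bound (hw : Comparable w) (hv : Comparable v) :
    ∃ D, 0 ≤ D ∧ ∀ z ∈ Ico 0 Real.pi, |Real.log (w z) - Real.log (v z)| ≤ D := by
  obtain ⟨A, hA⟩ := hw.bound
  obtain ⟨B, hB⟩ := hv.bound
  refine ⟨|A + B|, abs_nonneg _, fun z hz => ?_⟩
  have h1 := abs_sub_le (Real.log (w z)) (Real.log (groundProfile z)) (Real.log (v z))
  rw [abs_sub_comm (Real.log (groundProfile z))] at h1
  linarith [hA z hz, hB z hz, le_abs_self (A + B)]

/-- From w ≤ e^d v follows wⁿ ≤ e^{nd} vⁿ. The potential is monotone and linear, so the constant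
e^{nd} passes through it. -/
theorem log_green_le (hw : Comparable w) (hv : Comparable v) (hn : 0 ≤ n) {d : ℝ}
    (h : ∀ z ∈ Ico 0 Real.pi, Real.log (w z) ≤ d + Real.log (v z)) :
    ∀ z ∈ Ico 0 Real.pi, Real.log (green (fun z => w z ^ n) z) ≤
      n * d + Real.log (green (fun z => v z ^ n) z) := by
  intro z hz
  have h1 := green_mono (hw.admissible_rpow hn) ((hv.admissible_rpow hn).const_mul (Real.exp (n * d)))
    (fun x hx => ?_) (Ico_subset_Icc_self hz)
  · rw [green_const_mul] at h1
    have h2 := Real.log_le_log ((hw.green_rpow hn).pos z hz) h1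
    rwa [Real.log_mul (Real.exp_pos _).ne' ((hv.green_rpow hn).pos z hz).ne', Real.log_exp] at h2
  · rw [Real.rpow_def_of_pos (hw.pos x hx), Real.rpow_def_of_pos (hv.pos x hx), ← Real.exp_add]
    refine Real.exp_le_exp.2 ?_
    nlinarith [h x hx]

/-- The map `w ↦ T(wⁿ)` contracts Thompson's metric by the factor `n`. -/
theorem green_contract (hw : Comparable w) (hv : Comparable v) (hn : 0 ≤ n) {d : ℝ}
    (h : ∀ z ∈ Ico 0 Real.pi, |Real.log (w z) - Real.log (v z)| ≤ d) :
    ∀ z ∈ Ico 0 Real.pi, |Real.log (green (fun z => w z ^ n) z) -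
      Real.log (green (fun z => v z ^ n) z)| ≤ n * d := by
  intro z hz
  have h1 := log_green_le hw hv hn (d := d) (fun z hz => by linarith [(abs_le.1 (h z hz)).2]) z hz
  have h2 := log_green_le hv hw hn (d := d) (fun z hz => by linarith [(abs_le.1 (h z hz)).1]) z hz
  exact abs_le.2 ⟨by linarith, by linarith⟩

/-- An approximate fixed point of `w ↦ T(wⁿ)` is close to an exact one. -/
theorem stability (hu : Comparable w) (hv : Comparable v) (hn : 0 ≤ n) (hn1 : n < 1)
    (hfix : ∀ z ∈ Ico 0 Real.pi, green (fun z => w z ^ n) z = w z) {ε : ℝ}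
    (h : ∀ z ∈ Ico 0 Real.pi,
      |Real.log (green (fun z => v z ^ n) z) - Real.log (v z)| ≤ ε) :
    ∀ z ∈ Ico 0 Real.pi, |Real.log (w z) - Real.log (v z)| ≤ ε / (1 - n) := by
  obtain ⟨D, hD, hb⟩ := hu.dist_bound hv
  have hn2 : 0 < 1 - n := by linarith
  have hε : 0 ≤ ε := (abs_nonneg _).trans (h 0 ⟨le_rfl, Real.pi_pos⟩)
  -- The distance is finite a priori, by D. One application of the map improves a bound b to nb + ε,
  -- and ε/(1 − n) is the fixed point of b ↦ nb + ε.
  have key : ∀ k : ℕ, ∀ z ∈ Ico 0 Real.pi,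
      |Real.log (w z) - Real.log (v z)| ≤ n ^ k * D + ε / (1 - n) := by
    intro k
    induction k with
    | zero =>
      intro z hz
      have : 0 ≤ ε / (1 - n) := by positivity
      linarith [hb z hz]
    | succ k ih =>
      intro z hz
      have h1 := green_contract hu hv hn ih z hz
      rw [hfix z hz] at h1
      have h2 := abs_sub_le (Real.log (w z)) (Real.log (green (fun z => v z ^ n) z))
        (Real.log (v z))
      have h3 : n * (n ^ k * D + ε / (1 - n)) + ε = n ^ (k + 1) * D + ε / (1 - n) := by
        field_simp; ring
      linarith [h z hz]
  intro z hz
  have hlim : Tendsto (fun k : ℕ => n ^ k * D + ε / (1 - n)) atTop (𝓝 (0 * D + ε / (1 - n))) :=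
    ((tendsto_pow_atTop_nhds_zero_of_lt_one hn hn1).mul_const D).add_const _
  rw [zero_mul, zero_add] at hlim
  exact ge_of_tendsto' hlim (fun k => key k z hz)

/-- The case ε = 0 of `stability`. -/
theorem eq_of_fixed (hu : Comparable w) (hv : Comparable v) (hn : 0 ≤ n) (hn1 : n < 1)
    (h1 : ∀ z ∈ Ico 0 Real.pi, green (fun z => w z ^ n) z = w z)
    (h2 : ∀ z ∈ Ico 0 Real.pi, green (fun z => v z ^ n) z = v z) :
    ∀ z ∈ Ico 0 Real.pi, w z = v z := by
  intro z hz
  have h := stability hu hv hn hn1 h1 (ε := 0) (fun z hz => by rw [h2 z hz]; simp) z hz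
  rw [zero_div] at h
  exact Real.log_injOn_pos (hu.pos z hz) (hv.pos z hz) (sub_eq_zero.1 (abs_nonpos_iff.1 h))

end Comparable

open scoped BoundedContinuousFunction

/-- The profile `groundProfile · eᵛ` on `[0, π)`. -/
def profileOf (v : Ico (0 : ℝ) Real.pi →ᵇ ℝ) (z : ℝ) : ℝ :=
  open Classical in if h : z ∈ Ico (0 : ℝ) Real.pi then groundProfile z * Real.exp (v ⟨z, h⟩) else 0

theorem profileOf_coe (v : Ico (0 : ℝ) Real.pi →ᵇ ℝ) (z : Ico (0 : ℝ) Real.pi) :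
    profileOf v z = groundProfile z * Real.exp (v z) := by
  simp [profileOf]

theorem log_profileOf (v : Ico (0 : ℝ) Real.pi →ᵇ ℝ) (z : Ico (0 : ℝ) Real.pi) :
    Real.log (profileOf v z) = Real.log (groundProfile z) + v z := by
  rw [profileOf_coe, Real.log_mul (groundProfile_pos z.2).ne' (Real.exp_pos _).ne', Real.log_exp]

theorem comparable_profileOf (v : Ico (0 : ℝ) Real.pi →ᵇ ℝ) : Comparable (profileOf v) := by
  refine ⟨?_, fun z hz => ?_, ‖v‖, fun z hz => ?_⟩
  · rw [continuousOn_iff_continuous_domRestrict]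
    have : (Ico (0 : ℝ) Real.pi).domRestrict (profileOf v) =
        fun z : Ico (0 : ℝ) Real.pi => groundProfile z * Real.exp (v z) := by
      ext z; exact profileOf_coe v z
    rw [this]
    exact (continuous_groundProfile.comp continuous_subtype_val).mul
      (Real.continuous_exp.comp v.continuous)
  · rw [profileOf_coe v ⟨z, hz⟩]
    exact mul_pos (groundProfile_pos hz) (Real.exp_pos _)
  · rw [log_profileOf v ⟨z, hz⟩, add_sub_cancel_left]
    exact v.norm_coe_le_norm _

/-- The logarithm of a comparable profile relative to `groundProfile`. -/
def Comparable.logRatio {w : ℝ → ℝ} (hw : Comparable w) : Ico (0 : ℝ) Real.pi →ᵇ ℝ :=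
  BoundedContinuousFunction.ofNormedAddCommGroup
    (fun z => Real.log (w z) - Real.log (groundProfile z))
    ((continuousOn_iff_continuous_domRestrict.1
      ((hw.cont.log fun _ hz => (hw.pos _ hz).ne').sub
        (continuous_groundProfile.continuousOn.log fun _ hz => (groundProfile_pos hz).ne'))))
    hw.bound.choose (fun z => hw.bound.choose_spec z.1 z.2)

/-- The map v ↦ u eᵛ, with u the ground profile, is an isometry from the bounded continuous
functions on [0, π) onto the comparable profiles (up to values outside [0, π)) with Thompson's
metric. This space is complete, so Banach's fixed-point theorem applies. -/
theorem exists_fixed {n : ℝ} (hn : 0 ≤ n) (hn1 : n < 1) :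
    ∃ w, Comparable w ∧ ∀ z ∈ Ico 0 Real.pi, green (fun z => w z ^ n) z = w z := by
  let Φ : (Ico (0 : ℝ) Real.pi →ᵇ ℝ) → (Ico (0 : ℝ) Real.pi →ᵇ ℝ) :=
    fun v => ((comparable_profileOf v).green_rpow hn).logRatio
  have hΦ : ContractingWith ⟨n, hn⟩ Φ := by
    refine ⟨by exact_mod_cast hn1, LipschitzWith.of_dist_le_mul fun v w => ?_⟩
    rw [BoundedContinuousFunction.dist_le (by positivity)]
    intro z
    have := (comparable_profileOf v).green_contract (comparable_profileOf w) hn (d := dist v w)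
      (fun z hz => ?_) z z.2
    · rw [← sub_sub_sub_cancel_right _ _ (Real.log (groundProfile z))] at this
      exact this
    · rw [log_profileOf v ⟨z, hz⟩, log_profileOf w ⟨z, hz⟩, add_sub_add_left_eq_sub,
        ← Real.dist_eq]
      exact BoundedContinuousFunction.dist_coe_le_dist _
  have hfix := hΦ.fixedPoint_isFixedPt
  set v := hΦ.fixedPoint with hv
  refine ⟨profileOf v, comparable_profileOf v, fun z hz => ?_⟩
  have h1 : Φ v ⟨z, hz⟩ = v ⟨z, hz⟩ := by rw [hfix.eq]
  have h2 := log_profileOf v ⟨z, hz⟩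
  have h3 : Φ v ⟨z, hz⟩ = Real.log (green (fun z => profileOf v z ^ n) z) -
    Real.log (groundProfile z) := rfl
  refine Real.log_injOn_pos (((comparable_profileOf v).green_rpow hn).pos z hz)
    ((comparable_profileOf v).pos z hz) ?_
  simp only at h2
  linarith

/-- Comparability with the ground profile comes from the equation itself: sΘ is the potential of the
positive source (sΘ)ⁿ. -/
theorem IsScaledPolytrope.fixed {n s : ℝ} {Θ : ℝ → ℝ} (hn : 0 ≤ n) (hs : 0 < s)
    (h : IsScaledPolytrope n s Θ) :
    Comparable (fun z => s * Θ z) ∧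
      ∀ z ∈ Ico 0 Real.pi, green (fun z => (s * Θ z) ^ n) z = s * Θ z := by
  have hc : ContinuousOn (fun z => s * Θ z) (Icc 0 Real.pi) := continuousOn_const.mul h.continuousOn
  have hf : Admissible fun z => (s * Θ z) ^ n :=
    Admissible.of_continuousOn (hc.rpow_const fun z hz => Or.inr hn)
  have heq := eqOn_green hc (contDiffOn_const.mul h.contDiffOn) hf h.equation
    (by simp [h.value_pi])
  have hcomp := comparable_green hf
    (fun z hz => Real.rpow_pos_of_pos (mul_pos hs (h.pos z hz)) n)
  refine ⟨⟨hc.mono Ico_subset_Icc_self, fun z hz => mul_pos hs (h.pos z hz), ?_⟩,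
    fun z hz => (heq z (Ico_subset_Icc_self hz)).symm⟩
  obtain ⟨A, hA⟩ := hcomp.bound
  exact ⟨A, fun z hz => by rw [heq z (Ico_subset_Icc_self hz)]; exact hA z hz⟩

/-- The witness is the potential divided by w(0), not w/w(0): w is controlled only on [0, π), while
the potential is regular on the closed interval and vanishes at π. -/
theorem isScaledPolytrope_of_fixed {n : ℝ} (hn : 0 ≤ n) {w : ℝ → ℝ} (hw : Comparable w)
    (h : ∀ z ∈ Ico 0 Real.pi, green (fun z => w z ^ n) z = w z) :
    IsScaledPolytrope n (w 0) fun z => green (fun z => w z ^ n) z / w 0 := by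
  have h0 : (0 : ℝ) ∈ Ico 0 Real.pi := ⟨le_rfl, Real.pi_pos⟩
  have hw0 := hw.pos 0 h0
  have hf := hw.admissible_rpow hn
  have hmul : ∀ z, w 0 * (green (fun z => w z ^ n) z / w 0) = green (fun z => w z ^ n) z := by
    intro z; field_simp
  refine ⟨hf.continuousOn_green.div_const _, hf.contDiffOn_green.div_const _, fun z hz => ?_, ?_,
    ?_, by simp [green_pi], fun z hz => ?_⟩
  · rw [h z hz]; exact div_pos (hw.pos z hz) hw0
  · simp only [h 0 h0]; exact div_self hw0.ne'
  · simpa using hf.hasDerivWithinAt_green_zero.div_const (w 0)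
  · simp only [hmul]
    rw [h z (Ioo_subset_Ico_self hz)]
    rw [hf.radialLaplacian_green hz]
    ring

/-- For `0 ≤ n < 1` there is exactly one scale factor. -/
theorem exists_scaleFactor {n : ℝ} (hn : 0 ≤ n) (hn1 : n < 1) :
    ∃ w, Comparable w ∧ (∀ z ∈ Ico 0 Real.pi, green (fun z => w z ^ n) z = w z) ∧
      ∀ s, IsScaleFactor n s ↔ s = w 0 := by
  have h0 : (0 : ℝ) ∈ Ico 0 Real.pi := ⟨le_rfl, Real.pi_pos⟩
  obtain ⟨w, hw, hfix⟩ := exists_fixed hn hn1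
  refine ⟨w, hw, hfix, fun s => ⟨?_, ?_⟩⟩
  · rintro ⟨hs, Θ, hΘ⟩
    obtain ⟨hc, hf⟩ := hΘ.fixed hn hs
    have := hc.eq_of_fixed hw hn hn1 hf hfix 0 h0
    simpa [hΘ.value_zero] using this
  · rintro rfl
    exact ⟨hw.pos 0 h0, _, isScaledPolytrope_of_fixed hn hw hfix⟩

end

/-! ### Expansion of (u₀ + n u₁ + ⋯)ⁿ in powers of n, with a uniform remainder. -/

section

open MeasureTheory Set

section powerCoeff

variable {p₀ p₁ p₂ p₃ : ℝ}

/-- Logarithmic differentiation near n = 0: with q₁ = (n log P)′ and q₂ = q₁′ one has f′ = f q₁ and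
f″ = f(q₁² + q₂). -/
theorem iteratedDeriv_cubic_rpow (hp : 0 < p₀) {f : ℝ → ℝ}
    (hf : ∀ n, f n = (p₀ + p₁ * n + p₂ * n ^ 2 + p₃ * n ^ 3) ^ n) :
    iteratedDeriv 1 f 0 = Real.log p₀ ∧
    iteratedDeriv 2 f 0 = Real.log p₀ ^ 2 + 2 * (p₁ / p₀) ∧
    iteratedDeriv 3 f 0 = Real.log p₀ ^ 3 + 6 * Real.log p₀ * (p₁ / p₀) + 6 * (p₂ / p₀)
      - 3 * (p₁ / p₀) ^ 2 := by
  set P : ℝ → ℝ := fun n => p₀ + p₁ * n + p₂ * n ^ 2 + p₃ * n ^ 3 with hP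
  set P' : ℝ → ℝ := fun n => p₁ + p₂ * (2 * n) + p₃ * (3 * n ^ 2) with hP'
  set P'' : ℝ → ℝ := fun n => p₂ * 2 + p₃ * (6 * n) with hP''
  have dP : ∀ n, HasDerivAt P (P' n) n := fun n => by
    refine ((((hasDerivAt_id n).const_mul p₁).const_add p₀).add
      ((hasDerivAt_pow 2 n).const_mul p₂)).add ((hasDerivAt_pow 3 n).const_mul p₃) |>.congr_deriv ?_
    simp [hP']
  have dP' : ∀ n, HasDerivAt P' (P'' n) n := fun n => by
    refine ((((hasDerivAt_id n).const_mul 2).const_mul p₂).const_add p₁).add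
      (((hasDerivAt_pow 2 n).const_mul 3).const_mul p₃) |>.congr_deriv ?_
    simp only [hP'', Nat.cast_ofNat, Nat.reduceSub, pow_one]; ring
  have dP'' : Differentiable ℝ P'' := by fun_prop
  have hpos : ∀ᶠ n in 𝓝 (0 : ℝ), 0 < P n := by
    have hc : Continuous P := by fun_prop
    exact hc.continuousAt.eventually (lt_mem_nhds (by simpa [hP] using hp))
  set q₁ : ℝ → ℝ := fun n => Real.log (P n) + n * (P' n / P n) with hq₁
  set g : ℝ → ℝ := fun n => (P'' n * P n - P' n * P' n) / P n ^ 2 with hg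
  set q₂ : ℝ → ℝ := fun n => 2 * (P' n / P n) + n * g n with hq₂
  have dR : ∀ n, 0 < P n → HasDerivAt (fun n => P' n / P n) (g n) n := fun n hn =>
    (dP' n).div (dP n) hn.ne'
  have df : ∀ n, 0 < P n → HasDerivAt f (f n * q₁ n) n := fun n hn => by
    have h := (dP n).rpow (hasDerivAt_id n) hn
    have hfe : f = fun n => P n ^ n := funext hf
    rw [hfe]
    refine h.congr_deriv ?_
    simp only [hq₁, id]
    rw [Real.rpow_sub_one hn.ne']
    field_simp; ring
  have dq₁ : ∀ n, 0 < P n → HasDerivAt q₁ (q₂ n) n := fun n hn => by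
    refine (((dP n).log hn.ne').add ((hasDerivAt_id n).mul (dR n hn))).congr_deriv ?_
    simp only [hq₂, id]; ring
  have hP0 : P 0 = p₀ := by simp [hP]
  have h0 : 0 < P 0 := by rwa [hP0]
  have dg : DifferentiableAt ℝ g 0 := by
    have h1 := (dP 0).differentiableAt
    have h2 := (dP' 0).differentiableAt
    have h3 := dP'' 0
    exact ((h3.mul h1).sub (h2.mul h2)).div (h1.pow 2) (pow_pos h0 2).ne'
  -- The derivative of n g(n) at 0 is g(0), so only differentiability of g is needed. The term 2P′/P
  -- contributes the other 2g(0).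
  have dq₂ : HasDerivAt q₂ (3 * g 0) 0 := by
    refine (((dR 0 h0).const_mul 2).add ((hasDerivAt_id 0).mul dg.hasDerivAt)).congr_deriv ?_
    simp only [zero_mul, add_zero, one_mul]; ring
  have e1 : deriv f =ᶠ[𝓝 0] fun n => f n * q₁ n := hpos.mono fun n hn => (df n hn).deriv
  have e2 : deriv (deriv f) =ᶠ[𝓝 0] fun n => f n * (q₁ n ^ 2 + q₂ n) := by
    filter_upwards [e1.eventuallyEq_nhds, hpos] with n hn hn'
    rw [hn.deriv_eq, ((df n hn').fun_mul (dq₁ n hn')).deriv]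
    ring
  have hf0 : f 0 = 1 := by simp [hf]
  have hq0 : q₁ 0 = Real.log p₀ := by simp [hq₁, hP0]
  have hq20 : q₂ 0 = 2 * (p₁ / p₀) := by simp [hq₂, hP0, hP']
  refine ⟨?_, ?_, ?_⟩
  · rw [iteratedDeriv_one, e1.eq_of_nhds, hf0, hq0, one_mul]
  · rw [iteratedDeriv_succ, iteratedDeriv_one, e2.eq_of_nhds, hf0, hq0, hq20, one_mul]
  · rw [iteratedDeriv_succ, iteratedDeriv_succ, iteratedDeriv_one, e2.deriv_eq,
      ((df 0 h0).fun_mul (((dq₁ 0 h0).fun_pow 2).fun_add dq₂)).deriv, hf0, hq0, hq20]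
    have hg0 : g 0 = 2 * (p₂ / p₀) - (p₁ / p₀) ^ 2 := by
      have hp0 := hp.ne'
      simp only [hg, hP0]
      simp only [hP', hP'']
      field_simp
      ring
    rw [hg0]; ring

theorem powerCoeff_zero (u : ℕ → ℝ) : powerCoeff u 0 = 1 := by
  simp [powerCoeff]

theorem powerCoeff_one {u : ℕ → ℝ} (h : 0 < u 0) : powerCoeff u 1 = Real.log (u 0) := by
  rw [powerCoeff, (iteratedDeriv_cubic_rpow (p₁ := u 1) (p₂ := 0) (p₃ := 0) h (fun n => ?_)).1]
  · simp
  · simp [Finset.sum_range_succ]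

theorem powerCoeff_two {u : ℕ → ℝ} (h : 0 < u 0) :
    powerCoeff u 2 = u 1 / u 0 + Real.log (u 0) ^ 2 / 2 := by
  rw [powerCoeff, (iteratedDeriv_cubic_rpow (p₁ := u 1) (p₂ := u 2) (p₃ := 0) h (fun n => ?_)).2.1]
  · simp [Nat.factorial]; ring
  · simp [Finset.sum_range_succ]

theorem powerCoeff_three {u : ℕ → ℝ} (h : 0 < u 0) :
    powerCoeff u 3 = u 2 / u 0 - (u 1 / u 0) ^ 2 / 2 + Real.log (u 0) * (u 1 / u 0)
      + Real.log (u 0) ^ 3 / 6 := by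
  rw [powerCoeff,
    (iteratedDeriv_cubic_rpow (p₁ := u 1) (p₂ := u 2) (p₃ := u 3) h (fun n => ?_)).2.2]
  · simp [Nat.factorial]; ring
  · simp [Finset.sum_range_succ]

end powerCoeff

theorem pow_four_le_exp {t : ℝ} (ht : 0 ≤ t) : t ^ 4 ≤ 16 ^ 4 * Real.exp (t / 4) := by
  have h1 : t / 16 ≤ Real.exp (t / 16) := by linarith [Real.add_one_le_exp (t / 16)]
  have h2 : (t / 16) ^ 4 ≤ Real.exp (t / 16) ^ 4 := pow_le_pow_left₀ (by positivity) h1 4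
  rw [← Real.exp_nat_mul] at h2
  have h3 : ((4 : ℕ) : ℝ) * (t / 16) = t / 4 := by push_cast; ring
  rw [h3] at h2
  linarith [show (t / 16) ^ 4 * 16 ^ 4 = t ^ 4 by ring]

theorem abs_log_one_add_sub_le {x : ℝ} (hx : |x| ≤ 1 / 2) :
    |Real.log (1 + x) - (x - x ^ 2 / 2)| ≤ 2 * |x| ^ 3 := by
  have h := Real.abs_log_sub_add_sum_range_le (x := -x) (by rw [abs_neg]; linarith) 2
  simp only [Finset.sum_range_succ, Finset.sum_range_zero] at h
  rw [abs_neg, sub_neg_eq_add] at h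
  norm_num at h
  have h1 : |x| ^ 3 / (1 - |x|) ≤ 2 * |x| ^ 3 := by
    rw [div_le_iff₀ (by linarith)]
    have : 0 ≤ |x| ^ 3 := by positivity
    nlinarith
  refine le_trans (le_of_eq ?_) (h.trans h1)
  congr 1; ring

theorem abs_exp_sub_cubic_le (y : ℝ) :
    |Real.exp y - (1 + y + y ^ 2 / 2 + y ^ 3 / 6)| ≤ |y| ^ 4 * Real.exp |y| := by
  have h := Complex.norm_exp_sub_sum_le_norm_mul_exp (y : ℂ) 4
  simp only [Finset.sum_range_succ, Finset.sum_range_zero] at h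
  have h1 : Complex.exp (y : ℂ) - (0 + (y : ℂ) ^ 0 / (Nat.factorial 0 : ℂ) + (y : ℂ) ^ 1 / (Nat.factorial 1 : ℂ)
      + (y : ℂ) ^ 2 / (Nat.factorial 2 : ℂ) + (y : ℂ) ^ 3 / (Nat.factorial 3 : ℂ))
      = ((Real.exp y - (1 + y + y ^ 2 / 2 + y ^ 3 / 6) : ℝ) : ℂ) := by
    push_cast [Nat.factorial]; ring
  rw [h1, Complex.norm_real, Complex.norm_real] at h
  exact h

/-- The quantity bounded is the coefficient of n⁴ left over in nq + (nq)²/2 + (nq)³/6 when q = L +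
np and p = a₁ + n e₂ + n² r. As C and t are at least 1, every monomial is dominated by a multiple of
C³t⁴. -/
theorem abs_expansion_remainder_le {C t L n r e₂ p : ℝ} (hC1 : 1 ≤ C) (ht1 : 1 ≤ t)
    (hLt : |L| ≤ t) (hn : 0 ≤ n) (hn1 : n ≤ 1) (hrC : |r| ≤ C) (heC : |e₂| ≤ C) (hpb : |p| ≤ C) :
    |r + L * (e₂ + n * r) + p ^ 2 / 2
      + (3 * L ^ 2 * p + 3 * n * L * p ^ 2 + n ^ 2 * p ^ 3) / 6| ≤ 6 * C ^ 3 * t ^ 4 := by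
  have ht4 : t ≤ t ^ 4 := by
    calc t = t ^ 1 := (pow_one t).symm
      _ ≤ t ^ 4 := pow_le_pow_right₀ ht1 (by norm_num)
  have ht2 : t ^ 2 ≤ t ^ 4 := pow_le_pow_right₀ ht1 (by norm_num)
  have hC0 : 0 ≤ C := by linarith
  have ht0 : 0 ≤ t := by linarith
  have hC3 : C ≤ C ^ 3 := by
    calc C = C ^ 1 := (pow_one C).symm
      _ ≤ C ^ 3 := pow_le_pow_right₀ hC1 (by norm_num)
  have hC2 : C ^ 2 ≤ C ^ 3 := pow_le_pow_right₀ hC1 (by norm_num)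
  have ht41 : 1 ≤ t ^ 4 := one_le_pow₀ ht1
  have b1 : |r| ≤ C ^ 3 * t ^ 4 := by
    calc |r| ≤ C ^ 3 * 1 := by linarith
      _ ≤ _ := by gcongr
  have b2 : |L * (e₂ + n * r)| ≤ 2 * (C ^ 3 * t ^ 4) := by
    have : |e₂ + n * r| ≤ 2 * C := by
      have h6 := abs_add_le e₂ (n * r)
      rw [abs_mul, abs_of_nonneg hn] at h6
      have h7 := mul_le_mul hn1 hrC (abs_nonneg _) zero_le_one
      linarith
    rw [abs_mul]
    calc |L| * |e₂ + n * r| ≤ t * (2 * C) := by gcongr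
      _ ≤ t ^ 4 * (2 * C ^ 3) := by gcongr
      _ = _ := by ring
  have hp2 : p ^ 2 ≤ C ^ 2 := sq_le_sq' (abs_le.1 hpb).1 (abs_le.1 hpb).2
  have b3 : |p ^ 2 / 2| ≤ C ^ 3 * t ^ 4 := by
    rw [abs_of_nonneg (by positivity)]
    calc p ^ 2 / 2 ≤ C ^ 3 * 1 := by linarith [sq_nonneg p]
      _ ≤ _ := by gcongr
  have b4 : |3 * L ^ 2 * p| ≤ 3 * (C ^ 3 * t ^ 4) := by
    rw [abs_mul, abs_mul, abs_of_pos (by norm_num : (0 : ℝ) < 3), abs_pow]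
    calc 3 * |L| ^ 2 * |p| ≤ 3 * t ^ 2 * C := by gcongr
      _ ≤ 3 * t ^ 4 * C ^ 3 := by gcongr
      _ = _ := by ring
  have b5 : |3 * n * L * p ^ 2| ≤ 3 * (C ^ 3 * t ^ 4) := by
    rw [abs_mul, abs_mul, abs_mul, abs_of_pos (by norm_num : (0 : ℝ) < 3), abs_of_nonneg hn,
      abs_of_nonneg (sq_nonneg p)]
    calc 3 * n * |L| * p ^ 2 ≤ 3 * 1 * t * C ^ 2 := by gcongr
      _ ≤ 3 * 1 * t ^ 4 * C ^ 3 := by gcongr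
      _ = _ := by ring
  have b6 : |n ^ 2 * p ^ 3| ≤ C ^ 3 * t ^ 4 := by
    rw [abs_mul, abs_of_nonneg (sq_nonneg n), abs_pow]
    calc n ^ 2 * |p| ^ 3 ≤ 1 * C ^ 3 := by gcongr; exact pow_le_one₀ hn hn1
      _ = C ^ 3 * 1 := by ring
      _ ≤ _ := by gcongr
  generalize p ^ 2 / 2 = y₃ at *
  generalize L * (e₂ + n * r) = y₂ at *
  generalize 3 * L ^ 2 * p = y₄ at *
  generalize 3 * n * L * p ^ 2 = y₅ at *
  generalize n ^ 2 * p ^ 3 = y₆ at *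
  rw [show 6 * C ^ 3 * t ^ 4 = 6 * (C ^ 3 * t ^ 4) by ring]
  generalize C ^ 3 * t ^ 4 = X at *
  clear hC3 hC2 ht2 ht4 ht41 hp2
  obtain ⟨b11, b12⟩ := abs_le.1 b1
  obtain ⟨b21, b22⟩ := abs_le.1 b2
  obtain ⟨b31, b32⟩ := abs_le.1 b3
  obtain ⟨b41, b42⟩ := abs_le.1 b4
  obtain ⟨b51, b52⟩ := abs_le.1 b5
  obtain ⟨b61, b62⟩ := abs_le.1 b6
  exact abs_le.2 ⟨by linarith only [b11, b21, b31, b41, b51, b61, b12],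
    by linarith only [b12, b22, b32, b42, b52, b62, b11]⟩

/-- Third order expansion in `n` of `(e^L (1 + n a₁ + n² a₂ + n³ a₃))ⁿ`, uniform in `L`. -/
theorem exists_power_expansion (A : ℝ) (hA : 0 ≤ A) : ∃ K δ : ℝ, 0 ≤ K ∧ 0 < δ ∧
    ∀ L a₁ a₂ a₃ n : ℝ, |a₁| ≤ A → |a₂| ≤ A → |a₃| ≤ A → 0 ≤ n → n ≤ δ →
      |n * a₁ + n ^ 2 * a₂ + n ^ 3 * a₃| ≤ 1 / 2 ∧
      |Real.exp (n * (L + Real.log (1 + (n * a₁ + n ^ 2 * a₂ + n ^ 3 * a₃)))) -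
        (1 + n * L + n ^ 2 * (a₁ + L ^ 2 / 2)
          + n ^ 3 * (a₂ - a₁ ^ 2 / 2 + L * a₁ + L ^ 3 / 6))|
        ≤ K * n ^ 4 * Real.exp (|L| / 2) := by
  -- Large enough to bound e₂, r and p below simultaneously, and at least 3A.
  set C : ℝ := 1 + 54 * A ^ 3 + 5 * A ^ 2 + 3 * A with hC
  have hC1 : 1 ≤ C := by
    have : 0 ≤ A ^ 3 := by positivity
    have : 0 ≤ A ^ 2 := by positivity
    linarith
  -- The choice of δ gives nC ≤ 1/8, which keeps |x| ≤ 1/2 and |np| ≤ 1/8. In K, 6C³ belongs to Q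
  -- and (2C)⁴ ≥ 1 to the exponential remainder; 16⁴ comes from `pow_four_le_exp` and e^{1/2} from t
  -- = 1 + |L|.
  refine ⟨(6 * C ^ 3 + (2 * C) ^ 4) * 16 ^ 4 * Real.exp (1 / 2), 1 / (8 * C), by positivity,
    by positivity, fun L a₁ a₂ a₃ n h1 h2 h3 hn hnδ => ?_⟩
  have hnC : n * C ≤ 1 / 8 := by
    rw [le_div_iff₀ (by positivity)] at hnδ; linarith
  have hn4 : n ≤ 1 / 8 := (le_mul_of_one_le_right hn hC1).trans hnC
  have hn1 : n ≤ 1 := hn4.trans (by norm_num)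
  have hAC : 3 * A ≤ C := by
    have : 0 ≤ A ^ 3 := by positivity
    have : 0 ≤ A ^ 2 := by positivity
    linarith
  set y₂ := a₂ + n * a₃ with hy₂
  have hy₂b : |y₂| ≤ 2 * A := by
    have := abs_add_le a₂ (n * a₃)
    rw [abs_mul, abs_of_nonneg hn] at this
    have h4 : n * |a₃| ≤ 1 * A := mul_le_mul hn1 h3 (abs_nonneg _) zero_le_one
    linarith
  set x := n * a₁ + n ^ 2 * a₂ + n ^ 3 * a₃ with hx
  have hxe : x = n * (a₁ + n * y₂) := by rw [hx, hy₂]; ring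
  have hxb : |x| ≤ n * (3 * A) := by
    rw [hxe, abs_mul, abs_of_nonneg hn]
    have := abs_add_le a₁ (n * y₂)
    rw [abs_mul, abs_of_nonneg hn] at this
    have h4 : n * |y₂| ≤ 1 * (2 * A) := mul_le_mul hn1 hy₂b (abs_nonneg _) zero_le_one
    gcongr
    linarith
  have hx2 : |x| ≤ 1 / 2 := by
    have := mul_le_mul_of_nonneg_left hAC hn
    linarith only [this, hxb, hnC]
  refine ⟨hx2, ?_⟩
  rcases hn.eq_or_lt with h0 | h0
  · rw [← h0]; simp
  set e₂ := a₂ - a₁ ^ 2 / 2 with he₂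
  set σ := Real.log (1 + x) - (x - x ^ 2 / 2) with hσ
  have hσb : |σ| ≤ n ^ 3 * (54 * A ^ 3) := by
    refine (abs_log_one_add_sub_le hx2).trans ?_
    have := pow_le_pow_left₀ (abs_nonneg x) hxb 3
    linarith only [this, show (n * (3 * A)) ^ 3 = n ^ 3 * (27 * A ^ 3) by ring]
  set r := σ / n ^ 3 + a₃ - a₁ * y₂ - n * y₂ ^ 2 / 2 with hr
  have ha₁s : a₁ ^ 2 ≤ A ^ 2 := sq_le_sq' (abs_le.1 h1).1 (abs_le.1 h1).2
  have hrb : |r| ≤ 54 * A ^ 3 + A + 4 * A ^ 2 := by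
    have t1 : |σ / n ^ 3| ≤ 54 * A ^ 3 := by
      rw [abs_div, abs_of_pos (by positivity : 0 < n ^ 3), div_le_iff₀ (by positivity)]
      linarith
    have t2 : |a₁ * y₂| ≤ 2 * A ^ 2 := by
      rw [abs_mul]
      have := mul_le_mul h1 hy₂b (abs_nonneg _) hA
      linarith
    have t3 : |n * y₂ ^ 2 / 2| ≤ 2 * A ^ 2 := by
      rw [abs_of_nonneg (by positivity)]
      have : y₂ ^ 2 ≤ (2 * A) ^ 2 := sq_le_sq' (abs_le.1 hy₂b).1 (abs_le.1 hy₂b).2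
      have : n * y₂ ^ 2 ≤ 1 * (2 * A) ^ 2 := mul_le_mul hn1 this (sq_nonneg _) zero_le_one
      linarith
    rw [abs_le] at *
    constructor <;> linarith [t1.1, t1.2, t2.1, t2.2, t3.1, t3.2, h3.1, h3.2]
  have he₂b : |e₂| ≤ A + A ^ 2 := by
    rw [abs_le] at *
    constructor <;> linarith [h2.1, h2.2, sq_nonneg a₁]
  -- Here r was defined so that log(1 + x) = np holds exactly.
  set p := a₁ + n * e₂ + n ^ 2 * r with hp
  have hlog : Real.log (1 + x) = n * p := by
    have : n ^ 3 * (σ / n ^ 3) = σ := by field_simp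
    have h5 : n * p = n * a₁ + n ^ 2 * e₂ + (n ^ 3 * (σ / n ^ 3)) + n ^ 3 * a₃ - n ^ 3 * (a₁ * y₂)
        - n ^ 4 * y₂ ^ 2 / 2 := by rw [hp, hr]; ring
    rw [h5, this, hσ, hxe, he₂, hy₂]; ring
  have hn2 : n ^ 2 ≤ 1 := pow_le_one₀ hn hn1
  have hpb : |p| ≤ C := by
    have t1 : |n * e₂| ≤ A + A ^ 2 := by
      rw [abs_mul, abs_of_nonneg hn]
      have := mul_le_mul hn1 he₂b (abs_nonneg _) zero_le_one
      linarith
    have t2 : |n ^ 2 * r| ≤ 54 * A ^ 3 + A + 4 * A ^ 2 := by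
      rw [abs_mul, abs_of_nonneg (by positivity)]
      have := mul_le_mul hn2 hrb (abs_nonneg _) zero_le_one
      linarith
    rw [abs_le] at *
    constructor <;> linarith [t1.1, t1.2, t2.1, t2.2, h1.1, h1.2]
  have hrC : |r| ≤ C := by
    have : 0 ≤ A ^ 2 := by positivity
    linarith
  have heC : |e₂| ≤ C := by
    have : 0 ≤ A ^ 2 := by positivity
    have : 0 ≤ A ^ 3 := by positivity
    linarith
  rw [hlog]
  set t := 1 + |L| with ht
  have ht1 : 1 ≤ t := by have := abs_nonneg L; linarith
  set q := L + n * p with hq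
  have hnp : |n * p| ≤ 1 / 8 := by
    rw [abs_mul, abs_of_nonneg hn]
    exact (mul_le_mul_of_nonneg_left hpb hn).trans hnC
  have hqb : |q| ≤ t := by
    have := abs_add_le L (n * p)
    linarith
  set Q := r + L * (e₂ + n * r) + p ^ 2 / 2
    + (3 * L ^ 2 * p + 3 * n * L * p ^ 2 + n ^ 2 * p ^ 3) / 6 with hQ
  have hQb : |Q| ≤ 6 * C ^ 3 * t ^ 4 :=
    abs_expansion_remainder_le hC1 ht1 (by linarith) hn hn1 hrC heC hpb
  have hexp := abs_exp_sub_cubic_le (n * q)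
  have hnq : |n * q| ≤ n * t := by
    rw [abs_mul, abs_of_nonneg hn]; gcongr
  have hE : |n * q| ^ 4 * Real.exp |n * q| ≤ n ^ 4 * (t ^ 4 * Real.exp (t / 4)) := by
    have h8 : |n * q| ≤ t / 4 := by
      have := mul_le_mul_of_nonneg_right hn4 (zero_le_one.trans ht1)
      linarith only [this, ht1, hnq]
    calc |n * q| ^ 4 * Real.exp |n * q| ≤ (n * t) ^ 4 * Real.exp (t / 4) := by gcongr
      _ = _ := by ring
  have hmain : Real.exp (n * (L + n * p)) - (1 + n * L + n ^ 2 * (a₁ + L ^ 2 / 2)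
      + n ^ 3 * (a₂ - a₁ ^ 2 / 2 + L * a₁ + L ^ 3 / 6)) =
      (Real.exp (n * q) - (1 + n * q + (n * q) ^ 2 / 2 + (n * q) ^ 3 / 6)) + n ^ 4 * Q := by
    rw [hQ, hq]
    have hpq : p = a₁ + n * (a₂ - a₁ ^ 2 / 2) + n ^ 2 * r := hp
    have : a₁ = p - n * e₂ - n ^ 2 * r := by rw [hp]; ring
    have h9 : a₂ - a₁ ^ 2 / 2 = e₂ := rfl
    rw [h9]
    clear_value p e₂ r
    rw [this]; ring
  rw [hmain]
  have hexp4 := pow_four_le_exp (zero_le_one.trans ht1)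
  have hexpt : Real.exp (t / 4) ≤ Real.exp (t / 2) := Real.exp_le_exp.2 (by linarith)
  have hsq : Real.exp (t / 4) * Real.exp (t / 4) = Real.exp (t / 2) := by
    rw [← Real.exp_add]; congr 1; ring
  have hfin : Real.exp (t / 2) = Real.exp (1 / 2) * Real.exp (|L| / 2) := by
    rw [← Real.exp_add, ht]; congr 1; ring
  -- The growth e^{t/2} is split in half: one e^{t/4} pays for the exponential remainder, the other
  -- absorbs t⁴.
  have k1 : t ^ 4 * Real.exp (t / 4) ≤ 16 ^ 4 * Real.exp (t / 2) := by
    calc _ ≤ 16 ^ 4 * Real.exp (t / 4) * Real.exp (t / 4) := by gcongr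
      _ = _ := by rw [mul_assoc, hsq]
  have k2 : t ^ 4 ≤ 16 ^ 4 * Real.exp (t / 2) := hexp4.trans (by gcongr)
  have hC4 : 1 ≤ (2 * C) ^ 4 := one_le_pow₀ (by linarith)
  calc |Real.exp (n * q) - (1 + n * q + (n * q) ^ 2 / 2 + (n * q) ^ 3 / 6) + n ^ 4 * Q|
      ≤ |Real.exp (n * q) - (1 + n * q + (n * q) ^ 2 / 2 + (n * q) ^ 3 / 6)| + |n ^ 4 * Q| :=
        abs_add_le _ _
    _ ≤ n ^ 4 * (t ^ 4 * Real.exp (t / 4)) + n ^ 4 * (6 * C ^ 3 * t ^ 4) := by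
        rw [abs_mul (n ^ 4) Q, abs_of_nonneg (by positivity : 0 ≤ n ^ 4)]
        gcongr
        exact hexp.trans hE
    _ ≤ n ^ 4 * ((2 * C) ^ 4 * (16 ^ 4 * Real.exp (t / 2)))
        + n ^ 4 * (6 * C ^ 3 * (16 ^ 4 * Real.exp (t / 2))) := by
        gcongr n ^ 4 * ?_ + n ^ 4 * (6 * C ^ 3 * ?_)
        exact k1.trans (le_mul_of_one_le_left (by positivity) hC4)
    _ = _ := by rw [hfin]; ring

end

/-! ### The Taylor polynomial as an approximate fixed point, and the expansion of the scale factor.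
-/

section

open MeasureTheory Set

/-- The ground profile vanishes linearly at π. The factor 1/2 in the exponent keeps the singularity
at (π − z)^(−1/2), which is integrable. -/
theorem exp_half_abs_log_le {z : ℝ} (hz : z ∈ Ico 0 Real.pi) :
    Real.exp (|Real.log (groundProfile z)| / 2) ≤ 4 * (Real.pi - z) ^ (-(1 / 2) : ℝ) := by
  have hu := groundProfile_pos hz
  have hpz : 0 < Real.pi - z := by linarith [hz.2]
  have h1 : (Real.pi - z) / 2 ≤ groundProfile z := by
    have := Real.pi_gt_three
    unfold groundProfile
    nlinarith [hz.1]
  have h2 : Real.log (groundProfile z) ≤ Real.log 2 := Real.log_le_log hu (groundProfile_le_two z)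
  have h3 : Real.log (Real.pi - z) - Real.log 2 ≤ Real.log (groundProfile z) := by
    rw [← Real.log_div hpz.ne' two_ne_zero]
    exact Real.log_le_log (by positivity) h1
  have h4 : Real.log 2 = Real.log 4 / 2 := by
    rw [show (4 : ℝ) = 2 ^ 2 by norm_num, Real.log_pow]; push_cast; ring
  have h5 : 0 < Real.log 2 := Real.log_pos one_lt_two
  have h6 : |Real.log (groundProfile z)| ≤ 3 * Real.log 2 - Real.log (Real.pi - z) := by
    refine abs_le.2 ⟨by linarith, ?_⟩
    have h7 : Real.log (Real.pi - z) ≤ Real.log 4 :=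
      Real.log_le_log hpz (by linarith [hz.1, Real.pi_le_four])
    linarith
  rw [Real.rpow_def_of_pos hpz, show (4 : ℝ) = Real.exp (Real.log 4) from
    (Real.exp_log (by norm_num)).symm, ← Real.exp_add]
  exact Real.exp_le_exp.2 (by linarith)

/-- A weight dominating all powers of `log groundProfile`. -/
def logWeight (z : ℝ) : ℝ := Real.exp (|Real.log (groundProfile z)| / 2)

theorem logWeight_pos (z : ℝ) : 0 < logWeight z := Real.exp_pos _

theorem continuousOn_log_groundProfile :
    ContinuousOn (fun z => Real.log (groundProfile z)) (Ico 0 Real.pi) :=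
  continuous_groundProfile.continuousOn.log fun _ hz => (groundProfile_pos hz).ne'

theorem admissible_logWeight : Admissible logWeight := by
  have hg : Admissible fun z => 4 * (Real.pi - z) ^ (-(1 / 2) : ℝ) := by
    refine Admissible.const_mul ⟨?_, ?_⟩ 4
    · exact (by fun_prop : Continuous fun z : ℝ => Real.pi - z).continuousOn.rpow_const
        fun z hz => Or.inl (by linarith [hz.2])
    · have := (intervalIntegral.intervalIntegrable_rpow' (a := 0) (b := Real.pi)
        (r := -(1 / 2)) (by norm_num)).comp_sub_left Real.pi
      simpa using this.symm
  refine Admissible.of_abs_le ?_ hg fun z hz => ?_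
  · exact Real.continuous_exp.comp_continuousOn
      ((continuousOn_log_groundProfile.abs).div_const 2)
  · rw [abs_of_pos (logWeight_pos z)]
    exact exp_half_abs_log_le hz

theorem abs_log_pow_le (z : ℝ) (k : ℕ) :
    |Real.log (groundProfile z)| ^ k ≤ 2 ^ k * k.factorial * logWeight z := by
  have h := Real.pow_div_factorial_le_exp (|Real.log (groundProfile z)| / 2) (by positivity) k
  rw [div_le_iff₀ (by positivity), div_pow, div_le_iff₀ (by positivity)] at h
  unfold logWeight
  linarith

theorem one_le_logWeight (z : ℝ) : 1 ≤ logWeight z := Real.one_le_exp (by positivity)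

theorem admissible_of_le_logWeight {f : ℝ → ℝ} (hf : ContinuousOn f (Ico 0 Real.pi)) (C : ℝ)
    (h : ∀ z ∈ Ico 0 Real.pi, |f z| ≤ C * logWeight z) : Admissible f :=
  Admissible.of_abs_le hf (admissible_logWeight.const_mul C) h

/-- The ratio of the potential of `f` and `groundProfile`. -/
def ratio (f : ℝ → ℝ) (z : ℝ) : ℝ := green f z / groundProfile z

theorem Admissible.continuousOn_ratio {f : ℝ → ℝ} (hf : Admissible f) :
    ContinuousOn (ratio f) (Ico 0 Real.pi) :=
  (hf.continuousOn_green.mono Ico_subset_Icc_self).div continuous_groundProfile.continuousOn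
    fun _ hz => (groundProfile_pos hz).ne'

theorem Admissible.exists_ratio_le {f : ℝ → ℝ} (hf : Admissible f) :
    ∃ A, 0 ≤ A ∧ ∀ z ∈ Ico 0 Real.pi, |ratio f z| ≤ A := by
  obtain ⟨C, hC, h⟩ := exists_abs_green_le hf
  refine ⟨C, hC, fun z hz => ?_⟩
  have hu := groundProfile_pos hz
  rw [ratio, abs_div, abs_of_pos hu, div_le_iff₀ hu]
  exact h z (Ico_subset_Icc_self hz)

theorem groundProfile_mul_ratio (f : ℝ → ℝ) {z : ℝ} (hz : z ∈ Ico 0 Real.pi) :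
    groundProfile z * ratio f z = green f z := by
  have := (groundProfile_pos hz).ne'
  rw [ratio]; field_simp

/-- Coefficient of `n` in `uⁿ`. -/
def source₁ (z : ℝ) : ℝ := Real.log (groundProfile z)

/-- Coefficient of `n²` in `uⁿ`. -/
def source₂ (z : ℝ) : ℝ := ratio source₁ z + Real.log (groundProfile z) ^ 2 / 2

/-- Coefficient of `n³` in `uⁿ`. -/
def source₃ (z : ℝ) : ℝ :=
  ratio source₂ z - ratio source₁ z ^ 2 / 2 + Real.log (groundProfile z) * ratio source₁ z
    + Real.log (groundProfile z) ^ 3 / 6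

theorem admissible_source₁ : Admissible source₁ := by
  refine admissible_of_le_logWeight continuousOn_log_groundProfile 2 fun z _ => ?_
  simpa [source₁] using abs_log_pow_le z 1

theorem admissible_source₂ : Admissible source₂ := by
  obtain ⟨A, hA, h⟩ := admissible_source₁.exists_ratio_le
  refine admissible_of_le_logWeight (admissible_source₁.continuousOn_ratio.add
    ((continuousOn_log_groundProfile.pow 2).div_const 2)) (A + 4) fun z hz => ?_
  have h1 := abs_log_pow_le z 2
  have h2 := one_le_logWeight z
  have h3 := abs_add_le (ratio source₁ z) (Real.log (groundProfile z) ^ 2 / 2)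
  rw [abs_div, abs_pow, abs_two] at h3
  norm_num [Nat.factorial] at h1
  have h4 := h z hz
  have h5 : A ≤ A * logWeight z := le_mul_of_one_le_right hA h2
  rw [← sq_abs] at h1
  unfold source₂
  linarith

theorem admissible_source₃ : Admissible source₃ := by
  obtain ⟨A, hA, h⟩ := admissible_source₁.exists_ratio_le
  obtain ⟨B, hB, h'⟩ := admissible_source₂.exists_ratio_le
  refine admissible_of_le_logWeight (((admissible_source₂.continuousOn_ratio.sub
    ((admissible_source₁.continuousOn_ratio.pow 2).div_const 2)).add
    (continuousOn_log_groundProfile.mul admissible_source₁.continuousOn_ratio)).add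
    ((continuousOn_log_groundProfile.pow 3).div_const 6)) (B + A ^ 2 + 2 * A + 8) fun z hz => ?_
  have hw := one_le_logWeight z
  have h1 := abs_log_pow_le z 1
  have h3 := abs_log_pow_le z 3
  norm_num [Nat.factorial] at h1 h3
  have e1 := h z hz
  have e2 := h' z hz
  have e3 : |Real.log (groundProfile z) * ratio source₁ z| ≤ 2 * A * logWeight z := by
    rw [abs_mul]
    calc _ ≤ (2 * logWeight z) * A := by gcongr
      _ = _ := by ring
  have e4 : |ratio source₁ z ^ 2 / 2| ≤ A ^ 2 * logWeight z := by
    rw [abs_of_nonneg (by positivity)]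
    have := sq_le_sq' (abs_le.1 e1).1 (abs_le.1 e1).2
    have : A ^ 2 ≤ A ^ 2 * logWeight z := le_mul_of_one_le_right (sq_nonneg A) hw
    linarith [sq_nonneg A]
  have e5 : |Real.log (groundProfile z) ^ 3 / 6| ≤ 8 * logWeight z := by
    rw [abs_div, abs_pow]; norm_num; linarith
  have e6 : |ratio source₂ z| ≤ B * logWeight z := e2.trans (le_mul_of_one_le_right hB hw)
  have t1 := abs_add_le (ratio source₂ z - ratio source₁ z ^ 2 / 2
    + Real.log (groundProfile z) * ratio source₁ z) (Real.log (groundProfile z) ^ 3 / 6)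
  have t2 := abs_add_le (ratio source₂ z - ratio source₁ z ^ 2 / 2)
    (Real.log (groundProfile z) * ratio source₁ z)
  have t3 := abs_sub (ratio source₂ z) (ratio source₁ z ^ 2 / 2)
  unfold source₃
  linarith

/-- The third order Taylor polynomial of the solution with respect to the index. -/
def approximant (n z : ℝ) : ℝ :=
  groundProfile z + n * green source₁ z + n ^ 2 * green source₂ z + n ^ 3 * green source₃ z

theorem abs_log_one_add_le {y : ℝ} (hy : |y| ≤ 1 / 2) : |Real.log (1 + y)| ≤ 2 * |y| := by
  have hlog := abs_log_one_add_sub_le hy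
  have hy4 : |y| ^ 2 ≤ |y| / 2 := by nlinarith [abs_nonneg y]
  have hy5 : |y| ^ 3 ≤ |y| / 4 := by nlinarith [abs_nonneg y]
  have hy6 : |y - y ^ 2 / 2| ≤ |y| + |y| ^ 2 / 2 := by
    refine (abs_sub _ _).trans ?_
    rw [abs_div, abs_pow, abs_two]
  have := abs_add_le (Real.log (1 + y) - (y - y ^ 2 / 2)) (y - y ^ 2 / 2)
  rw [sub_add_cancel] at this
  linarith [abs_nonneg y]

/-- The approximant is u(1 + x), with u the ground profile and x a combination of bounded ratios, so
its n-th power is 1 + n f₁ + n² f₂ + n³ f₃ up to O(n⁴) times the weight, f_i being the sources. The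
potential of the weight is bounded by a multiple of u, so the error after applying the potential is
relative and uniform up to π. -/
theorem exists_approximant_bound : ∃ K δ : ℝ, 0 ≤ K ∧ 0 < δ ∧ δ ≤ 1 / 2 ∧ ∀ n, 0 ≤ n → n ≤ δ →
    Comparable (approximant n) ∧ ∀ z ∈ Ico 0 Real.pi,
      |Real.log (green (fun z => approximant n z ^ n) z) - Real.log (approximant n z)|
        ≤ K * n ^ 4 := by
  obtain ⟨A₁, hA₁, h₁⟩ := admissible_source₁.exists_ratio_le
  obtain ⟨A₂, hA₂, h₂⟩ := admissible_source₂.exists_ratio_le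
  obtain ⟨A₃, hA₃, h₃⟩ := admissible_source₃.exists_ratio_le
  obtain ⟨K, δ, hK, hδ, H⟩ := exists_power_expansion (A₁ + A₂ + A₃) (by positivity)
  obtain ⟨C, hC, hgw⟩ := exists_abs_green_le admissible_logWeight
  have hδ' : 0 < 1 / (4 * (K * C + 1)) := by positivity
  -- The last bound on n gives KCn ≤ 1/4, hence |y| ≤ 1/2 for the relative error y below.
  refine ⟨4 * (K * C), min δ (min (1 / 2) (1 / (4 * (K * C + 1)))), by positivity,
    lt_min hδ (lt_min (by norm_num) hδ'), (min_le_right _ _).trans (min_le_left _ _),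
    fun n hn hnδ => ?_⟩
  have hnδ1 : n ≤ δ := hnδ.trans (min_le_left _ _)
  have hn1 : n ≤ 1 / 2 := hnδ.trans ((min_le_right _ _).trans (min_le_left _ _))
  have hn2 : n ≤ 1 / (4 * (K * C + 1)) := hnδ.trans ((min_le_right _ _).trans (min_le_right _ _))
  set x : ℝ → ℝ := fun z =>
    n * ratio source₁ z + n ^ 2 * ratio source₂ z + n ^ 3 * ratio source₃ z with hx
  have happ : ∀ z ∈ Ico 0 Real.pi, approximant n z = groundProfile z * (1 + x z) := by
    intro z hz
    rw [approximant, ← groundProfile_mul_ratio source₁ hz, ← groundProfile_mul_ratio source₂ hz,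
      ← groundProfile_mul_ratio source₃ hz, hx]
    ring
  have HH : ∀ z ∈ Ico 0 Real.pi, |x z| ≤ 1 / 2 ∧
      |approximant n z ^ n - (1 + n * source₁ z + n ^ 2 * source₂ z + n ^ 3 * source₃ z)|
        ≤ K * n ^ 4 * logWeight z := by
    intro z hz
    have := H (Real.log (groundProfile z)) (ratio source₁ z) (ratio source₂ z) (ratio source₃ z) n
      ((h₁ z hz).trans (by linarith)) ((h₂ z hz).trans (by linarith))
      ((h₃ z hz).trans (by linarith)) hn hnδ1
    refine ⟨this.1, ?_⟩
    have hu := groundProfile_pos hz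
    have hx1 : 0 < 1 + x z := by linarith [(abs_le.1 this.1).1]
    rw [happ z hz, Real.rpow_def_of_pos (by positivity), Real.log_mul hu.ne' hx1.ne', mul_comm]
    exact this.2
  have hcont : ContinuousOn (approximant n) (Ico 0 Real.pi) := by
    have c1 := admissible_source₁.continuousOn_green.mono Ico_subset_Icc_self
    have c2 := admissible_source₂.continuousOn_green.mono Ico_subset_Icc_self
    have c3 := admissible_source₃.continuousOn_green.mono Ico_subset_Icc_self
    exact ((continuous_groundProfile.continuousOn.add (continuousOn_const.mul c1)).add
      (continuousOn_const.mul c2)).add (continuousOn_const.mul c3)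
  have hcomp : Comparable (approximant n) := by
    refine comparable_of_bounds hcont (c := 1 / 2) (C := 3 / 2) (by norm_num) ?_ ?_
    all_goals
      intro z hz
      rw [happ z hz]
      have := groundProfile_pos hz
      obtain ⟨k1, k2⟩ := abs_le.1 (HH z hz).1
      nlinarith
  refine ⟨hcomp, fun z hz => ?_⟩
  have hzI := Ico_subset_Icc_self hz
  set R : ℝ → ℝ := fun z => approximant n z ^ n +
    (-1) * (1 + n * source₁ z + n ^ 2 * source₂ z + n ^ 3 * source₃ z) with hR
  have a1 := admissible_source₁.const_mul n
  have a2 := admissible_source₂.const_mul (n ^ 2)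
  have a3 := admissible_source₃.const_mul (n ^ 3)
  have a0 := admissible_const 1
  have aw := hcomp.admissible_rpow hn
  have aS := ((a0.add a1).add a2).add a3
  have aR : Admissible R := aw.add (aS.const_mul (-1))
  -- The potential of the truncated series is the approximant itself, so only the remainder R
  -- contributes to the defect.
  have hgS : green (fun z => 1 + n * source₁ z + n ^ 2 * source₂ z + n ^ 3 * source₃ z) z
      = approximant n z := by
    rw [green_add ((a0.add a1).add a2) a3 hzI, green_add (a0.add a1) a2 hzI, green_add a0 a1 hzI,
      green_const_mul, green_const_mul, green_const_mul, green_one hzI, approximant]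
  have hgR : green R z = green (fun z => approximant n z ^ n) z - approximant n z := by
    rw [hR, green_add aw (aS.const_mul (-1)) hzI, green_const_mul, hgS]; ring
  have hu := groundProfile_pos hz
  have hRb : |green R z| ≤ K * n ^ 4 * (C * groundProfile z) := by
    have b := (le_abs_self _).trans (hgw z hzI)
    have hKn : 0 ≤ K * n ^ 4 := by positivity
    have b1 := green_mono aR (admissible_logWeight.const_mul (K * n ^ 4)) (fun z hz => by
      have := (abs_le.1 (HH z hz).2).2
      simp only [hR]; linarith) hzI
    have b2 := green_mono (admissible_logWeight.const_mul (-(K * n ^ 4))) aR (fun z hz => by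
      have := (abs_le.1 (HH z hz).2).1
      simp only [hR]; linarith) hzI
    rw [green_const_mul] at b1 b2
    have b3 := mul_le_mul_of_nonneg_left b hKn
    exact abs_le.2 ⟨by linarith, by linarith⟩
  have hwpos := hcomp.pos z hz
  have hwge : groundProfile z / 2 ≤ approximant n z := by
    rw [happ z hz]
    have := (abs_le.1 (HH z hz).1).1
    nlinarith
  have hTpos := (hcomp.green_rpow hn).pos z hz
  set y := green R z / approximant n z with hy
  have hyb : |y| ≤ 2 * (K * C) * n ^ 4 := by
    rw [hy, abs_div, abs_of_pos hwpos, div_le_iff₀ hwpos]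
    refine hRb.trans ?_
    have : 0 ≤ K * C * n ^ 4 := by positivity
    nlinarith
  have hn4 : n ^ 4 ≤ n := by
    calc n ^ 4 ≤ n ^ 1 := pow_le_pow_of_le_one hn (by linarith) (by norm_num)
      _ = n := pow_one n
  have hy2 : |y| ≤ 1 / 2 := by
    have h9 : K * C * n ≤ 1 / 4 := by
      rw [le_div_iff₀ (by positivity)] at hn2
      nlinarith
    have : K * C * n ^ 4 ≤ K * C * n := by gcongr
    linarith
  have hyT : green (fun z => approximant n z ^ n) z = approximant n z * (1 + y) := by
    rw [hy, hgR]; field_simp; ring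
  have hy3 := abs_le.1 hy2
  rw [hyT, Real.log_mul hwpos.ne' (by linarith), add_sub_cancel_left]
  linarith [abs_log_one_add_le hy2]

theorem approximant_zero (n : ℝ) : approximant n 0 =
    Real.pi ^ 2 / 6 + n * green source₁ 0 + n ^ 2 * green source₂ 0 + n ^ 3 * green source₃ 0 := by
  simp [approximant, groundProfile]

/-- Existence, uniqueness and third order expansion of the scale factor. -/
theorem exists_scaleFactor_expansion : ∃ σ : ℝ → ℝ,
    (∀ᶠ n in 𝓝[≥] (0 : ℝ), ∀ s : ℝ, IsScaleFactor n s ↔ s = σ n) ∧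
    (fun n : ℝ => σ n - (Real.pi ^ 2 / 6 + n * green source₁ 0 + n ^ 2 * green source₂ 0
      + n ^ 3 * green source₃ 0)) =O[𝓝[≥] (0 : ℝ)] (fun n : ℝ => n ^ 4) := by
  have h0 : (0 : ℝ) ∈ Ico 0 Real.pi := ⟨le_rfl, Real.pi_pos⟩
  obtain ⟨K, δ, hK, hδ, hδ2, H⟩ := exists_approximant_bound
  -- The range of n is put inside the statement so that one fixed point can be chosen for every real
  -- n; outside [0, 1) it is a dummy.
  have hex : ∀ n : ℝ, ∃ w : ℝ → ℝ, 0 ≤ n → n < 1 → Comparable w ∧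
      (∀ z ∈ Ico 0 Real.pi, green (fun z => w z ^ n) z = w z) ∧
      ∀ s, IsScaleFactor n s ↔ s = w 0 := by
    intro n
    by_cases h : 0 ≤ n ∧ n < 1
    · obtain ⟨w, hw⟩ := exists_scaleFactor h.1 h.2
      exact ⟨w, fun _ _ => hw⟩
    · exact ⟨0, fun h1 h2 => absurd ⟨h1, h2⟩ h⟩
  choose w hw using hex
  have hev : ∀ᶠ n in 𝓝[≥] (0 : ℝ), 0 ≤ n ∧ n ≤ δ ∧ 2 * K * n ≤ 1 := by
    have e1 : ∀ᶠ n in 𝓝[≥] (0 : ℝ), 0 ≤ n := eventually_mem_nhdsWithin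
    have e2 : ∀ᶠ n in 𝓝 (0 : ℝ), n < δ := gt_mem_nhds hδ
    have e3 : ∀ᶠ n in 𝓝 (0 : ℝ), 2 * K * n < 1 := by
      have hc : Continuous fun n : ℝ => 2 * K * n := by fun_prop
      exact hc.continuousAt.eventually (gt_mem_nhds (by simp))
    filter_upwards [e1, e2.filter_mono nhdsWithin_le_nhds, e3.filter_mono nhdsWithin_le_nhds]
      with n h1 h2 h3
    exact ⟨h1, h2.le, h3.le⟩
  refine ⟨fun n => w n 0, ?_, ?_⟩
  · filter_upwards [hev] with n hn
    exact (hw n hn.1 (by linarith [hn.2.1])).2.2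
  · have hcb : ∃ B, ∀ n, 0 ≤ n → n ≤ 1 → approximant n 0 ≤ B := by
      have hc : Continuous fun n => approximant n 0 := by unfold approximant; fun_prop
      obtain ⟨B, hB⟩ := (isCompact_Icc (a := (0 : ℝ)) (b := 1)).exists_bound_of_continuousOn
        hc.continuousOn
      exact ⟨B, fun n h1 h2 => (le_abs_self _).trans (hB n ⟨h1, h2⟩)⟩
    obtain ⟨B, hB⟩ := hcb
    refine IsBigO.of_bound (B * (4 * K)) ?_
    filter_upwards [hev] with n hn
    obtain ⟨hn0, hnδ, hnK⟩ := hn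
    have hn1 : n < 1 := by linarith
    obtain ⟨hc, hfix, -⟩ := hw n hn0 hn1
    obtain ⟨ha, hb⟩ := H n hn0 hnδ
    have hst := hc.stability ha hn0 hn1 hfix hb 0 h0
    have hap := ha.pos 0 h0
    -- Here 1/(1 − n) ≤ 2 because n ≤ 1/2.
    have h2K : K * n ^ 4 / (1 - n) ≤ 2 * K * n ^ 4 := by
      rw [div_le_iff₀ (by linarith)]
      have : 0 ≤ K * n ^ 4 := by positivity
      nlinarith
    have hn4 : n ^ 4 ≤ n := by
      calc n ^ 4 ≤ n ^ 1 := pow_le_pow_of_le_one hn0 hn1.le (by norm_num)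
        _ = n := pow_one n
    set t := Real.log (w n 0) - Real.log (approximant n 0) with ht
    have ht1 : |t| ≤ 2 * K * n ^ 4 := hst.trans h2K
    have ht2 : |t| ≤ 1 := by
      have : 2 * K * n ^ 4 ≤ 2 * K * n := by gcongr
      linarith
    have hwe : w n 0 = approximant n 0 * Real.exp t := by
      rw [ht, Real.exp_sub, Real.exp_log (hc.pos 0 h0), Real.exp_log hap]
      field_simp
    have he := Real.abs_exp_sub_one_le ht2
    rw [← approximant_zero, hwe, Real.norm_eq_abs, Real.norm_eq_abs,
      show approximant n 0 * Real.exp t - approximant n 0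
        = approximant n 0 * (Real.exp t - 1) by ring,
      abs_mul, abs_of_pos hap, abs_of_nonneg (by positivity : (0 : ℝ) ≤ n ^ 4)]
    calc approximant n 0 * |Real.exp t - 1| ≤ B * (4 * K * n ^ 4) := by
          have := hB n hn0 hn1.le
          have h5 : 0 ≤ B := hap.le.trans this
          gcongr
          linarith
      _ = _ := by ring

end

/-! ### The perturbation system: solvability and uniqueness of its coefficients S_i. -/

section

open MeasureTheory Set

/-- The regularity and the homogeneous boundary conditions shared by all coefficients. -/
structure RadialRegular (f : ℝ → ℝ) : Prop where
  continuousOn : ContinuousOn f (Icc 0 Real.pi)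
  contDiffOn : ContDiffOn ℝ 2 f (Ioo 0 Real.pi)
  deriv_zero : HasDerivWithinAt f 0 (Ici 0) 0
  value_pi : f Real.pi = 0

namespace RadialRegular

variable {f g : ℝ → ℝ}

theorem sub (hf : RadialRegular f) (hg : RadialRegular g) : RadialRegular fun z => f z - g z :=
  ⟨hf.continuousOn.sub hg.continuousOn, hf.contDiffOn.sub hg.contDiffOn,
    by simpa using hf.deriv_zero.fun_sub hg.deriv_zero, by simp [hf.value_pi, hg.value_pi]⟩

theorem const_mul (hf : RadialRegular f) (c : ℝ) : RadialRegular fun z => c * f z :=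
  ⟨continuousOn_const.mul hf.continuousOn, contDiffOn_const.mul hf.contDiffOn,
    by simpa using hf.deriv_zero.const_mul c, by simp [hf.value_pi]⟩

end RadialRegular

theorem Admissible.radialRegular_green {f : ℝ → ℝ} (hf : Admissible f) : RadialRegular (green f) :=
  ⟨hf.continuousOn_green, hf.contDiffOn_green, hf.hasDerivWithinAt_green_zero, green_pi f⟩

/-- The coefficients of `S(n) Θ(z)` for the perturbation solution. -/
def profileCoeff : ℕ → ℝ → ℝ
  | 0 => green fun _ => 1
  | 1 => green source₁
  | 2 => green source₂
  | _ => green source₃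

theorem radialRegular_profileCoeff (i : ℕ) : RadialRegular (profileCoeff i) := by
  match i with
  | 0 => exact (admissible_const 1).radialRegular_green
  | 1 => exact admissible_source₁.radialRegular_green
  | 2 => exact admissible_source₂.radialRegular_green
  | _ + 3 => exact admissible_source₃.radialRegular_green

theorem profileCoeff_zero {z : ℝ} (hz : z ∈ Icc 0 Real.pi) :
    profileCoeff 0 z = groundProfile z := green_one hz

/-- The system is triangular: the source at order i involves only coefficients of lower order, so
each order is a linear Poisson problem with known source. -/
theorem powerCoeff_profile {u : ℕ → ℝ} {z : ℝ} (hz : z ∈ Ioo 0 Real.pi)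
    (h0 : u 0 = groundProfile z) :
    powerCoeff u 0 = 1 ∧ powerCoeff u 1 = source₁ z ∧
    (u 1 = green source₁ z → powerCoeff u 2 = source₂ z) ∧
    (u 1 = green source₁ z → u 2 = green source₂ z → powerCoeff u 3 = source₃ z) := by
  have hpos : 0 < u 0 := by rw [h0]; exact groundProfile_pos (Ioo_subset_Ico_self hz)
  refine ⟨powerCoeff_zero u, ?_, fun h1 => ?_, fun h1 h2 => ?_⟩
  · rw [powerCoeff_one hpos, h0, source₁]
  · rw [powerCoeff_two hpos, h1, h0, source₂, ratio]
  · rw [powerCoeff_three hpos, h2, h1, h0, source₃, ratio, ratio]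

theorem profileCoeff_equation {i : ℕ} (hi : i ≤ 3) {z : ℝ} (hz : z ∈ Ioo 0 Real.pi) :
    radialLaplacian (profileCoeff i) z + powerCoeff (fun j => profileCoeff j z) i = 0 := by
  obtain ⟨h0, h1, h2, h3⟩ := powerCoeff_profile (u := fun j => profileCoeff j z) hz
    (profileCoeff_zero (Ioo_subset_Icc_self hz))
  interval_cases i
  · rw [h0]
    exact (congrArg (· + 1) ((admissible_const 1).radialLaplacian_green hz)).trans (by norm_num)
  · rw [h1]
    exact (congrArg (· + _) (admissible_source₁.radialLaplacian_green hz)).trans (by ring)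
  · rw [h2 rfl]
    exact (congrArg (· + _) (admissible_source₂.radialLaplacian_green hz)).trans (by ring)
  · rw [h3 rfl rfl]
    exact (congrArg (· + _) (admissible_source₃.radialLaplacian_green hz)).trans (by ring)

/-- The coefficients of `Θ`, by division of the series `∑ nⁱ profileCoeff i` by its value at `0`. -/
def shapeCoeff : ℕ → ℝ → ℝ
  | 0 => fun z => (profileCoeff 0 0)⁻¹ * profileCoeff 0 z
  | 1 => fun z => (profileCoeff 0 0)⁻¹ *
      (profileCoeff 1 z - profileCoeff 1 0 * shapeCoeff 0 z)
  | 2 => fun z => (profileCoeff 0 0)⁻¹ *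
      (profileCoeff 2 z - profileCoeff 1 0 * shapeCoeff 1 z - profileCoeff 2 0 * shapeCoeff 0 z)
  | i + 3 => fun z => (profileCoeff 0 0)⁻¹ *
      (profileCoeff 3 z - profileCoeff 1 0 * shapeCoeff (i + 2) z
        - profileCoeff 2 0 * shapeCoeff (i + 1) z - profileCoeff 3 0 * shapeCoeff i z)

theorem profileCoeff_zero_zero : profileCoeff 0 0 = Real.pi ^ 2 / 6 := by
  rw [profileCoeff_zero ⟨le_rfl, Real.pi_pos.le⟩, groundProfile]; ring

theorem profileCoeff_zero_ne : profileCoeff 0 0 ≠ 0 := by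
  rw [profileCoeff_zero_zero]; positivity

theorem radialRegular_shapeCoeff (i : ℕ) : RadialRegular (shapeCoeff i) := by
  have r := radialRegular_profileCoeff
  have r0 : RadialRegular (shapeCoeff 0) := (r 0).const_mul _
  have r1 : RadialRegular (shapeCoeff 1) := ((r 1).sub (r0.const_mul _)).const_mul _
  have r2 : RadialRegular (shapeCoeff 2) :=
    (((r 2).sub (r1.const_mul _)).sub (r0.const_mul _)).const_mul _
  induction i using Nat.strong_induction_on with
  | _ i ih =>
    match i with
    | 0 => exact r0
    | 1 => exact r1
    | 2 => exact r2
    | i + 3 =>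
      exact ((((r 3).sub ((ih (i + 2) (by omega)).const_mul _)).sub
        ((ih (i + 1) (by omega)).const_mul _)).sub ((ih i (by omega)).const_mul _)).const_mul _

theorem productCoeff_shapeCoeff {i : ℕ} (hi : i ≤ 3) :
    productCoeff (fun i => profileCoeff i 0) shapeCoeff i = profileCoeff i := by
  have h := profileCoeff_zero_ne
  ext z
  interval_cases i
  all_goals
    simp only [productCoeff, Finset.sum_range_succ, Finset.sum_range_zero, zero_add, Nat.sub_self,
      Nat.sub_zero, Nat.reduceSub, Nat.reduceAdd]
    simp only [shapeCoeff]
    field_simp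
    try ring

theorem exists_perturbationSolution :
    ∃ (S : ℕ → ℝ) (Θ : ℕ → ℝ → ℝ), IsPerturbationSolution 3 S Θ := by
  have h := profileCoeff_zero_ne
  have hr := radialRegular_shapeCoeff
  refine ⟨fun i => profileCoeff i 0, shapeCoeff, fun i _ => (hr i).continuousOn,
    fun i _ => (hr i).contDiffOn, fun i hi => ?_, fun i _ => (hr i).deriv_zero,
    fun i _ => (hr i).value_pi, fun i hi z hz => ?_⟩
  · have h0 : shapeCoeff 0 0 = 1 := by simp [shapeCoeff, h]
    have h1 : shapeCoeff 1 0 = 0 := by rw [shapeCoeff]; simp only [h0]; ring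
    have h2 : shapeCoeff 2 0 = 0 := by rw [shapeCoeff]; simp only [h0, h1]; ring
    have h3 : shapeCoeff 3 0 = 0 := by rw [shapeCoeff]; simp only [zero_add, h0, h1, h2]; ring
    interval_cases i <;> simp [h0, h1, h2, h3]
  · rw [productCoeff_shapeCoeff hi]
    -- The i-th power coefficient depends only on the coefficients of index at most i ≤ 3, where the
    -- Cauchy product is already identified.
    have : powerCoeff (fun j => productCoeff (fun i => profileCoeff i 0) shapeCoeff j z) i =
        powerCoeff (fun j => profileCoeff j z) i := by
      unfold powerCoeff
      congr 2
      ext n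
      congr 1
      refine Finset.sum_congr rfl fun j hj => ?_
      beta_reduce
      rw [productCoeff_shapeCoeff (by have := Finset.mem_range.1 hj; omega)]
    rw [this, profileCoeff_equation hi hz]

section uniqueness

variable {S : ℕ → ℝ} {Θ : ℕ → ℝ → ℝ}

/-- Since Θ_i(0) = δ_{0i}, only one term of the Cauchy product survives at the origin. -/
theorem IsPerturbationSolution.productCoeff_at_zero (h : IsPerturbationSolution 3 S Θ) {i : ℕ}
    (hi : i ≤ 3) : productCoeff S Θ i 0 = S i := by
  have := h.value_zero
  have h0 := this 0 (by norm_num)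
  have h1 := this 1 (by norm_num)
  have h2 := this 2 (by norm_num)
  have h3 := this 3 (by norm_num)
  interval_cases i <;> simp_all [productCoeff, Finset.sum_range_succ]

theorem IsPerturbationSolution.eq_green (h : IsPerturbationSolution 3 S Θ) {i : ℕ} (hi : i ≤ 3)
    {f : ℝ → ℝ} (hf : Admissible f)
    (hs : ∀ z ∈ Ioo 0 Real.pi, powerCoeff (fun j => productCoeff S Θ j z) i = f z) :
    ∀ z ∈ Icc 0 Real.pi, productCoeff S Θ i z = green f z := by
  refine eqOn_green ?_ ?_ hf (fun z hz => ?_) ?_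
  · exact continuousOn_finsetSum _ fun j _ =>
      continuousOn_const.mul (h.continuousOn _ (by omega))
  · exact ContDiffOn.sum fun j _ => contDiffOn_const.mul (h.contDiffOn _ (by omega))
  · rw [← hs z hz]; exact h.equation i hi z hz
  · exact Finset.sum_eq_zero fun j _ => by rw [h.value_pi _ (by omega), mul_zero]

/-- The coefficients `S i` of any perturbation solution. -/
theorem IsPerturbationSolution.coeff_eq (h : IsPerturbationSolution 3 S Θ) :
    S 0 = Real.pi ^ 2 / 6 ∧ S 1 = green source₁ 0 ∧ S 2 = green source₂ 0 ∧
      S 3 = green source₃ 0 := by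
  have hz : (0 : ℝ) ∈ Icc 0 Real.pi := ⟨le_rfl, Real.pi_pos.le⟩
  have u0 : ∀ z ∈ Icc 0 Real.pi, productCoeff S Θ 0 z = groundProfile z := fun z hz => by
    rw [h.eq_green (by norm_num) (admissible_const 1) (fun z _ => powerCoeff_zero _) z hz,
      green_one hz]
  have hp := fun z (hz : z ∈ Ioo 0 Real.pi) =>
    powerCoeff_profile (u := fun j => productCoeff S Θ j z) hz (u0 z (Ioo_subset_Icc_self hz))
  have u1 := h.eq_green (by norm_num) admissible_source₁ (fun z hz => (hp z hz).2.1)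
  have u2 := h.eq_green (by norm_num) admissible_source₂
    (fun z hz => (hp z hz).2.2.1 (u1 z (Ioo_subset_Icc_self hz)))
  have u3 := h.eq_green (by norm_num) admissible_source₃
    (fun z hz => (hp z hz).2.2.2 (u1 z (Ioo_subset_Icc_self hz)) (u2 z (Ioo_subset_Icc_self hz)))
  rw [← h.productCoeff_at_zero (i := 0) (by norm_num), ← h.productCoeff_at_zero (i := 1) (by norm_num),
    ← h.productCoeff_at_zero (i := 2) (by norm_num), ← h.productCoeff_at_zero (i := 3) (by norm_num)]
  refine ⟨?_, u1 0 hz, u2 0 hz, u3 0 hz⟩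
  rw [u0 0 hz, groundProfile]; ring

end uniqueness

end

/-! ### Logarithmic integrals on (0, 1) by primitives and polylogarithms. -/

section

open Set

/-- `c` is the integral over `(0, 1)` of the derivative `f`, as an increment of a primitive. -/
def HasNewtonIntegral (f : ℝ → ℝ) (c : ℝ) : Prop :=
  ∃ (G : ℝ → ℝ) (A B : ℝ), (∀ x ∈ Ioo (0 : ℝ) 1, HasDerivAt G (f x) x) ∧
    Tendsto G (𝓝[>] 0) (𝓝 A) ∧ Tendsto G (𝓝[<] 1) (𝓝 B) ∧ B - A = c

namespace HasNewtonIntegral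

variable {f g : ℝ → ℝ} {c d : ℝ}

/-- Two primitives differ by a constant, so their increments agree. This allows the same integral to
be evaluated in two ways without any integrability argument. -/
theorem unique (hf : HasNewtonIntegral f c) (hg : HasNewtonIntegral f d) : c = d := by
  obtain ⟨G, A, B, hG, hA, hB, rfl⟩ := hf
  obtain ⟨H, A', B', hH, hA', hB', rfl⟩ := hg
  have hd : ∀ x ∈ Ioo (0 : ℝ) 1, HasDerivAt (fun x => G x - H x) 0 x := fun x hx => by
    simpa using (hG x hx).fun_sub (hH x hx)
  have hm : (1 / 2 : ℝ) ∈ Ioo (0 : ℝ) 1 := by constructor <;> norm_num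
  obtain ⟨e, he⟩ : ∃ e, ∀ x ∈ Ioo (0 : ℝ) 1, G x - H x = e :=
    ⟨_, fun x hx => const_of_hasDerivAt_zero hd hx hm⟩
  have h0 : Tendsto (fun _ : ℝ => e) (𝓝[>] 0) (𝓝 (A - A')) :=
    (hA.sub hA').congr' (by
      filter_upwards [Ioo_mem_nhdsGT (zero_lt_one' ℝ)] with x hx using he x hx)
  have h1 : Tendsto (fun _ : ℝ => e) (𝓝[<] 1) (𝓝 (B - B')) :=
    (hB.sub hB').congr' (by
      filter_upwards [Ioo_mem_nhdsLT (zero_lt_one' ℝ)] with x hx using he x hx)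
  have e0 := tendsto_nhds_unique h0 tendsto_const_nhds
  have e1 := tendsto_nhds_unique h1 tendsto_const_nhds
  linarith

theorem congr (hf : HasNewtonIntegral f c) (h : ∀ x ∈ Ioo (0 : ℝ) 1, f x = g x) :
    HasNewtonIntegral g c := by
  obtain ⟨G, A, B, hG, hA, hB, hc⟩ := hf
  exact ⟨G, A, B, fun x hx => h x hx ▸ hG x hx, hA, hB, hc⟩

theorem add (hf : HasNewtonIntegral f c) (hg : HasNewtonIntegral g d) :
    HasNewtonIntegral (fun x => f x + g x) (c + d) := by
  obtain ⟨G, A, B, hG, hA, hB, rfl⟩ := hf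
  obtain ⟨H, A', B', hH, hA', hB', rfl⟩ := hg
  exact ⟨_, _, _, fun x hx => (hG x hx).fun_add (hH x hx), hA.add hA', hB.add hB', by ring⟩

theorem const_mul (hf : HasNewtonIntegral f c) (k : ℝ) :
    HasNewtonIntegral (fun x => k * f x) (k * c) := by
  obtain ⟨G, A, B, hG, hA, hB, rfl⟩ := hf
  exact ⟨_, _, _, fun x hx => (hG x hx).const_mul k, hA.const_mul k, hB.const_mul k, by ring⟩

theorem comp_one_sub (hf : HasNewtonIntegral f c) :
    HasNewtonIntegral (fun x => f (1 - x)) c := by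
  obtain ⟨G, A, B, hG, hA, hB, rfl⟩ := hf
  have hc : Continuous fun x : ℝ => 1 - x := by fun_prop
  refine ⟨fun x => -G (1 - x), -B, -A, fun x hx => ?_, ?_, ?_, by ring⟩
  · have := (hG (1 - x) ⟨by linarith [hx.2], by linarith [hx.1]⟩).comp x
      ((hasDerivAt_id x).const_sub 1)
    simpa using this.fun_neg
  · refine (hB.comp (tendsto_nhdsWithin_iff.2 ⟨?_, ?_⟩)).neg
    · simpa using (hc.tendsto 0).mono_left nhdsWithin_le_nhds
    · filter_upwards [self_mem_nhdsWithin] with x (hx : 0 < x)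
      simpa using hx
  · refine (hA.comp (tendsto_nhdsWithin_iff.2 ⟨?_, ?_⟩)).neg
    · simpa using (hc.tendsto 1).mono_left nhdsWithin_le_nhds
    · filter_upwards [self_mem_nhdsWithin] with x (hx : x < 1)
      simpa using hx

theorem comp_sq (hf : HasNewtonIntegral f c) :
    HasNewtonIntegral (fun x => f (x ^ 2) * (2 * x)) c := by
  obtain ⟨G, A, B, hG, hA, hB, rfl⟩ := hf
  have hc : Continuous fun x : ℝ => x ^ 2 := by fun_prop
  refine ⟨fun x => G (x ^ 2), A, B, fun x hx => ?_, ?_, ?_, rfl⟩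
  · have := HasDerivAt.comp (h₂ := G) (h := fun x : ℝ => x ^ 2) x
      (hG (x ^ 2) ⟨pow_pos hx.1 2, pow_lt_one₀ hx.1.le hx.2 two_ne_zero⟩) (hasDerivAt_pow 2 x)
    exact this.congr_deriv (by simp)
  · refine hA.comp (tendsto_nhdsWithin_iff.2 ⟨?_, ?_⟩)
    · simpa using (hc.tendsto 0).mono_left nhdsWithin_le_nhds
    · filter_upwards [self_mem_nhdsWithin] with x (hx : 0 < x)
      exact pow_pos hx 2
  · refine hB.comp (tendsto_nhdsWithin_iff.2 ⟨?_, ?_⟩)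
    · simpa using (hc.tendsto 1).mono_left nhdsWithin_le_nhds
    · filter_upwards [Ioo_mem_nhdsLT (zero_lt_one' ℝ)] with x hx
      exact pow_lt_one₀ hx.1.le hx.2 two_ne_zero

/-- The map t = (1 − x)/(1 + x) is an involution of (0, 1) with 1 + t = 2/(1 + x) and 1 − t = 2x/(1
+ x). It exchanges log x with log(1 − x) − log(1 + x), which produces the relations among the
integrals below. -/
theorem comp_cayley (hf : HasNewtonIntegral f c) :
    HasNewtonIntegral (fun x => f ((1 - x) / (1 + x)) * (2 / (1 + x) ^ 2)) c := by
  obtain ⟨G, A, B, hG, hA, hB, rfl⟩ := hf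
  have hct : ∀ a : ℝ, 0 ≤ a → ContinuousAt (fun x : ℝ => (1 - x) / (1 + x)) a := fun a ha =>
    ContinuousAt.div (by fun_prop) (by fun_prop) (by positivity)
  have hmem : ∀ x ∈ Ioo (0 : ℝ) 1, (1 - x) / (1 + x) ∈ Ioo (0 : ℝ) 1 := fun x hx => by
    have h1 : 0 < 1 + x := by linarith [hx.1]
    exact ⟨div_pos (by linarith [hx.2]) h1, (div_lt_one h1).2 (by linarith [hx.1])⟩
  refine ⟨fun x => -G ((1 - x) / (1 + x)), -B, -A, fun x hx => ?_, ?_, ?_, by ring⟩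
  · have h1 : 1 + x ≠ 0 := by linarith [hx.1]
    have hd : HasDerivAt (fun x : ℝ => (1 - x) / (1 + x)) (-(2 / (1 + x) ^ 2)) x := by
      refine (((hasDerivAt_id x).const_sub 1).div ((hasDerivAt_id x).const_add 1) h1).congr_deriv ?_
      simp only [id]; field_simp; ring
    have := (hG _ (hmem x hx)).comp x hd
    simpa using this.fun_neg
  · refine (hB.comp (tendsto_nhdsWithin_iff.2 ⟨?_, ?_⟩)).neg
    · simpa using (hct 0 le_rfl).tendsto.mono_left nhdsWithin_le_nhds
    · filter_upwards [Ioo_mem_nhdsGT (zero_lt_one' ℝ)] with x hx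
      exact (hmem x hx).2
  · refine (hA.comp (tendsto_nhdsWithin_iff.2 ⟨?_, ?_⟩)).neg
    · simpa using (hct 1 zero_le_one).tendsto.mono_left nhdsWithin_le_nhds
    · filter_upwards [Ioo_mem_nhdsLT (zero_lt_one' ℝ)] with x hx
      exact (hmem x hx).1

end HasNewtonIntegral

theorem tendsto_mul_log_pow_zero (m : ℕ) :
    Tendsto (fun x : ℝ => x * Real.log x ^ m) (𝓝[>] 0) (𝓝 0) := by
  have h := (Real.isLittleO_pow_log_id_atTop (n := m)).tendsto_div_nhds_zero
  have h2 := h.comp (tendsto_inv_nhdsGT_zero (𝕜 := ℝ))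
  have h3 := h2.const_mul ((-1) ^ m)
  rw [mul_zero] at h3
  refine h3.congr fun x => ?_
  simp only [Function.comp, id, Real.log_inv, div_inv_eq_mul]
  rw [neg_pow (Real.log x), ← mul_assoc, ← mul_assoc, ← mul_pow]
  norm_num [mul_comm]

/-- A differentiable zero beats any power of the logarithm; this disposes of boundary terms. -/
theorem tendsto_log_pow_mul_zero {f : ℝ → ℝ} (hf : DifferentiableAt ℝ f 0) (h0 : f 0 = 0)
    (m : ℕ) : Tendsto (fun x => Real.log x ^ m * f x) (𝓝[>] 0) (𝓝 0) := by
  have hO : f =O[𝓝[>] 0] fun x => x := by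
    have := hf.isBigO_sub
    simp only [h0, sub_zero] at this
    exact this.mono nhdsWithin_le_nhds
  have h1 : (fun x => Real.log x ^ m * f x) =O[𝓝[>] 0] fun x => Real.log x ^ m * x :=
    (isBigO_refl _ _).mul hO
  refine h1.trans_tendsto ?_
  simpa only [mul_comm] using tendsto_mul_log_pow_zero m

theorem tendsto_log_one_sub_pow_mul {f : ℝ → ℝ} (hf : DifferentiableAt ℝ f 1) (h1 : f 1 = 0)
    (m : ℕ) : Tendsto (fun x => Real.log (1 - x) ^ m * f x) (𝓝[<] 1) (𝓝 0) := by
  have hg : DifferentiableAt ℝ (fun x => f (1 - x)) 0 := by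
    refine DifferentiableAt.comp (g := f) (f := fun x : ℝ => 1 - x) 0 ?_ (by fun_prop)
    simpa using hf
  have h := tendsto_log_pow_mul_zero hg (by simpa using h1) m
  have hc : Continuous fun x : ℝ => 1 - x := by fun_prop
  have ht : Tendsto (fun x : ℝ => 1 - x) (𝓝[<] 1) (𝓝[>] 0) := by
    refine tendsto_nhdsWithin_iff.2 ⟨?_, ?_⟩
    · simpa using (hc.tendsto 1).mono_left nhdsWithin_le_nhds
    · filter_upwards [self_mem_nhdsWithin] with x (hx : x < 1)
      simpa using hx
  simpa [Function.comp_def] using h.comp ht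

/-- The polylogarithm `∑ xⁿ / nᵏ`. -/
def polylog (k : ℕ) (x : ℝ) : ℝ := ∑' n : ℕ, x ^ (n + 1) / ((n : ℝ) + 1) ^ k

theorem summable_inv_succ_pow {k : ℕ} (hk : 2 ≤ k) :
    Summable fun n : ℕ => 1 / ((n : ℝ) + 1) ^ k := by
  have := (summable_nat_add_iff 1).2 (Real.summable_one_div_nat_pow.2 hk)
  simpa using this

theorem continuousOn_polylog {k : ℕ} (hk : 2 ≤ k) : ContinuousOn (polylog k) (Icc (-1) 1) := by
  refine continuousOn_tsum (fun n => by fun_prop) (summable_inv_succ_pow hk) fun n x hx => ?_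
  rw [norm_div, norm_pow, norm_pow, Real.norm_eq_abs, Real.norm_of_nonneg (by positivity)]
  gcongr
  exact pow_le_one₀ (abs_nonneg x) (abs_le.2 hx)

theorem polylog_zero_right (k : ℕ) : polylog k 0 = 0 := by simp [polylog]

theorem polylog_one {x : ℝ} (hx : |x| < 1) : polylog 1 x = -Real.log (1 - x) := by
  rw [← (Real.hasSum_pow_div_log_of_abs_lt_one hx).tsum_eq]
  simp [polylog]

/-- The derivative is kept as a series in xⁿ so that x = 0 is included. Off 0 it becomes the usual
quotient by x. -/
theorem hasDerivAt_polylog (k : ℕ) {x : ℝ} (hx : |x| < 1) :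
    HasDerivAt (polylog (k + 1)) (∑' n : ℕ, x ^ n / ((n : ℝ) + 1) ^ k) x := by
  obtain ⟨r, hxr, hr⟩ := exists_between hx
  have hr0 : 0 ≤ r := (abs_nonneg x).trans hxr.le
  have h : HasDerivAt (fun x => ∑' n : ℕ, x ^ (n + 1) / ((n : ℝ) + 1) ^ (k + 1))
      (∑' n : ℕ, x ^ n / ((n : ℝ) + 1) ^ k) x := by
    refine hasDerivAt_tsum_of_isPreconnected (u := fun n : ℕ => r ^ n) (t := Ioo (-r) r) (y₀ := 0)
      (g' := fun (n : ℕ) x => x ^ n / ((n : ℝ) + 1) ^ k)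
      (summable_geometric_of_lt_one hr0 hr) isOpen_Ioo isPreconnected_Ioo
      (fun n y hy => ?_) (fun n y hy => ?_)
      ⟨by linarith [abs_nonneg x], by linarith [abs_nonneg x]⟩ (by simp) (abs_lt.1 hxr)
    · refine ((hasDerivAt_pow (n + 1) y).div_const _).congr_deriv ?_
      have : (n : ℝ) + 1 ≠ 0 := by positivity
      push_cast
      field_simp
      ring
    · rw [norm_div, norm_pow, norm_pow, Real.norm_eq_abs,
        Real.norm_of_nonneg (by positivity : 0 ≤ (n : ℝ) + 1)]
      calc |y| ^ n / ((n : ℝ) + 1) ^ k ≤ |y| ^ n :=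
            div_le_self (by positivity) (one_le_pow₀ (by linarith [Nat.cast_nonneg (α := ℝ) n]))
        _ ≤ r ^ n := pow_le_pow_left₀ (abs_nonneg y) (abs_le.2 ⟨hy.1.le, hy.2.le⟩) n
  exact h

theorem hasDerivAt_polylog_of_ne (k : ℕ) {x : ℝ} (hx : |x| < 1) (h0 : x ≠ 0) :
    HasDerivAt (polylog (k + 1)) (polylog k x / x) x := by
  refine (hasDerivAt_polylog k hx).congr_deriv ?_
  rw [polylog, ← tsum_div_const]
  refine tsum_congr fun n => ?_
  rw [pow_succ]
  field_simp

theorem polylog_two_one : polylog 2 1 = Real.pi ^ 2 / 6 := by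
  have h := (hasSum_nat_add_iff' 1).2 hasSum_zeta_two
  simp only [Finset.sum_range_one] at h
  norm_num at h
  rw [polylog, ← h.tsum_eq]
  simp

/-- `ζ(3)` as a real number. -/
def zetaThree : ℝ := (riemannZeta 3).re

theorem polylog_three_one : polylog 3 1 = zetaThree := by
  have h := zeta_nat_eq_tsum_of_gt_one (k := 3) (by norm_num)
  have h2 : riemannZeta 3 = ((∑' n : ℕ, 1 / (n : ℝ) ^ 3 : ℝ) : ℂ) := by
    rw [show (3 : ℂ) = ((3 : ℕ) : ℂ) by norm_num, h, Complex.ofReal_tsum]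
    push_cast; rfl
  rw [zetaThree, h2, Complex.ofReal_re, (Real.summable_one_div_nat_pow.2 (by norm_num : 1 < 3)).tsum_eq_zero_add]
  simp [polylog]

/-- In the sum of the values at −1 and 1, the terms with odd denominator n + 1 cancel and the even
ones double, leaving 2/2ᵏ times the value at 1. -/
theorem polylog_neg_one {k : ℕ} (hk : 2 ≤ k) :
    polylog k (-1) = (2 / 2 ^ k - 1) * polylog k 1 := by
  have hs := summable_inv_succ_pow hk
  have hs' : Summable fun n : ℕ => (-1 : ℝ) ^ (n + 1) / ((n : ℝ) + 1) ^ k := by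
    refine Summable.of_norm (hs.congr fun n => ?_)
    rw [norm_div, norm_pow, norm_neg, norm_one, one_pow, Real.norm_of_nonneg (by positivity)]
  have h5 : polylog k 1 = ∑' n : ℕ, 1 / ((n : ℝ) + 1) ^ k := by simp [polylog]
  obtain ⟨g, hg⟩ : ∃ g : ℕ → ℝ, ∀ n, g n =
    (-1 : ℝ) ^ (n + 1) / ((n : ℝ) + 1) ^ k + 1 / ((n : ℝ) + 1) ^ k := ⟨_, fun _ => rfl⟩
  have h2 : Summable g := (hs'.add hs).congr fun n => (hg n).symm
  have h1 : polylog k (-1) + polylog k 1 = ∑' n, g n := by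
    rw [h5, polylog, ← hs'.tsum_add hs]
    exact tsum_congr fun n => (hg n).symm
  have i1 : Function.Injective fun n : ℕ => 2 * n := fun a b h => by simpa using h
  have i2 : Function.Injective fun n : ℕ => 2 * n + 1 := fun a b h => by simpa using h
  have h6 := tsum_even_add_odd (f := g) (h2.comp_injective i1) (h2.comp_injective i2)
  have h3 : ∀ n : ℕ, (-1 : ℝ) ^ (2 * n + 1) / (((2 * n : ℕ) : ℝ) + 1) ^ k
      + 1 / (((2 * n : ℕ) : ℝ) + 1) ^ k = 0 := fun n => by
    rw [pow_succ, pow_mul, neg_one_sq, one_pow]; ring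
  have h4 : ∀ n : ℕ, (-1 : ℝ) ^ (2 * n + 1 + 1) / (((2 * n + 1 : ℕ) : ℝ) + 1) ^ k
      + 1 / (((2 * n + 1 : ℕ) : ℝ) + 1) ^ k = 2 / 2 ^ k * (1 / ((n : ℝ) + 1) ^ k) := fun n => by
    rw [show 2 * n + 1 + 1 = 2 * (n + 1) by ring, pow_mul, neg_one_sq, one_pow]
    push_cast
    rw [show (2 : ℝ) * n + 1 + 1 = 2 * (n + 1) by ring, mul_pow]
    field_simp
    norm_num
  rw [tsum_congr fun n => (hg (2 * n)).trans (h3 n),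
    tsum_congr fun n => (hg (2 * n + 1)).trans (h4 n), tsum_zero, tsum_mul_left, ← h5] at h6
  linarith

section limits

variable {k : ℕ}

theorem tendsto_polylog_one (hk : 2 ≤ k) : Tendsto (polylog k) (𝓝[<] 1) (𝓝 (polylog k 1)) :=
  ((continuousOn_polylog hk) 1 ⟨by norm_num, le_rfl⟩).tendsto.mono_left
    (nhdsWithin_le_of_mem (mem_of_superset (Ioo_mem_nhdsLT (by norm_num : (-1 : ℝ) < 1))
      Ioo_subset_Icc_self))

theorem tendsto_polylog_neg_one (hk : 2 ≤ k) :
    Tendsto (fun x => polylog k (-x)) (𝓝[<] 1) (𝓝 (polylog k (-1))) := by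
  refine ((continuousOn_polylog hk) (-1) ⟨le_rfl, by norm_num⟩).tendsto.comp
    (tendsto_nhdsWithin_iff.2 ⟨?_, ?_⟩)
  · exact (continuous_neg.tendsto 1).mono_left nhdsWithin_le_nhds
  · filter_upwards [Ioo_mem_nhdsLT (by norm_num : (-1 : ℝ) < 1)] with x hx
    exact ⟨by linarith [hx.2], by linarith [hx.1]⟩

theorem differentiableAt_polylog_zero : DifferentiableAt ℝ (polylog (k + 1)) 0 :=
  (hasDerivAt_polylog k (by simp)).differentiableAt

theorem differentiableAt_polylog_neg_zero :
    DifferentiableAt ℝ (fun x => polylog (k + 1) (-x)) 0 := by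
  refine DifferentiableAt.comp (g := polylog (k + 1)) (f := fun x : ℝ => -x) 0 ?_ (by fun_prop)
  simpa using differentiableAt_polylog_zero

theorem hasDerivAt_polylog_neg (k : ℕ) {x : ℝ} (hx : x ∈ Ioo (0 : ℝ) 1) :
    HasDerivAt (fun x => polylog (k + 1) (-x)) (polylog k (-x) / x) x := by
  have := (hasDerivAt_polylog_of_ne k (x := -x) (by
    rw [abs_neg, abs_lt]; constructor <;> linarith [hx.1, hx.2]) (by linarith [hx.1])).comp x
    (hasDerivAt_neg x)
  refine this.congr_deriv ?_
  have := hx.1.ne'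
  field_simp

theorem tendsto_of_differentiableAt_zero {f : ℝ → ℝ} (hf : DifferentiableAt ℝ f 0) :
    Tendsto f (𝓝[>] 0) (𝓝 (f 0)) := hf.continuousAt.tendsto.mono_left nhdsWithin_le_nhds

theorem tendsto_of_differentiableAt_one {f : ℝ → ℝ} (hf : DifferentiableAt ℝ f 1) :
    Tendsto f (𝓝[<] 1) (𝓝 (f 1)) := hf.continuousAt.tendsto.mono_left nhdsWithin_le_nhds

end limits

/-- Repeated integration by parts lowers the power of log t and raises the order of the
polylogarithm, starting from Li₁(t) = −log(1 − t). The two integrals with 1 + t use the same scheme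
at −t. -/
theorem integral_log_sq_div_one_sub :
    HasNewtonIntegral (fun t => Real.log t ^ 2 / (1 - t)) (2 * zetaThree) := by
  refine ⟨fun t => -(Real.log t ^ 2 * Real.log (1 - t)) + -2 * (Real.log t ^ 1 * polylog 2 t)
    + 2 * polylog 3 t, 0, 2 * zetaThree, fun t ht => ?_, ?_, ?_, by ring⟩
  · have h0 := ht.1.ne'
    have h1 : 1 - t ≠ 0 := by linarith [ht.2]
    have hab : |t| < 1 := abs_lt.2 ⟨by linarith [ht.1], ht.2⟩
    have dl := Real.hasDerivAt_log h0
    have d1 := ((hasDerivAt_id t).const_sub 1).log h1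
    refine ((((dl.pow 2).mul d1).neg.add
      (((dl.pow 1).mul (hasDerivAt_polylog_of_ne 1 hab h0)).const_mul (-2))).add
      ((hasDerivAt_polylog_of_ne 2 hab h0).const_mul 2)).congr_deriv ?_
    rw [polylog_one hab]
    simp only [id, Pi.pow_apply]
    field_simp
    ring
  · have e1 : DifferentiableAt ℝ (fun t : ℝ => Real.log (1 - t)) 0 :=
      DifferentiableAt.log (by fun_prop) (by norm_num)
    simpa [polylog_zero_right] using (((tendsto_log_pow_mul_zero e1 (by simp) 2).neg).add
      ((tendsto_log_pow_mul_zero (differentiableAt_polylog_zero (k := 1))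
        (polylog_zero_right 2) 1).const_mul (-2))).add
      ((tendsto_of_differentiableAt_zero (differentiableAt_polylog_zero (k := 2))).const_mul 2)
  · have e1 : DifferentiableAt ℝ Real.log 1 := Real.differentiableAt_log one_ne_zero
    have e2 := tendsto_log_one_sub_pow_mul (e1.fun_pow 2) (by simp) 1
    have e3 := ((tendsto_of_differentiableAt_one e1).pow 1).mul
      (tendsto_polylog_one (k := 2) le_rfl)
    have e4 := tendsto_polylog_one (k := 3) (by norm_num)
    have := (e2.neg.add (e3.const_mul (-2))).add (e4.const_mul 2)
    simp only [Real.log_one, polylog_three_one] at this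
    refine (this.congr fun t => ?_).trans (by simp)
    ring

theorem integral_log_div_one_add :
    HasNewtonIntegral (fun t => Real.log t / (1 + t)) (-(Real.pi ^ 2 / 12)) := by
  refine ⟨fun t => Real.log t ^ 1 * Real.log (1 + t) + polylog 2 (-t), 0, -(Real.pi ^ 2 / 12),
    fun t ht => ?_, ?_, ?_, by ring⟩
  · have h0 := ht.1.ne'
    have h1 : 1 + t ≠ 0 := by linarith [ht.1]
    have dl := Real.hasDerivAt_log h0
    have d1 := ((hasDerivAt_id t).const_add 1).log h1
    refine (((dl.pow 1).mul d1).add (hasDerivAt_polylog_neg 1 ht)).congr_deriv ?_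
    rw [polylog_one (by rw [abs_neg, abs_lt]; constructor <;> linarith [ht.1, ht.2])]
    simp only [id, Pi.pow_apply, sub_neg_eq_add]
    field_simp
    ring
  · have e1 : DifferentiableAt ℝ (fun t : ℝ => Real.log (1 + t)) 0 :=
      DifferentiableAt.log (by fun_prop) (by norm_num)
    simpa [polylog_zero_right] using (tendsto_log_pow_mul_zero e1 (by simp) 1).add
      (tendsto_of_differentiableAt_zero (differentiableAt_polylog_neg_zero (k := 1)))
  · have e1 : DifferentiableAt ℝ Real.log 1 := Real.differentiableAt_log one_ne_zero
    have e2 : DifferentiableAt ℝ (fun t : ℝ => Real.log (1 + t)) 1 :=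
      DifferentiableAt.log (by fun_prop) (by norm_num)
    have := (((tendsto_of_differentiableAt_one e1).pow 1).mul
      (tendsto_of_differentiableAt_one e2)).add (tendsto_polylog_neg_one (k := 2) le_rfl)
    rw [polylog_neg_one le_rfl, polylog_two_one] at this
    convert! this using 2
    simp; ring

theorem integral_log_sq_div_one_add :
    HasNewtonIntegral (fun t => Real.log t ^ 2 / (1 + t)) (3 / 2 * zetaThree) := by
  refine ⟨fun t => Real.log t ^ 2 * Real.log (1 + t) + 2 * (Real.log t ^ 1 * polylog 2 (-t))
    + -2 * polylog 3 (-t), 0, 3 / 2 * zetaThree, fun t ht => ?_, ?_, ?_, by ring⟩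
  · have h0 := ht.1.ne'
    have h1 : 1 + t ≠ 0 := by linarith [ht.1]
    have dl := Real.hasDerivAt_log h0
    have d1 := ((hasDerivAt_id t).const_add 1).log h1
    refine ((((dl.pow 2).mul d1).add (((dl.pow 1).mul (hasDerivAt_polylog_neg 1 ht)).const_mul 2)).add
      ((hasDerivAt_polylog_neg 2 ht).const_mul (-2))).congr_deriv ?_
    rw [polylog_one (by rw [abs_neg, abs_lt]; constructor <;> linarith [ht.1, ht.2])]
    simp only [id, Pi.pow_apply, sub_neg_eq_add]
    field_simp
    ring
  · have e1 : DifferentiableAt ℝ (fun t : ℝ => Real.log (1 + t)) 0 :=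
      DifferentiableAt.log (by fun_prop) (by norm_num)
    simpa [polylog_zero_right] using ((tendsto_log_pow_mul_zero e1 (by simp) 2).add
      ((tendsto_log_pow_mul_zero (differentiableAt_polylog_neg_zero (k := 1))
        (by simp [polylog_zero_right]) 1).const_mul 2)).add
      ((tendsto_of_differentiableAt_zero (differentiableAt_polylog_neg_zero (k := 2))).const_mul (-2))
  · have e1 : DifferentiableAt ℝ Real.log 1 := Real.differentiableAt_log one_ne_zero
    have e2 : DifferentiableAt ℝ (fun t : ℝ => Real.log (1 + t)) 1 :=
      DifferentiableAt.log (by fun_prop) (by norm_num)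
    have t1 := tendsto_of_differentiableAt_one e1
    have := (((t1.pow 2).mul (tendsto_of_differentiableAt_one e2)).add
      (((t1.pow 1).mul (tendsto_polylog_neg_one (k := 2) le_rfl)).const_mul 2)).add
      ((tendsto_polylog_neg_one (k := 3) (by norm_num)).const_mul (-2))
    rw [polylog_neg_one (k := 3) (by norm_num), polylog_three_one] at this
    convert! this using 2
    simp; ring

/-- `∫₀¹ log²((1-x)/(1+x)) / x dx`. -/
theorem integral_log_sub_log_sq_div :
    HasNewtonIntegral (fun x => (Real.log (1 - x) - Real.log (1 + x)) ^ 2 / x) (7 / 2 * zetaThree) := by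
  have h := (integral_log_sq_div_one_sub.add integral_log_sq_div_one_add).comp_cayley
  rw [show 2 * zetaThree + 3 / 2 * zetaThree = 7 / 2 * zetaThree by ring] at h
  refine h.congr fun x hx => ?_
  have h0 := hx.1.ne'
  have h1 : 1 - x ≠ 0 := by linarith [hx.2]
  have h2 : 1 + x ≠ 0 := by linarith [hx.1]
  have e1 : 1 - (1 - x) / (1 + x) = 2 * x / (1 + x) := by field_simp; ring
  have e2 : 1 + (1 - x) / (1 + x) = 2 / (1 + x) := by field_simp; ring
  rw [Real.log_div h1 h2, e1, e2]
  field_simp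

theorem integral_log_one_sub_sq_div :
    HasNewtonIntegral (fun x => Real.log (1 - x) ^ 2 / x) (2 * zetaThree) := by
  refine integral_log_sq_div_one_sub.comp_one_sub.congr fun x _ => ?_
  rw [sub_sub_cancel]

/-- The sum of the logarithms is log(1 − x²), so the substitution x² reduces this to the previous
integral. -/
theorem integral_log_add_log_sq_div :
    HasNewtonIntegral (fun x => (Real.log (1 - x) + Real.log (1 + x)) ^ 2 / x) zetaThree := by
  have h := integral_log_one_sub_sq_div.comp_sq.const_mul (1 / 2)
  rw [show 1 / 2 * (2 * zetaThree) = zetaThree by ring] at h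
  refine h.congr fun x hx => ?_
  have h0 := hx.1.ne'
  have h1 : 1 - x ≠ 0 := by linarith [hx.2]
  have h2 : 1 + x ≠ 0 := by linarith [hx.1]
  rw [← Real.log_mul h1 h2, show (1 - x) * (1 + x) = 1 - x ^ 2 by ring]
  field_simp

/-- The parallelogram identity (a − b)² + (a + b)² = 2a² + 2b² isolates b = log(1 + x). -/
theorem integral_log_one_add_sq_div :
    HasNewtonIntegral (fun x => Real.log (1 + x) ^ 2 / x) (1 / 4 * zetaThree) := by
  have h := ((integral_log_sub_log_sq_div.add integral_log_add_log_sq_div).const_mul (1 / 2)).add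
    (integral_log_one_sub_sq_div.const_mul (-1))
  rw [show 1 / 2 * (7 / 2 * zetaThree + zetaThree) + -1 * (2 * zetaThree) = 1 / 4 * zetaThree by ring] at h
  refine h.congr fun x hx => ?_
  have h0 := hx.1.ne'
  field_simp
  ring

/-- `∫₀¹ log²((1+x)/2) / (1-x) dx`. -/
theorem integral_log_half_sq_div_one_sub :
    HasNewtonIntegral (fun x => (Real.log (1 + x) - Real.log 2) ^ 2 / (1 - x))
      (1 / 4 * zetaThree - Real.log 2 ^ 3 / 3) := by
  have h1 : HasNewtonIntegral (fun t => Real.log (1 + t) ^ 2 / (1 + t)) (Real.log 2 ^ 3 / 3) := by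
    have e : ∀ t : ℝ, 0 ≤ t → DifferentiableAt ℝ (fun t => Real.log (1 + t) ^ 3 / 3) t :=
      fun t ht => ((DifferentiableAt.log (by fun_prop) (by positivity)).pow 3).div_const 3
    refine ⟨_, _, _, fun t ht => ?_, tendsto_of_differentiableAt_zero (e 0 le_rfl),
      tendsto_of_differentiableAt_one (e 1 zero_le_one), by norm_num⟩
    have h1 : 1 + t ≠ 0 := by linarith [ht.1]
    refine (((((hasDerivAt_id t).const_add 1).log h1).pow 3).div_const 3).congr_deriv ?_
    simp only [id]; push_cast; field_simp
  -- Under the substitution, log((1 + x)/2) becomes −log(1 + t), and dx/(1 − x) becomes, up to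
  -- orientation, (1/t − 1/(1 + t)) dt.
  have h := (integral_log_one_add_sq_div.add (h1.const_mul (-1))).comp_cayley
  rw [show 1 / 4 * zetaThree + -1 * (Real.log 2 ^ 3 / 3) = 1 / 4 * zetaThree - Real.log 2 ^ 3 / 3 by ring] at h
  refine h.congr fun x hx => ?_
  have h0 := hx.1.ne'
  have h1 : 1 - x ≠ 0 := by linarith [hx.2]
  have h2 : 1 + x ≠ 0 := by linarith [hx.1]
  have e2 : 1 + (1 - x) / (1 + x) = 2 / (1 + x) := by field_simp; ring
  rw [e2, Real.log_div two_ne_zero h2]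
  field_simp
  ring

/-- The measure dx/(1 + x) is invariant under the substitution, while log(1 − x) becomes log 2 + log
t − log(1 + t). -/
theorem integral_inv_one_add_mul {p : ℝ → ℝ} {c : ℝ}
    (h : HasNewtonIntegral
      (fun t => p (Real.log 2 + Real.log t - Real.log (1 + t)) / (1 + t)) c) :
    HasNewtonIntegral (fun x => p (Real.log (1 - x)) / (1 + x)) c := by
  refine h.comp_cayley.congr fun x hx => ?_
  have h1 : 1 - x ≠ 0 := by linarith [hx.2]
  have h2 : 1 + x ≠ 0 := by linarith [hx.1]
  have e2 : 1 + (1 - x) / (1 + x) = 2 / (1 + x) := by field_simp; ring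
  rw [e2, Real.log_div two_ne_zero h2, Real.log_div h1 h2,
    show Real.log 2 + (Real.log (1 - x) - Real.log (1 + x)) - (Real.log 2 - Real.log (1 + x))
      = Real.log (1 - x) by ring]
  field_simp

theorem integral_log_half_pow_div_one_add (m : ℕ) :
    HasNewtonIntegral (fun t => (Real.log 2 - Real.log (1 + t)) ^ m / (1 + t))
      (Real.log 2 ^ (m + 1) / (m + 1)) := by
  have e : ∀ t : ℝ, 0 ≤ t →
      DifferentiableAt ℝ (fun t => -((Real.log 2 - Real.log (1 + t)) ^ (m + 1) / (m + 1))) t :=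
    fun t ht => ((((DifferentiableAt.log (by fun_prop) (by positivity)).const_sub _).pow _).div_const
      _).neg
  refine ⟨_, _, _, fun t ht => ?_, tendsto_of_differentiableAt_zero (e 0 le_rfl),
    tendsto_of_differentiableAt_one (e 1 zero_le_one), by norm_num⟩
  have h1 : 1 + t ≠ 0 := by linarith [ht.1]
  have h2 : (m : ℝ) + 1 ≠ 0 := by positivity
  refine (((((((hasDerivAt_id t).const_add 1).log h1).const_sub _).pow (m + 1)).div_const
    ((m : ℝ) + 1)).neg).congr_deriv ?_
  simp only [id]; push_cast; field_simp

/-- Integration by parts of ½ log t · log²(1 + t), whose boundary values both vanish. -/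
theorem integral_log_mul_log_one_add_div :
    HasNewtonIntegral (fun t => Real.log t * Real.log (1 + t) / (1 + t)) (-(1 / 8 * zetaThree)) := by
  have h1 : HasNewtonIntegral (fun t => Real.log (1 + t) ^ 2 / (2 * t)
      + Real.log t * Real.log (1 + t) / (1 + t)) 0 := by
    refine ⟨fun t => 1 / 2 * (Real.log t ^ 1 * Real.log (1 + t) ^ 2), 0, 0, fun t ht => ?_, ?_, ?_,
      by ring⟩
    · have h0 := ht.1.ne'
      have h1 : 1 + t ≠ 0 := by linarith [ht.1]
      refine ((((Real.hasDerivAt_log h0).pow 1).mul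
        ((((hasDerivAt_id t).const_add 1).log h1).pow 2)).const_mul (1 / 2)).congr_deriv ?_
      simp only [id, Pi.pow_apply]; push_cast; field_simp
    · have e1 : DifferentiableAt ℝ (fun t : ℝ => Real.log (1 + t) ^ 2) 0 :=
        (DifferentiableAt.log (by fun_prop) (by norm_num)).pow 2
      simpa using (tendsto_log_pow_mul_zero e1 (by simp) 1).const_mul (2⁻¹ : ℝ)
    · have e1 : DifferentiableAt ℝ (fun t : ℝ => 1 / 2 * (Real.log t ^ 1 * Real.log (1 + t) ^ 2)) 1 :=
        (((Real.differentiableAt_log one_ne_zero).pow 1).mul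
          ((DifferentiableAt.log (by fun_prop) (by norm_num)).pow 2)).const_mul _
      simpa using tendsto_of_differentiableAt_one e1
  have h := h1.add (integral_log_one_add_sq_div.const_mul (-(1 / 2)))
  rw [show 0 + -(1 / 2) * (1 / 4 * zetaThree) = -(1 / 8 * zetaThree) by ring] at h
  refine h.congr fun x hx => ?_
  have h0 := hx.1.ne'
  have h2 : 1 + x ≠ 0 := by linarith [hx.1]
  field_simp
  ring

theorem integral_log_one_sub_div_one_add :
    HasNewtonIntegral (fun x => Real.log (1 - x) / (1 + x))
      (Real.log 2 ^ 2 / 2 - Real.pi ^ 2 / 12) := by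
  refine integral_inv_one_add_mul (p := fun y => y) ?_
  have h := (integral_log_half_pow_div_one_add 1).add integral_log_div_one_add
  norm_num at h
  rw [← sub_eq_add_neg] at h
  refine h.congr fun t _ => ?_
  ring

theorem integral_log_one_sub_sq_div_one_add :
    HasNewtonIntegral (fun x => Real.log (1 - x) ^ 2 / (1 + x))
      (7 / 4 * zetaThree - Real.pi ^ 2 / 6 * Real.log 2 + Real.log 2 ^ 3 / 3) := by
  refine integral_inv_one_add_mul (p := fun y => y ^ 2) ?_
  have h := (((integral_log_half_pow_div_one_add 2).add
    (integral_log_div_one_add.const_mul (2 * Real.log 2))).add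
    (integral_log_mul_log_one_add_div.const_mul (-2))).add integral_log_sq_div_one_add
  rw [show Real.log 2 ^ (2 + 1) / (((2 : ℕ) : ℝ) + 1) + 2 * Real.log 2 * -(Real.pi ^ 2 / 12)
    + -2 * -(1 / 8 * zetaThree) + 3 / 2 * zetaThree
    = 7 / 4 * zetaThree - Real.pi ^ 2 / 6 * Real.log 2 + Real.log 2 ^ 3 / 3 by push_cast; ring] at h
  refine h.congr fun t _ => ?_
  ring

end

/-! ### An elementary primitive for the third-order integrand. -/

section

open Set

/-- Products of powers of `log (1 - x)`, `log ((1 + x) / 2)` and a rational function. -/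
def logTerm (i j : ℕ) (c₀ c₁ c₂ c₃ c₄ x : ℝ) : ℝ :=
  Real.log (1 - x) ^ i * ((Real.log (1 + x) - Real.log 2) ^ j *
    (c₀ + c₁ * x + c₂ * x ^ 2 + c₃ * x ^ 3 + c₄ / (1 + x)))

/-- The derivative of `logTerm`, where `a` and `β` stand for the two logarithms. -/
def logTermDeriv (i j : ℕ) (c₀ c₁ c₂ c₃ c₄ a β x : ℝ) : ℝ :=
  -(i * a ^ (i - 1) / (1 - x)) * (β ^ j *
    (c₀ + c₁ * x + c₂ * x ^ 2 + c₃ * x ^ 3 + c₄ / (1 + x)))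
  + a ^ i * (j * β ^ (j - 1) / (1 + x) * (c₀ + c₁ * x + c₂ * x ^ 2 + c₃ * x ^ 3 + c₄ / (1 + x))
    + β ^ j * (c₁ + 2 * c₂ * x + 3 * c₃ * x ^ 2 - c₄ / (1 + x) ^ 2))

section logTerm

variable {i j : ℕ} {c₀ c₁ c₂ c₃ c₄ : ℝ}

theorem hasDerivAt_logTerm {x : ℝ} (hx : x ∈ Ioo (0 : ℝ) 1) :
    HasDerivAt (logTerm i j c₀ c₁ c₂ c₃ c₄)
      (logTermDeriv i j c₀ c₁ c₂ c₃ c₄ (Real.log (1 - x)) (Real.log (1 + x) - Real.log 2) x) x := by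
  have h1 : 1 - x ≠ 0 := by linarith [hx.2]
  have h2 : 1 + x ≠ 0 := by linarith [hx.1]
  have da := (((hasDerivAt_id x).const_sub 1).log h1).fun_pow i
  have db := ((((hasDerivAt_id x).const_add 1).log h2).sub_const (Real.log 2)).fun_pow j
  have dp := (((((hasDerivAt_id x).const_mul c₁).const_add c₀).fun_add
    ((hasDerivAt_pow 2 x).const_mul c₂)).fun_add ((hasDerivAt_pow 3 x).const_mul c₃)).fun_add
    ((((hasDerivAt_id x).const_add 1).fun_inv h2).const_mul c₄)
  refine (da.fun_mul (db.fun_mul dp)).congr_deriv ?_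
  simp only [logTermDeriv, id, Nat.cast_ofNat, Nat.reduceSub, pow_one, div_eq_mul_inv]
  ring

theorem tendsto_logTerm_zero :
    Tendsto (logTerm i j c₀ c₁ c₂ c₃ c₄) (𝓝[>] 0)
      (𝓝 (0 ^ i * ((-Real.log 2) ^ j * (c₀ + c₄)))) := by
  have h : DifferentiableAt ℝ (logTerm i j c₀ c₁ c₂ c₃ c₄) 0 := by
    have h1 : DifferentiableAt ℝ (fun x : ℝ => Real.log (1 - x)) 0 :=
      DifferentiableAt.log (by fun_prop) (by norm_num)
    have h2 : DifferentiableAt ℝ (fun x : ℝ => Real.log (1 + x)) 0 :=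
      DifferentiableAt.log (by fun_prop) (by norm_num)
    have h3 : DifferentiableAt ℝ (fun x : ℝ => c₄ / (1 + x)) 0 :=
      DifferentiableAt.fun_div (by fun_prop) (by fun_prop) (by norm_num)
    unfold logTerm
    fun_prop
  have := tendsto_of_differentiableAt_zero h
  simpa [logTerm] using this

/-- For i > 0 the factor log(1 − x) diverges, so the rest must vanish at 1: either through the
second logarithm, normalised by log 2 to be zero there, or through the rational factor. -/
theorem tendsto_logTerm_one (h : i = 0 ∨ j ≠ 0 ∨ c₀ + c₁ + c₂ + c₃ + c₄ / 2 = 0) :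
    Tendsto (logTerm i j c₀ c₁ c₂ c₃ c₄) (𝓝[<] 1)
      (𝓝 (0 ^ i * (0 ^ j * (c₀ + c₁ + c₂ + c₃ + c₄ / 2)))) := by
  have hd : DifferentiableAt ℝ (fun x => (Real.log (1 + x) - Real.log 2) ^ j *
      (c₀ + c₁ * x + c₂ * x ^ 2 + c₃ * x ^ 3 + c₄ / (1 + x))) 1 := by
    have h2 : DifferentiableAt ℝ (fun x : ℝ => Real.log (1 + x)) 1 :=
      DifferentiableAt.log (by fun_prop) (by norm_num)
    have h3 : DifferentiableAt ℝ (fun x : ℝ => c₄ / (1 + x)) 1 :=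
      DifferentiableAt.fun_div (by fun_prop) (by fun_prop) (by norm_num)
    fun_prop
  have hv : (Real.log (1 + 1) - Real.log 2) ^ j *
      (c₀ + c₁ * 1 + c₂ * 1 ^ 2 + c₃ * 1 ^ 3 + c₄ / (1 + 1)) =
      0 ^ j * (c₀ + c₁ + c₂ + c₃ + c₄ / 2) := by
    norm_num
  rcases Nat.eq_zero_or_pos i with rfl | hi
  · have := tendsto_of_differentiableAt_one hd
    rw [hv] at this
    rw [pow_zero, one_mul]
    exact this.congr fun x => by simp [logTerm]
  · have h0 : (0 : ℝ) ^ j * (c₀ + c₁ + c₂ + c₃ + c₄ / 2) = 0 := by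
      rcases h with h | h | h
      · omega
      · rw [zero_pow h, zero_mul]
      · rw [h, mul_zero]
    rw [h0, mul_zero]
    exact tendsto_log_one_sub_pow_mul hd (hv.trans h0) i

end logTerm

/-- The ratio of the first order correction and `groundProfile`, in terms of `x = z / π` and of
`a = log (1 - x)`, `b = log (1 + x)`, `l = log 2`, `Λ = log (π² / 6)`. -/
def firstRatio (Λ l a b x : ℝ) : ℝ :=
  Λ + (-((1 - x) ^ 2 * (2 + x) * a) + (1 + x) ^ 2 * (2 - x) * b - 5 / 3 * (x * (1 - x) * (1 + x))
    - 4 * l * x) / (x * (1 - x) * (1 + x))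

/-- The integrand for the third order coefficient. -/
def thirdIntegrand (Λ l a b x : ℝ) : ℝ :=
  x * (1 - x) * (-(firstRatio Λ l a b x ^ 2 / 2) + (Λ + a + b) * firstRatio Λ l a b x
    + (Λ + a + b) ^ 3 / 6)
  - 6 * x * ((1 + x) * b - 2 * l * x) * (firstRatio Λ l a b x + (Λ + a + b) ^ 2 / 2)

/-- The elementary part of a primitive of `thirdIntegrand`. -/
def thirdPrimitive (Λ l x : ℝ) : ℝ :=
  logTerm 3 0 (-1 / 36) (0) (1 / 12) (-1 / 18) (0) x
    + logTerm 2 1 (29 / 12) (0) (-5 / 4) (-7 / 6) (0) x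
    + logTerm 1 2 (-17 / 12) (0) (-11 / 4) (-13 / 6) (0) x
    + logTerm 0 3 (13 / 36) (0) (-17 / 12) (-19 / 18) (0) x
    + logTerm 2 0 (-(1 / 12 * Λ) + 5 / 12 * l + 59 / 36) (-1 / 6)
        (1 / 4 * Λ - 5 / 4 * l + 1 / 4) (-(1 / 6 * Λ) + 5 / 6 * l + 5 / 18) (-4) x
    + logTerm 1 1 (29 / 6 * Λ + 35 / 6 * l - 289 / 18) (47 / 3)
        (-(5 / 2 * Λ) - 11 / 2 * l + 1 / 2) (-(7 / 3 * Λ) - 1 / 3 * l - 1 / 9) (0) x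
    + logTerm 0 2 (7 / 12 * Λ + 61 / 12 * l + 547 / 36) (95 / 6)
        (-(11 / 4 * Λ) - 17 / 4 * l + 1 / 4) (-(13 / 6 * Λ) - 7 / 6 * l - 7 / 18) (0) x
    + logTerm 1 0 (-(1 / 12 * Λ ^ 2) + 5 / 6 * l * Λ + 11 / 12 * l ^ 2 - 13 / 18 * Λ
        + 191 / 18 * l + 725 / 54) (-(1 / 3 * Λ) - 49 / 3 * l - 112 / 9)
        (1 / 4 * Λ ^ 2 - 5 / 2 * l * Λ - 11 / 4 * l ^ 2 + 1 / 2 * Λ + 1 / 2 * l - 5 / 6)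
        (-(1 / 6 * Λ ^ 2) + 5 / 3 * l * Λ + 11 / 6 * l ^ 2 + 5 / 9 * Λ + 11 / 9 * l - 4 / 27)
        (8 * l) x
    + logTerm 0 1 (1 / 12 * Λ ^ 2 + 31 / 6 * l * Λ - 203 / 12 * l ^ 2 + 55 / 18 * Λ
        - 245 / 18 * l - 2357 / 54) (11 / 3 * Λ - 73 / 3 * l - 388 / 9)
        (-(5 / 4 * Λ ^ 2) - 11 / 2 * l * Λ - 17 / 4 * l ^ 2 + 1 / 2 * Λ + 1 / 2 * l + 25 / 6)
        (-(7 / 6 * Λ ^ 2) - 1 / 3 * l * Λ + 5 / 6 * l ^ 2 - 1 / 9 * Λ + 5 / 9 * l + 98 / 27) (0) x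
    + logTerm 0 0 (0)
        (-(1 / 6 * Λ ^ 2) - 13 / 3 * l * Λ + 47 / 6 * l ^ 2 - 34 / 9 * Λ + 320 / 9 * l
        + 1541 / 27)
        (1 / 12 * Λ ^ 3 - 5 / 4 * l * Λ ^ 2 - 11 / 4 * l ^ 2 * Λ - 17 / 12 * l ^ 3
        + 1 / 4 * Λ ^ 2 + 1 / 2 * l * Λ + 1 / 4 * l ^ 2 - 5 / 6 * Λ + 25 / 6 * l - 17 / 36)
        (-(1 / 18 * Λ ^ 3) + 5 / 6 * l * Λ ^ 2 + 11 / 6 * l ^ 2 * Λ + 17 / 18 * l ^ 3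
        + 5 / 18 * Λ ^ 2 + 11 / 9 * l * Λ + 17 / 18 * l ^ 2 - 4 / 27 * Λ - 106 / 27 * l
        - 113 / 162) (-(4 * l ^ 2)) x

-- A rational identity in which a, β, l, Λ and x are independent, with β in the role of log((1 +
-- x)/2), so that log(1 + x) reads β + l. The last group holds the four integrands not covered by
-- the elementary primitive.
set_option maxHeartbeats 4000000 in
theorem thirdIntegrand_eq {Λ l a β x : ℝ} (h0 : x ≠ 0) (h1 : 1 - x ≠ 0) (h2 : 1 + x ≠ 0) :
    thirdIntegrand Λ l a (β + l) x =
      logTermDeriv 3 0 (-1 / 36) (0) (1 / 12) (-1 / 18) (0) a β x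
        + logTermDeriv 2 1 (29 / 12) (0) (-5 / 4) (-7 / 6) (0) a β x
        + logTermDeriv 1 2 (-17 / 12) (0) (-11 / 4) (-13 / 6) (0) a β x
        + logTermDeriv 0 3 (13 / 36) (0) (-17 / 12) (-19 / 18) (0) a β x
        + logTermDeriv 2 0 (-(1 / 12 * Λ) + 5 / 12 * l + 59 / 36) (-1 / 6)
            (1 / 4 * Λ - 5 / 4 * l + 1 / 4) (-(1 / 6 * Λ) + 5 / 6 * l + 5 / 18) (-4) a β x
        + logTermDeriv 1 1 (29 / 6 * Λ + 35 / 6 * l - 289 / 18) (47 / 3)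
            (-(5 / 2 * Λ) - 11 / 2 * l + 1 / 2) (-(7 / 3 * Λ) - 1 / 3 * l - 1 / 9) (0) a β x
        + logTermDeriv 0 2 (7 / 12 * Λ + 61 / 12 * l + 547 / 36) (95 / 6)
            (-(11 / 4 * Λ) - 17 / 4 * l + 1 / 4) (-(13 / 6 * Λ) - 7 / 6 * l - 7 / 18) (0) a β x
        + logTermDeriv 1 0 (-(1 / 12 * Λ ^ 2) + 5 / 6 * l * Λ + 11 / 12 * l ^ 2 - 13 / 18 * Λ
            + 191 / 18 * l + 725 / 54) (-(1 / 3 * Λ) - 49 / 3 * l - 112 / 9)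
            (1 / 4 * Λ ^ 2 - 5 / 2 * l * Λ - 11 / 4 * l ^ 2 + 1 / 2 * Λ + 1 / 2 * l - 5 / 6)
            (-(1 / 6 * Λ ^ 2) + 5 / 3 * l * Λ + 11 / 6 * l ^ 2 + 5 / 9 * Λ + 11 / 9 * l
            - 4 / 27) (8 * l) a β x
        + logTermDeriv 0 1 (1 / 12 * Λ ^ 2 + 31 / 6 * l * Λ - 203 / 12 * l ^ 2 + 55 / 18 * Λ
            - 245 / 18 * l - 2357 / 54) (11 / 3 * Λ - 73 / 3 * l - 388 / 9)
            (-(5 / 4 * Λ ^ 2) - 11 / 2 * l * Λ - 17 / 4 * l ^ 2 + 1 / 2 * Λ + 1 / 2 * l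
            + 25 / 6)
            (-(7 / 6 * Λ ^ 2) - 1 / 3 * l * Λ + 5 / 6 * l ^ 2 - 1 / 9 * Λ + 5 / 9 * l + 98 / 27)
            (0) a β x
        + logTermDeriv 0 0 (0)
            (-(1 / 6 * Λ ^ 2) - 13 / 3 * l * Λ + 47 / 6 * l ^ 2 - 34 / 9 * Λ + 320 / 9 * l
            + 1541 / 27)
            (1 / 12 * Λ ^ 3 - 5 / 4 * l * Λ ^ 2 - 11 / 4 * l ^ 2 * Λ - 17 / 12 * l ^ 3
            + 1 / 4 * Λ ^ 2 + 1 / 2 * l * Λ + 1 / 4 * l ^ 2 - 5 / 6 * Λ + 25 / 6 * l - 17 / 36)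
            (-(1 / 18 * Λ ^ 3) + 5 / 6 * l * Λ ^ 2 + 11 / 6 * l ^ 2 * Λ + 17 / 18 * l ^ 3
            + 5 / 18 * Λ ^ 2 + 11 / 9 * l * Λ + 17 / 18 * l ^ 2 - 4 / 27 * Λ - 106 / 27 * l
            - 113 / 162) (-(4 * l ^ 2)) a β x
        + (-2 * ((a - (β + l)) ^ 2 / x) + -(1 / 3) * (a ^ 2 / (1 + x))
          + (58 / 3 * l - 14 / 3 * Λ + 184 / 9) * (a / (1 + x)) + -(97 / 3) * (β ^ 2 / (1 - x))) := by
  simp only [thirdIntegrand, firstRatio, logTermDeriv]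
  norm_num only [pow_zero, pow_one, Nat.cast_ofNat, Nat.cast_zero, Nat.cast_one, Nat.reduceSub,
    zero_mul, mul_zero, zero_div, neg_zero, zero_add, add_zero, one_mul, mul_one, sub_zero]
  field_simp
  ring

end

/-! ### Value of the third-order integral. -/

section

open Set

set_option maxHeartbeats 1000000 in
theorem hasNewtonIntegral_thirdIntegrand (Λ : ℝ) :
    HasNewtonIntegral
      (fun x => thirdIntegrand Λ (Real.log 2) (Real.log (1 - x)) (Real.log (1 + x)) x)
      (18113 / 324 - 46 / 27 * Real.pi ^ 2 - (212 / 27 + 14 / 9 * Real.pi ^ 2) * Real.log 2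
        - 68 / 9 * Real.log 2 ^ 2 - 16 / 9 * Real.log 2 ^ 3 - 47 / 3 * zetaThree
        + (-(257 / 54) + 7 / 18 * Real.pi ^ 2 + 4 / 9 * Real.log 2 + 4 / 3 * Real.log 2 ^ 2) * Λ
        + (13 / 36 - 1 / 3 * Real.log 2) * Λ ^ 2 + 1 / 36 * Λ ^ 3) := by
  set l := Real.log 2 with hl
  have hP : HasNewtonIntegral (deriv (thirdPrimitive Λ l)) (18113 / 324 - 184 / 9 * (l ^ 2 / 2)
      - 212 / 27 * l - 68 / 9 * l ^ 2 - 16 / 9 * l ^ 3 - 58 / 3 * l * (l ^ 2 / 2)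
      + 14 / 3 * Λ * (l ^ 2 / 2) + 1 / 9 * l ^ 3 - 97 / 9 * l ^ 3
      + (-(257 / 54) + 4 / 9 * l + 4 / 3 * l ^ 2) * Λ
      + (13 / 36 - 1 / 3 * l) * Λ ^ 2 + 1 / 36 * Λ ^ 3) := by
    refine ⟨thirdPrimitive Λ l, ?A, ?B, fun x hx => ?d, ?z, ?o, ?v⟩
    case z =>
      unfold thirdPrimitive
      exact (((((((((tendsto_logTerm_zero.add tendsto_logTerm_zero).add tendsto_logTerm_zero).add
        tendsto_logTerm_zero).add tendsto_logTerm_zero).add tendsto_logTerm_zero).add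
        tendsto_logTerm_zero).add tendsto_logTerm_zero).add tendsto_logTerm_zero).add
        tendsto_logTerm_zero)
    case o =>
      unfold thirdPrimitive
      refine (((((((((Tendsto.add (tendsto_logTerm_one ?_) (tendsto_logTerm_one ?_)).add
        (tendsto_logTerm_one ?_)).add (tendsto_logTerm_one ?_)).add
        (tendsto_logTerm_one ?_)).add (tendsto_logTerm_one ?_)).add
        (tendsto_logTerm_one ?_)).add (tendsto_logTerm_one ?_)).add
        (tendsto_logTerm_one ?_)).add (tendsto_logTerm_one ?_))
      · norm_num
      · norm_num
      · norm_num
      · norm_num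
      -- With a pure power of log(1 − x), convergence at 1 requires the rational coefficient to
      -- vanish there.
      · exact Or.inr (Or.inr (by ring))
      · norm_num
      · norm_num
      · exact Or.inr (Or.inr (by ring))
      · norm_num
      · norm_num
    case v => rw [← hl]; ring
    case d =>
      refine DifferentiableAt.hasDerivAt ?_
      unfold thirdPrimitive
      have h : ∀ i j c₀ c₁ c₂ c₃ c₄, DifferentiableAt ℝ (fun x => logTerm i j c₀ c₁ c₂ c₃ c₄ x) x :=
        fun i j c₀ c₁ c₂ c₃ c₄ => (hasDerivAt_logTerm hx).differentiableAt
      exact (((((((((h _ _ _ _ _ _ _).fun_add (h _ _ _ _ _ _ _)).fun_add (h _ _ _ _ _ _ _)).fun_add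
        (h _ _ _ _ _ _ _)).fun_add (h _ _ _ _ _ _ _)).fun_add (h _ _ _ _ _ _ _)).fun_add
        (h _ _ _ _ _ _ _)).fun_add (h _ _ _ _ _ _ _)).fun_add (h _ _ _ _ _ _ _)).fun_add
        (h _ _ _ _ _ _ _)
  have hB := (((integral_log_sub_log_sq_div.const_mul (-2)).add
    (integral_log_one_sub_sq_div_one_add.const_mul (-(1 / 3)))).add
    (integral_log_one_sub_div_one_add.const_mul (58 / 3 * l - 14 / 3 * Λ + 184 / 9))).add
    (integral_log_half_sq_div_one_sub.const_mul (-(97 / 3)))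
  rw [← hl] at hB
  have h := hP.add hB
  convert! h.congr (g := fun x => thirdIntegrand Λ l (Real.log (1 - x)) (Real.log (1 + x)) x)
    fun x hx => ?_ using 1
  · ring
  · have h0 := hx.1.ne'
    have h1 : 1 - x ≠ 0 := by linarith [hx.2]
    have h2 : 1 + x ≠ 0 := by linarith [hx.1]
    have e := thirdIntegrand_eq (Λ := Λ) (l := l) (a := Real.log (1 - x))
      (β := Real.log (1 + x) - l) h0 h1 h2
    rw [sub_add_cancel] at e
    rw [e]
    congr 1
    have hd : ∀ i j c₀ c₁ c₂ c₃ c₄, HasDerivAt (fun x => logTerm i j c₀ c₁ c₂ c₃ c₄ x)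
        (logTermDeriv i j c₀ c₁ c₂ c₃ c₄ (Real.log (1 - x)) (Real.log (1 + x) - l) x) x :=
      fun i j c₀ c₁ c₂ c₃ c₄ => hasDerivAt_logTerm hx
    exact ((((((((((hd _ _ _ _ _ _ _).fun_add (hd _ _ _ _ _ _ _)).fun_add
      (hd _ _ _ _ _ _ _)).fun_add (hd _ _ _ _ _ _ _)).fun_add (hd _ _ _ _ _ _ _)).fun_add
      (hd _ _ _ _ _ _ _)).fun_add (hd _ _ _ _ _ _ _)).fun_add (hd _ _ _ _ _ _ _)).fun_add
      (hd _ _ _ _ _ _ _)).fun_add (hd _ _ _ _ _ _ _)).deriv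

end

/-! ### Reduction of the third coefficient to a one-dimensional integral. -/

section

open Set

/-- `x ↦ x u(π x)` for the potential `u` of `f`. -/
def scaledPotential (f : ℝ → ℝ) (x : ℝ) : ℝ := x * green f (Real.pi * x)

/-- The derivative of `scaledPotential f`. -/
def scaledSlope (f : ℝ → ℝ) (x : ℝ) : ℝ :=
  green f (Real.pi * x) - Real.pi * x * radialFlux f (Real.pi * x)

theorem pi_mul_mem_Ioo {x : ℝ} (hx : x ∈ Ioo (0 : ℝ) 1) : Real.pi * x ∈ Ioo 0 Real.pi :=
  ⟨mul_pos Real.pi_pos hx.1, mul_lt_of_lt_one_right Real.pi_pos hx.2⟩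

theorem tendsto_scaled_zero {g : ℝ → ℝ} (hg : ContinuousOn g (Icc 0 Real.pi)) :
    Tendsto (fun x => g (Real.pi * x)) (𝓝[>] 0) (𝓝 (g 0)) := by
  refine (hg 0 ⟨le_rfl, Real.pi_pos.le⟩).tendsto.comp (tendsto_nhdsWithin_iff.2 ⟨?_, ?_⟩)
  · have hc : Continuous fun x : ℝ => Real.pi * x := by fun_prop
    simpa using (hc.tendsto 0).mono_left nhdsWithin_le_nhds
  · filter_upwards [Ioo_mem_nhdsGT (zero_lt_one' ℝ)] with x hx
    exact Ioo_subset_Icc_self (pi_mul_mem_Ioo hx)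

theorem tendsto_scaled_one {g : ℝ → ℝ} (hg : ContinuousOn g (Icc 0 Real.pi)) :
    Tendsto (fun x => g (Real.pi * x)) (𝓝[<] 1) (𝓝 (g Real.pi)) := by
  refine (hg Real.pi ⟨Real.pi_pos.le, le_rfl⟩).tendsto.comp (tendsto_nhdsWithin_iff.2 ⟨?_, ?_⟩)
  · have hc : Continuous fun x : ℝ => Real.pi * x := by fun_prop
    simpa using (hc.tendsto 1).mono_left nhdsWithin_le_nhds
  · filter_upwards [Ioo_mem_nhdsLT (zero_lt_one' ℝ)] with x hx
    exact Ioo_subset_Icc_self (pi_mul_mem_Ioo hx)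

theorem tendsto_id_zero : Tendsto (fun x : ℝ => x) (𝓝[>] 0) (𝓝 0) := nhdsWithin_le_nhds

theorem tendsto_id_one : Tendsto (fun x : ℝ => x) (𝓝[<] 1) (𝓝 1) := nhdsWithin_le_nhds

namespace Admissible

variable {f : ℝ → ℝ}

theorem hasDerivAt_scaledPotential (hf : Admissible f) {x : ℝ} (hx : x ∈ Ioo (0 : ℝ) 1) :
    HasDerivAt (scaledPotential f) (scaledSlope f x) x := by
  have h := HasDerivAt.comp (h₂ := green f) (h := fun x => Real.pi * x) x
    (hf.hasDerivAt_green (pi_mul_mem_Ioo hx)) ((hasDerivAt_id x).const_mul Real.pi)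
  refine ((hasDerivAt_id x).mul h).congr_deriv ?_
  simp only [scaledSlope, id, Function.comp_apply]
  ring

/-- Multiplying the potential by x turns the radial Laplacian into an ordinary second derivative. -/
theorem hasDerivAt_scaledSlope (hf : Admissible f) {x : ℝ} (hx : x ∈ Ioo (0 : ℝ) 1) :
    HasDerivAt (scaledSlope f) (-(Real.pi ^ 2 * x * f (Real.pi * x))) x := by
  have hd := (hasDerivAt_id x).const_mul Real.pi
  have h := HasDerivAt.comp (h₂ := green f) (h := fun x => Real.pi * x) x
    (hf.hasDerivAt_green (pi_mul_mem_Ioo hx)) hd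
  have h' := HasDerivAt.comp (h₂ := radialFlux f) (h := fun x => Real.pi * x) x
    (hf.hasDerivAt_flux (pi_mul_mem_Ioo hx)) hd
  refine (h.sub (hd.mul h')).congr_deriv ?_
  have h0 := hx.1.ne'
  have hp := Real.pi_ne_zero
  simp only [id, Function.comp_apply]
  field_simp
  ring

theorem tendsto_scaledPotential_zero (hf : Admissible f) :
    Tendsto (scaledPotential f) (𝓝[>] 0) (𝓝 0) := by
  unfold scaledPotential
  simpa using tendsto_id_zero.mul (tendsto_scaled_zero hf.continuousOn_green)

theorem tendsto_scaledPotential_one (hf : Admissible f) :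
    Tendsto (scaledPotential f) (𝓝[<] 1) (𝓝 0) := by
  unfold scaledPotential
  simpa [green_pi] using
    tendsto_id_one.mul (tendsto_scaled_one hf.continuousOn_green)

theorem tendsto_scaledSlope_zero (hf : Admissible f) :
    Tendsto (scaledSlope f) (𝓝[>] 0) (𝓝 (green f 0)) := by
  unfold scaledSlope
  simpa using (tendsto_scaled_zero hf.continuousOn_green).sub
    ((tendsto_id_zero.const_mul Real.pi).mul (tendsto_scaled_zero hf.continuousOn_flux))

theorem tendsto_scaledSlope_one (hf : Admissible f) :
    Tendsto (scaledSlope f) (𝓝[<] 1) (𝓝 (-(Real.pi * radialFlux f Real.pi))) := by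
  unfold scaledSlope
  simpa [green_pi] using (tendsto_scaled_one hf.continuousOn_green).sub
    ((tendsto_id_one.const_mul Real.pi).mul (tendsto_scaled_one hf.continuousOn_flux))

/-- The value of the potential at the origin as a one-dimensional integral. -/
theorem integral_green_zero (hf : Admissible f) :
    HasNewtonIntegral (fun x => x * (1 - x) * f (Real.pi * x)) (green f 0 / Real.pi ^ 2) := by
  have hp := Real.pi_ne_zero
  -- With W the scaled potential, ((1 − x)W′ + W)′ = (1 − x)W″. The weight 1 − x is linear and
  -- vanishes at 1, so only W′(0), the potential at the origin, survives.
  refine ⟨fun x => -(Real.pi ^ 2)⁻¹ * ((1 - x) * scaledSlope f x + scaledPotential f x),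
    -(Real.pi ^ 2)⁻¹ * ((1 - 0) * green f 0 + 0),
    -(Real.pi ^ 2)⁻¹ * ((1 - 1) * -(Real.pi * radialFlux f Real.pi) + 0), fun x hx => ?_,
    (((tendsto_id_zero.const_sub 1).mul hf.tendsto_scaledSlope_zero).add
      hf.tendsto_scaledPotential_zero).const_mul _,
    (((tendsto_id_one.const_sub 1).mul hf.tendsto_scaledSlope_one).add
      hf.tendsto_scaledPotential_one).const_mul _, by field_simp; ring⟩
  refine (((((hasDerivAt_id x).const_sub 1).mul (hf.hasDerivAt_scaledSlope hx)).add
    (hf.hasDerivAt_scaledPotential hx)).const_mul _).congr_deriv ?_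
  simp only [id]
  field_simp
  ring

/-- Green's identity for the potential of `f` and `(1 + x) log (1 + x) - 2 x log 2`. -/
theorem integral_green_identity (hf : Admissible f) :
    HasNewtonIntegral (fun x => scaledPotential f x / (1 + x) + Real.pi ^ 2 * x * f (Real.pi * x) *
      ((1 + x) * Real.log (1 + x) - 2 * Real.log 2 * x)) 0 := by
  have d1 : ∀ x : ℝ, 0 ≤ x → HasDerivAt
      (fun x => (1 + x) * Real.log (1 + x) - 2 * Real.log 2 * x)
      (Real.log (1 + x) + 1 - 2 * Real.log 2) x := fun x hx => by
    have h1 : 1 + x ≠ 0 := by positivity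
    have h := (hasDerivAt_id x).const_add 1
    refine ((h.mul (h.log h1)).sub ((hasDerivAt_id x).const_mul (2 * Real.log 2))).congr_deriv ?_
    simp only [id]; field_simp
  have d2 : ∀ x : ℝ, 0 ≤ x → HasDerivAt (fun x => Real.log (1 + x) + 1 - 2 * Real.log 2)
      (1 / (1 + x)) x := fun x hx => by
    have h1 : 1 + x ≠ 0 := by positivity
    exact ((((hasDerivAt_id x).const_add 1).log h1).add_const 1).sub_const _
  have z1 := tendsto_of_differentiableAt_zero (d1 0 le_rfl).differentiableAt
  have z2 := tendsto_of_differentiableAt_zero (d2 0 le_rfl).differentiableAt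
  have o1 := tendsto_of_differentiableAt_one (d1 1 zero_le_one).differentiableAt
  have o2 := tendsto_of_differentiableAt_one (d2 1 zero_le_one).differentiableAt
  -- The primitive is Wφ′ − W′φ, with W the scaled potential and φ = (1 + x) log(1 + x) − 2x log 2.
  -- Both W and φ vanish at 0 and 1, and φ″ = 1/(1 + x).
  refine ⟨_, _, _, fun x hx => ?_,
    (hf.tendsto_scaledPotential_zero.mul z2).sub (hf.tendsto_scaledSlope_zero.mul z1),
    (hf.tendsto_scaledPotential_one.mul o2).sub (hf.tendsto_scaledSlope_one.mul o1), ?_⟩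
  · refine (((hf.hasDerivAt_scaledPotential hx).fun_mul (d2 x hx.1.le)).fun_sub
      ((hf.hasDerivAt_scaledSlope hx).fun_mul (d1 x hx.1.le))).congr_deriv ?_
    ring
  · norm_num

/-- A function with the same second derivative and vanishing boundary values is the scaled
potential. -/
theorem scaledPotential_eq (hf : Admissible f) {W V : ℝ → ℝ}
    (hW : ∀ x ∈ Ioo (0 : ℝ) 1, HasDerivAt W (V x) x)
    (hV : ∀ x ∈ Ioo (0 : ℝ) 1, HasDerivAt V (-(Real.pi ^ 2 * x * f (Real.pi * x))) x)
    (h0 : Tendsto W (𝓝[>] 0) (𝓝 0)) (h1 : Tendsto W (𝓝[<] 1) (𝓝 0)) :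
    ∀ x ∈ Ioo (0 : ℝ) 1, scaledPotential f x = W x := by
  have hm : (1 / 2 : ℝ) ∈ Ioo (0 : ℝ) 1 := by constructor <;> norm_num
  obtain ⟨c, hc⟩ : ∃ c, ∀ x ∈ Ioo (0 : ℝ) 1, scaledSlope f x - V x = c :=
    ⟨_, fun x hx => const_of_hasDerivAt_zero (d := fun x => scaledSlope f x - V x) (fun x hx =>
      ((hf.hasDerivAt_scaledSlope hx).fun_sub (hV x hx)).congr_deriv (sub_self _)) hx hm⟩
  obtain ⟨e, he⟩ : ∃ e, ∀ x ∈ Ioo (0 : ℝ) 1, scaledPotential f x - W x - c * x = e :=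
    ⟨_, fun x hx => const_of_hasDerivAt_zero (d := fun x => scaledPotential f x - W x - c * x)
      (fun x hx => by
        refine (((hf.hasDerivAt_scaledPotential hx).fun_sub (hW x hx)).fun_sub
          ((hasDerivAt_id x).const_mul c)).congr_deriv ?_
        rw [hc x hx]; ring) hx hm⟩
  have t0 : Tendsto (fun _ : ℝ => e) (𝓝[>] 0) (𝓝 (0 - 0 - c * 0)) :=
    ((hf.tendsto_scaledPotential_zero.sub h0).sub (tendsto_id_zero.const_mul c)).congr' (by
      filter_upwards [Ioo_mem_nhdsGT (zero_lt_one' ℝ)] with x hx using he x hx)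
  have t1 : Tendsto (fun _ : ℝ => e) (𝓝[<] 1) (𝓝 (0 - 0 - c * 1)) :=
    ((hf.tendsto_scaledPotential_one.sub h1).sub (tendsto_id_one.const_mul c)).congr' (by
      filter_upwards [Ioo_mem_nhdsLT (zero_lt_one' ℝ)] with x hx using he x hx)
  have e0 := tendsto_nhds_unique t0 tendsto_const_nhds
  have e1 := tendsto_nhds_unique t1 tendsto_const_nhds
  intro x hx
  have := he x hx
  rw [show c = 0 by linarith, ← e0] at this
  linarith

end Admissible

theorem groundProfile_scaled (x : ℝ) :
    groundProfile (Real.pi * x) = Real.pi ^ 2 / 6 * ((1 - x) * (1 + x)) := by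
  rw [groundProfile]; ring

theorem source₁_scaled {x : ℝ} (hx : x ∈ Ioo (0 : ℝ) 1) : source₁ (Real.pi * x) =
    Real.log (Real.pi ^ 2 / 6) + Real.log (1 - x) + Real.log (1 + x) := by
  have h1 : 1 - x ≠ 0 := by linarith [hx.2]
  have h2 : 1 + x ≠ 0 := by linarith [hx.1]
  have hp := Real.pi_ne_zero
  rw [source₁, groundProfile_scaled, Real.log_mul (by positivity) (mul_ne_zero h1 h2),
    Real.log_mul h1 h2]
  ring

theorem ratio_scaled (f : ℝ → ℝ) {x : ℝ} (hx : x ∈ Ioo (0 : ℝ) 1) : ratio f (Real.pi * x) =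
    scaledPotential f x / (Real.pi ^ 2 / 6 * (x * (1 - x) * (1 + x))) := by
  have h0 := hx.1.ne'
  have h1 : 1 - x ≠ 0 := by linarith [hx.2]
  have h2 : 1 + x ≠ 0 := by linarith [hx.1]
  have hp := Real.pi_ne_zero
  rw [ratio, groundProfile_scaled, scaledPotential]
  field_simp

/-- Two integrations of the explicit logarithmic source; the term −4x log 2 enforces the zero at x =
1. The exponent 1 matches the form of the boundary-limit lemma. -/
theorem scaledPotential_source₁ {x : ℝ} (hx : x ∈ Ioo (0 : ℝ) 1) : scaledPotential source₁ x =
    Real.pi ^ 2 / 6 * (Real.log (Real.pi ^ 2 / 6) * (x - x ^ 3)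
      - Real.log (1 - x) ^ 1 * ((1 - x) ^ 2 * (2 + x)) + (1 + x) ^ 2 * (2 - x) * Real.log (1 + x)
      - 5 / 3 * (x - x ^ 3) - 4 * Real.log 2 * x) := by
  set Λ := Real.log (Real.pi ^ 2 / 6) with hΛ
  refine admissible_source₁.scaledPotential_eq (W := fun x => Real.pi ^ 2 / 6 * (Λ * (x - x ^ 3)
      - Real.log (1 - x) ^ 1 * ((1 - x) ^ 2 * (2 + x)) + (1 + x) ^ 2 * (2 - x) * Real.log (1 + x)
      - 5 / 3 * (x - x ^ 3) - 4 * Real.log 2 * x))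
    (V := fun x => Real.pi ^ 2 / 6 * (Λ * (1 - 3 * x ^ 2)
      + 3 * ((1 - x ^ 2) * (Real.log (1 - x) + Real.log (1 + x))) + 3 * x ^ 2 + 7 / 3
      - 4 * Real.log 2)) (fun x hx => ?_) (fun x hx => ?_) ?_ ?_ x hx
  · have h1 : 1 - x ≠ 0 := by linarith [hx.2]
    have h2 : 1 + x ≠ 0 := by linarith [hx.1]
    have i := hasDerivAt_id x
    have p3 := i.sub (hasDerivAt_pow 3 x)
    refine (((((p3.const_mul Λ).sub ((((i.const_sub 1).log h1).pow 1).mul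
      (((i.const_sub 1).pow 2).mul (i.const_add 2)))).add
      ((((i.const_add 1).pow 2).mul (i.const_sub 2)).mul ((i.const_add 1).log h2))).sub
      (p3.const_mul (5 / 3))).sub (i.const_mul (4 * Real.log 2))).const_mul _ |>.congr_deriv ?_
    simp only [id, Pi.mul_apply, Pi.pow_apply, Nat.cast_ofNat, Nat.reduceSub, pow_one, Nat.cast_one,
      Nat.sub_self, pow_zero]
    field_simp
    ring
  · have h1 : 1 - x ≠ 0 := by linarith [hx.2]
    have h2 : 1 + x ≠ 0 := by linarith [hx.1]
    have i := hasDerivAt_id x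
    have p2 := hasDerivAt_pow 2 x
    refine ((((((p2.const_mul 3).const_sub 1).const_mul Λ).add
      (((p2.const_sub 1).mul (((i.const_sub 1).log h1).add ((i.const_add 1).log h2))).const_mul
        3)).add (p2.const_mul 3)).add_const (7 / 3)).sub_const (4 * Real.log 2) |>.const_mul _
        |>.congr_deriv ?_
    rw [source₁_scaled hx, ← hΛ]
    simp only [id, Pi.add_apply, Nat.cast_ofNat, Nat.reduceSub, pow_one]
    field_simp
    ring
  · have hd : DifferentiableAt ℝ (fun x => Real.pi ^ 2 / 6 * (Λ * (x - x ^ 3)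
      - Real.log (1 - x) ^ 1 * ((1 - x) ^ 2 * (2 + x)) + (1 + x) ^ 2 * (2 - x) * Real.log (1 + x)
      - 5 / 3 * (x - x ^ 3) - 4 * Real.log 2 * x)) 0 := by
      have h1 : DifferentiableAt ℝ (fun x : ℝ => Real.log (1 - x)) 0 :=
        DifferentiableAt.log (by fun_prop) (by norm_num)
      have h2 : DifferentiableAt ℝ (fun x : ℝ => Real.log (1 + x)) 0 :=
        DifferentiableAt.log (by fun_prop) (by norm_num)
      fun_prop
    simpa using tendsto_of_differentiableAt_zero hd
  · have hd : DifferentiableAt ℝ (fun x => Λ * (x - x ^ 3) + (1 + x) ^ 2 * (2 - x) * Real.log (1 + x)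
      - 5 / 3 * (x - x ^ 3) - 4 * Real.log 2 * x) 1 := by
      have h2 : DifferentiableAt ℝ (fun x : ℝ => Real.log (1 + x)) 1 :=
        DifferentiableAt.log (by fun_prop) (by norm_num)
      fun_prop
    have t1 := tendsto_of_differentiableAt_one hd
    have t2 := tendsto_log_one_sub_pow_mul (f := fun x => (1 - x) ^ 2 * (2 + x)) (by fun_prop)
      (by norm_num) 1
    have t3 := (t1.sub t2).const_mul (Real.pi ^ 2 / 6)
    refine (t3.congr fun x => by ring).trans ?_
    norm_num

theorem firstRatio_scaled {x : ℝ} (hx : x ∈ Ioo (0 : ℝ) 1) : ratio source₁ (Real.pi * x) =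
    firstRatio (Real.log (Real.pi ^ 2 / 6)) (Real.log 2) (Real.log (1 - x)) (Real.log (1 + x)) x := by
  have h0 := hx.1.ne'
  have h1 : 1 - x ≠ 0 := by linarith [hx.2]
  have h2 : 1 + x ≠ 0 := by linarith [hx.1]
  have hp := Real.pi_ne_zero
  rw [ratio_scaled _ hx, scaledPotential_source₁ hx, firstRatio]
  generalize Real.log (Real.pi ^ 2 / 6) = Λ
  field_simp
  ring

/-- The third order coefficient in closed form. -/
theorem green_source₃_zero : green source₃ 0 =
    18113 / 324 * Real.pi ^ 2 - 46 / 27 * Real.pi ^ 4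
      - (212 / 27 * Real.pi ^ 2 + 14 / 9 * Real.pi ^ 4) * Real.log 2
      - 68 / 9 * Real.pi ^ 2 * Real.log 2 ^ 2
      - 16 / 9 * Real.pi ^ 2 * Real.log 2 ^ 3
      - 47 / 3 * Real.pi ^ 2 * (riemannZeta 3).re
      + (-(257 / 54) * Real.pi ^ 2 + 7 / 18 * Real.pi ^ 4
          + 4 / 9 * Real.pi ^ 2 * Real.log 2
          + 4 / 3 * Real.pi ^ 2 * Real.log 2 ^ 2) * Real.log (Real.pi ^ 2 / 6)
      + (13 / 36 * Real.pi ^ 2 - 1 / 3 * Real.pi ^ 2 * Real.log 2)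
          * Real.log (Real.pi ^ 2 / 6) ^ 2
      + 1 / 36 * Real.pi ^ 2 * Real.log (Real.pi ^ 2 / 6) ^ 3 := by
  have hp := Real.pi_ne_zero
  -- The second-order potential enters as (6/π²)W₂/(1 + x). Subtracting 6/π² times Green's identity,
  -- whose integral is 0, trades it for the explicit second source.
  have h := admissible_source₃.integral_green_zero.add
    (admissible_source₂.integral_green_identity.const_mul (-(6 / Real.pi ^ 2)))
  have h' := h.congr (g := fun x => thirdIntegrand (Real.log (Real.pi ^ 2 / 6)) (Real.log 2)
    (Real.log (1 - x)) (Real.log (1 + x)) x) fun x hx => by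
      have h0 := hx.1.ne'
      have h1 : 1 - x ≠ 0 := by linarith [hx.2]
      have h2 : 1 + x ≠ 0 := by linarith [hx.1]
      have e1 := firstRatio_scaled hx
      have e2 := source₁_scaled hx
      rw [source₁] at e2
      rw [source₃, source₂, e1, e2, ratio_scaled source₂ hx, thirdIntegrand]
      generalize firstRatio (Real.log (Real.pi ^ 2 / 6)) (Real.log 2) (Real.log (1 - x))
        (Real.log (1 + x)) x = r
      field_simp
      ring
  have e := h'.unique (hasNewtonIntegral_thirdIntegrand _)
  rw [mul_zero, add_zero, div_eq_iff (by positivity), zetaThree] at e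
  rw [e]
  ring

end

/-! ### Accelerated series for ζ(3) and alternating bounds for arctan. -/

section

open Set

/-- The terms of the `m`-th accelerated series for `ζ(3)`. -/
def zetaTerm (m k : ℕ) : ℝ :=
  (k.factorial : ℝ) / ((k + m + 1 : ℝ) ^ 2 * ((k + 2 * m + 1).factorial : ℝ))

/-- The coefficient of the central factorial series for `ζ(3)`, up to a factor `± m!²`. -/
def zetaCoeff (m : ℕ) : ℝ := 5 / (2 * (m + 1) * ((2 * m + 2).factorial : ℝ))

theorem zetaTerm_nonneg (m k : ℕ) : 0 ≤ zetaTerm m k := by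
  unfold zetaTerm; positivity

theorem summable_zetaTerm (m : ℕ) : Summable (zetaTerm m) := by
  refine Summable.of_nonneg_of_le (zetaTerm_nonneg m) (fun k => ?_)
    (summable_inv_succ_pow (k := 2) le_rfl)
  have h : (k.factorial : ℝ) ≤ ((k + 2 * m + 1).factorial : ℝ) := by
    exact_mod_cast Nat.factorial_le (by omega)
  have hk : (0 : ℝ) < k.factorial := by positivity
  rw [zetaTerm, div_le_div_iff₀ (by positivity) (by positivity), one_mul, mul_comm]
  gcongr
  linarith [(Nat.cast_nonneg m : (0 : ℝ) ≤ m)]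

/-- Telescoping with F(k) = k!/((2m + 2)(k + 2m + 2)!), which tends to 0. -/
theorem hasSum_factorial_ratio (m : ℕ) :
    HasSum (fun k : ℕ => (k.factorial : ℝ) / ((k + 2 * m + 3).factorial : ℝ))
      (1 / ((2 * m + 2) * ((2 * m + 2).factorial : ℝ))) := by
  set F : ℕ → ℝ := fun k => (k.factorial : ℝ) / ((2 * m + 2) * ((k + 2 * m + 2).factorial : ℝ))
  have hF : ∀ k : ℕ, (k.factorial : ℝ) / ((k + 2 * m + 3).factorial : ℝ) = F k - F (k + 1) := by
    intro k
    have e : (k + 1 + 2 * m + 2).factorial = (k + 2 * m + 3) * (k + 2 * m + 2).factorial := by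
      rw [show k + 1 + 2 * m + 2 = (k + 2 * m + 2) + 1 by ring, Nat.factorial_succ]
    have e' : (k + 2 * m + 3).factorial = (k + 2 * m + 3) * (k + 2 * m + 2).factorial := by
      rw [show k + 2 * m + 3 = (k + 2 * m + 2) + 1 by ring, Nat.factorial_succ]
    have h0 : ((k + 2 * m + 2).factorial : ℝ) ≠ 0 := by positivity
    simp only [F]
    rw [e, e', Nat.factorial_succ k]
    push_cast
    field_simp
    ring
  rw [hasSum_iff_tendsto_nat_of_nonneg (fun k => by positivity)]
  have hlim : Tendsto F atTop (𝓝 0) := by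
    refine squeeze_zero (fun k => by positivity) (fun k => ?_) tendsto_one_div_add_atTop_nhds_zero_nat
    have h : ((k + 1).factorial : ℝ) ≤ ((k + 2 * m + 2).factorial : ℝ) := by
      exact_mod_cast Nat.factorial_le (by omega)
    rw [Nat.factorial_succ] at h
    push_cast at h
    rw [div_le_div_iff₀ (by positivity) (by positivity)]
    nlinarith [(by positivity : (0 : ℝ) ≤ (2 * m + 1) * ((k + 2 * m + 2).factorial : ℝ))]
  have : ∀ n, ∑ k ∈ Finset.range n, (k.factorial : ℝ) / ((k + 2 * m + 3).factorial : ℝ)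
      = F 0 - F n := by
    intro n
    rw [← Finset.sum_range_sub']
    exact Finset.sum_congr rfl fun k _ => hF k
  simp only [this]
  simpa [F] using hlim.const_sub (F 0)

theorem zetaTerm_succ (m k : ℕ) :
    (m + 1 : ℝ) ^ 2 * zetaTerm (m + 1) k =
      (k.factorial : ℝ) / ((k + 2 * m + 3).factorial : ℝ) - zetaTerm m (k + 1) := by
  have e : (k + 2 * (m + 1) + 1).factorial = (k + 2 * m + 3) * (k + 2 * m + 2).factorial := by
    rw [show k + 2 * (m + 1) + 1 = (k + 2 * m + 2) + 1 by ring, Nat.factorial_succ]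
  have e' : (k + 2 * m + 3).factorial = (k + 2 * m + 3) * (k + 2 * m + 2).factorial := by
    rw [show k + 2 * m + 3 = (k + 2 * m + 2) + 1 by ring, Nat.factorial_succ]
  have e'' : k + 1 + 2 * m + 1 = k + 2 * m + 2 := by ring
  have h0 : ((k + 2 * m + 2).factorial : ℝ) ≠ 0 := by positivity
  simp only [zetaTerm]
  rw [e, e', e'', Nat.factorial_succ k]
  push_cast
  have h1 : (k + (m + 1) + 1 : ℝ) ≠ 0 := by positivity
  have h2 : (k + 1 + m + 1 : ℝ) ≠ 0 := by positivity
  have h3 : (k + 2 * m + 3 : ℝ) ≠ 0 := by positivity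
  field_simp
  ring

/-- By `zetaTerm_succ`, consecutive series differ by a telescoping one. Its sum and the peeled-off
term k = 0 combine to `zetaCoeff m`; iteration yields Apéry's series (5/2) Σ (−1)^{k−1}/(k³ C(2k,
k)). -/
theorem tsum_zetaTerm_recurrence (m : ℕ) :
    ∑' k, zetaTerm m k = zetaCoeff m - (m + 1 : ℝ) ^ 2 * ∑' k, zetaTerm (m + 1) k := by
  have h1 := (summable_zetaTerm m).tsum_eq_zero_add
  have h2 := (hasSum_factorial_ratio m).sub
    ((summable_nat_add_iff 1).2 (summable_zetaTerm m)).hasSum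
  have h3 := ((summable_zetaTerm (m + 1)).hasSum.mul_left ((m + 1 : ℝ) ^ 2)).unique
    (h2.congr_fun fun k => zetaTerm_succ m k)
  have e : (2 * m + 2).factorial = (2 * m + 2) * (2 * m + 1).factorial := Nat.factorial_succ _
  have h4 : zetaTerm m 0 + 1 / ((2 * m + 2) * ((2 * m + 2).factorial : ℝ)) = zetaCoeff m := by
    simp only [zetaTerm, zetaCoeff, Nat.factorial_zero, zero_add]
    rw [e]
    push_cast
    field_simp
    ring
  linarith

theorem tsum_zetaTerm_zero : ∑' k, zetaTerm 0 k = (riemannZeta 3).re := by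
  rw [← zetaThree, ← polylog_three_one, polylog]
  refine tsum_congr fun k => ?_
  simp only [zetaTerm, Nat.factorial_succ]
  push_cast
  have : (k.factorial : ℝ) ≠ 0 := by positivity
  field_simp
  ring

/-- All terms are nonnegative, so the recurrence bounds the tail by its own leading coefficient. -/
theorem tsum_zetaTerm_mem (m : ℕ) : ∑' k, zetaTerm m k ∈ Icc 0 (zetaCoeff m) := by
  refine ⟨tsum_nonneg (zetaTerm_nonneg m), ?_⟩
  rw [tsum_zetaTerm_recurrence]
  have : 0 ≤ ∑' k, zetaTerm (m + 1) k := tsum_nonneg (zetaTerm_nonneg _)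
  nlinarith [sq_nonneg (m + 1 : ℝ), mul_nonneg (sq_nonneg (m + 1 : ℝ)) this]

/-- The central factorial series for `ζ(3)` with remainder. -/
theorem zeta_three_eq_sum_add (M : ℕ) :
    (riemannZeta 3).re = ∑ m ∈ Finset.range M, (-1) ^ m * (m.factorial : ℝ) ^ 2 * zetaCoeff m
      + (-1) ^ M * (M.factorial : ℝ) ^ 2 * ∑' k, zetaTerm M k := by
  induction M with
  | zero => simp [tsum_zetaTerm_zero]
  | succ M ih =>
    rw [ih, tsum_zetaTerm_recurrence M, Finset.sum_range_succ, Nat.factorial_succ]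
    push_cast
    ring

theorem arctan_bounds {x : ℝ} (h0 : 0 ≤ x) (h1 : x < 1) (k : ℕ) :
    ∑ i ∈ Finset.range (2 * k), (-1) ^ i * (x ^ (2 * i + 1) / (2 * i + 1)) ≤ Real.arctan x ∧
    Real.arctan x ≤ ∑ i ∈ Finset.range (2 * k + 1), (-1) ^ i * (x ^ (2 * i + 1) / (2 * i + 1)) := by
  have hs := (Real.hasSum_arctan (x := x) (by rwa [Real.norm_of_nonneg h0])).tendsto_sum_nat
  have hs' : Tendsto (fun n => ∑ i ∈ Finset.range n, (-1) ^ i * (x ^ (2 * i + 1) / (2 * i + 1)))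
      atTop (𝓝 (Real.arctan x)) := by
    refine hs.congr fun n => Finset.sum_congr rfl fun i _ => ?_
    push_cast
    ring
  have ha : Antitone (fun i : ℕ => x ^ (2 * i + 1) / (2 * i + 1)) := by
    refine antitone_nat_of_succ_le fun i => ?_
    have : x ^ (2 * (i + 1) + 1) ≤ x ^ (2 * i + 1) :=
      pow_le_pow_of_le_one h0 h1.le (by omega)
    push_cast
    gcongr
    linarith
  exact ⟨ha.alternating_series_le_tendsto hs' k, ha.tendsto_le_alternating_series hs' k⟩

end

/-! ### Rational enclosures and the numerical value. -/

section

open Set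

/-- Machin's formula, with alternating partial sums bracketing the arctangents of 1/5 and 1/239. -/
theorem pi_mem : Real.pi ∈ Icc (314159265358979323846264337 / 10 ^ 26 : ℝ) (314159265358979323846264340 / 10 ^ 26) := by
  have h5 := arctan_bounds (x := 5⁻¹) (by norm_num) (by norm_num) 10
  have h239 := arctan_bounds (x := 239⁻¹) (by norm_num) (by norm_num) 3
  have h := Real.four_mul_arctan_inv_5_sub_arctan_inv_239
  norm_num [Finset.sum_range_succ] at h5 h239 h ⊢
  constructor <;> linarith [h5.1, h5.2, h239.1, h239.2]

/-- The partial sums of the series of log((1 + x)/(1 − x)) increase to it, so any of them bounds it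
from below. -/
theorem le_log_of_sum_le {x y c : ℝ} (n : ℕ) (h0 : 0 ≤ x) (h1 : x < 1)
    (hy : (1 + x) / (1 - x) ≤ y)
    (hc : c ≤ 2 * ∑ i ∈ Finset.range n, x ^ (2 * i + 1) / (2 * i + 1)) : c ≤ Real.log y := by
  have h := Real.sum_range_le_log_div h0 h1 n
  have := Real.log_le_log (div_pos (by linarith) (by linarith)) hy
  linarith

theorem log_le_of_sum_le {x y c : ℝ} (n : ℕ) (h0 : 0 ≤ x) (h1 : x < 1) (hy0 : 0 < y)
    (hy : y ≤ (1 + x) / (1 - x))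
    (hc : 2 * (∑ i ∈ Finset.range n, x ^ (2 * i + 1) / (2 * i + 1)
      + x ^ (2 * n + 1) / (1 - x ^ 2)) ≤ c) : Real.log y ≤ c := by
  have h := Real.log_div_le_sum_range_add h0 h1 n
  have := Real.log_le_log hy0 hy
  linarith

theorem log_two_mem : Real.log 2 ∈ Icc (69314718055994530941723211 / 10 ^ 26 : ℝ) (69314718055994530941723214 / 10 ^ 26) := by
  constructor
  · refine le_log_of_sum_le (x := 1 / 3) 27 (by norm_num) (by norm_num) (by norm_num) ?_
    norm_num [Finset.sum_range_succ]
  · refine log_le_of_sum_le (x := 1 / 3) 27 (by norm_num) (by norm_num) (by norm_num)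
      (by norm_num) ?_
    norm_num [Finset.sum_range_succ]

theorem zeta_three_mem : (riemannZeta 3).re ∈ Icc (120205690315959428539973815 / 10 ^ 26 : ℝ) (120205690315959428539973818 / 10 ^ 26) := by
  -- After 40 terms the remainder is below 10⁻²⁸, since the series decays like 4^{−m}.
  obtain ⟨h0, h1⟩ := tsum_zetaTerm_mem 40
  rw [zetaCoeff] at h1
  rw [zeta_three_eq_sum_add 40]
  simp only [zetaCoeff]
  norm_num [Finset.sum_range_succ, Nat.factorial] at h0 h1 ⊢
  constructor <;> linarith

theorem log_ratio_mem : Real.log (Real.pi ^ 2 / 6) ∈ Icc (49770030247074534747437724 / 10 ^ 26 : ℝ) (49770030247074534747437745 / 10 ^ 26) := by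
  obtain ⟨h1, h2⟩ := pi_mem
  have h1' := pow_le_pow_left₀ (by norm_num) h1 2
  have h2' := pow_le_pow_left₀ Real.pi_pos.le h2 2
  constructor
  -- This is (y − 1)/(y + 1) for y = π²/6, rounded down; the upper bound uses it rounded up.
  · refine le_log_of_sum_le (x := 24383748348659101764398488 / 10 ^ 26) 21 (by norm_num) (by norm_num)
      (le_trans ?_ (div_le_div_of_nonneg_right h1' (by norm_num))) ?_
    · norm_num
    · norm_num [Finset.sum_range_succ]
  · refine log_le_of_sum_le (x := 24383748348659101764398490 / 10 ^ 26) 21 (by norm_num) (by norm_num) (by positivity)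
      (le_trans (div_le_div_of_nonneg_right h2' (by norm_num)) ?_) ?_
    · norm_num
    · norm_num [Finset.sum_range_succ]

theorem mul_mem_Icc {a b c d e f x y : ℝ} (hx : x ∈ Icc a b) (hy : y ∈ Icc c d)
    (ha : 0 ≤ a) (hc : 0 ≤ c) (he : e ≤ a * c) (hf : b * d ≤ f) : x * y ∈ Icc e f :=
  ⟨he.trans (mul_le_mul hx.1 hy.1 hc (ha.trans hx.1)),
    (mul_le_mul hx.2 hy.2 (hc.trans hy.1) (ha.trans (hx.1.trans hx.2))).trans hf⟩

/-- Each monomial is enclosed separately, after which the estimate is linear. Terms of size several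
hundred cancel to about 0.0027, hence the 26 decimals. -/
theorem abs_closedForm_sub_le {p l z w : ℝ}
    (hp : p ∈ Icc (314159265358979323846264337 / 10 ^ 26 : ℝ) (314159265358979323846264340 / 10 ^ 26))
    (hl : l ∈ Icc (69314718055994530941723211 / 10 ^ 26 : ℝ) (69314718055994530941723214 / 10 ^ 26))
    (hz : z ∈ Icc (120205690315959428539973815 / 10 ^ 26 : ℝ) (120205690315959428539973818 / 10 ^ 26))
    (hw : w ∈ Icc (49770030247074534747437724 / 10 ^ 26 : ℝ) (49770030247074534747437745 / 10 ^ 26)) :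
    |18113 / 324 * p ^ 2 - 46 / 27 * p ^ 4 - (212 / 27 * p ^ 2 + 14 / 9 * p ^ 4) * l
      - 68 / 9 * p ^ 2 * l ^ 2 - 16 / 9 * p ^ 2 * l ^ 3 - 47 / 3 * p ^ 2 * z
      + (-(257 / 54) * p ^ 2 + 7 / 18 * p ^ 4 + 4 / 9 * p ^ 2 * l + 4 / 3 * p ^ 2 * l ^ 2) * w
      + (13 / 36 * p ^ 2 - 1 / 3 * p ^ 2 * l) * w ^ 2 + 1 / 36 * p ^ 2 * w ^ 3
      - 0.002686585492882264| ≤ 5e-19 := by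
  have hP : p * p ∈ Icc (986960440108935861883449091 / 10 ^ 26 : ℝ) (986960440108935861883449111 / 10 ^ 26) :=
    mul_mem_Icc hp hp (by norm_num) (by norm_num) (by norm_num) (by norm_num)
  have hPP : p * p * (p * p) ∈ Icc (9740909103400243723644033091 / 10 ^ 26 : ℝ) (9740909103400243723644033487 / 10 ^ 26) :=
    mul_mem_Icc hP hP (by norm_num) (by norm_num) (by norm_num) (by norm_num)
  have hPl : p * p * l ∈ Icc (684108846385711654484747897 / 10 ^ 26 : ℝ) (684108846385711654484747942 / 10 ^ 26) :=
    mul_mem_Icc hP hl (by norm_num) (by norm_num) (by norm_num) (by norm_num)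
  have hPll : p * p * l * l ∈ Icc (474188118068372765263750380 / 10 ^ 26 : ℝ) (474188118068372765263750433 / 10 ^ 26) :=
    mul_mem_Icc hPl hl (by norm_num) (by norm_num) (by norm_num) (by norm_num)
  have hPlll : p * p * l * l * l ∈ Icc (328682157094119041925140512 / 10 ^ 26 : ℝ) (328682157094119041925140564 / 10 ^ 26) :=
    mul_mem_Icc hPll hl (by norm_num) (by norm_num) (by norm_num) (by norm_num)
  have hPPl : p * p * (p * p) * l ∈ Icc (6751883681112583710265143341 / 10 ^ 26 : ℝ) (6751883681112583710265143909 / 10 ^ 26) :=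
    mul_mem_Icc hPP hl (by norm_num) (by norm_num) (by norm_num) (by norm_num)
  have hPz : p * p * z ∈ Icc (1186382610178377670918251242 / 10 ^ 26 : ℝ) (1186382610178377670918251297 / 10 ^ 26) :=
    mul_mem_Icc hP hz (by norm_num) (by norm_num) (by norm_num) (by norm_num)
  have hPw : p * p * w ∈ Icc (491210509568877326680568201 / 10 ^ 26 : ℝ) (491210509568877326680568419 / 10 ^ 26) :=
    mul_mem_Icc hP hw (by norm_num) (by norm_num) (by norm_num) (by norm_num)
  have hPPw : p * p * (p * p) * w ∈ Icc (4848053407102338168727711997 / 10 ^ 26 : ℝ) (4848053407102338168727714240 / 10 ^ 26) :=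
    mul_mem_Icc hPP hw (by norm_num) (by norm_num) (by norm_num) (by norm_num)
  have hPlw : p * p * l * w ∈ Icc (340481179769081355524115877 / 10 ^ 26 : ℝ) (340481179769081355524116044 / 10 ^ 26) :=
    mul_mem_Icc hPl hw (by norm_num) (by norm_num) (by norm_num) (by norm_num)
  have hPllw : p * p * l * l * w ∈ Icc (236003569790662632328660831 / 10 ^ 26 : ℝ) (236003569790662632328660958 / 10 ^ 26) :=
    mul_mem_Icc hPll hw (by norm_num) (by norm_num) (by norm_num) (by norm_num)
  have hPww : p * p * w * w ∈ Icc (244475619189239197299938514 / 10 ^ 26 : ℝ) (244475619189239197299938727 / 10 ^ 26) :=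
    mul_mem_Icc hPw hw (by norm_num) (by norm_num) (by norm_num) (by norm_num)
  have hPlww : p * p * l * w * w ∈ Icc (169457586156668012185803945 / 10 ^ 26 : ℝ) (169457586156668012185804100 / 10 ^ 26) :=
    mul_mem_Icc hPlw hw (by norm_num) (by norm_num) (by norm_num) (by norm_num)
  have hPwww : p * p * w * w * w ∈ Icc (121675589617207103950668917 / 10 ^ 26 : ℝ) (121675589617207103950669075 / 10 ^ 26) :=
    mul_mem_Icc hPww hw (by norm_num) (by norm_num) (by norm_num) (by norm_num)
  simp only [mem_Icc] at *
  rw [abs_le]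
  constructor <;> linarith

end

end LaneEmden

end

theorem mainTheorem4 :
    (∃ (S : ℕ → ℝ) (Θ : ℕ → ℝ → ℝ), LaneEmden.IsPerturbationSolution 3 S Θ) ∧
    ∀ (S : ℕ → ℝ) (Θ : ℕ → ℝ → ℝ), LaneEmden.IsPerturbationSolution 3 S Θ →
      (∃ σ : ℝ → ℝ,
        (∀ᶠ n in 𝓝[≥] (0 : ℝ), ∀ s : ℝ, LaneEmden.IsScaleFactor n s ↔ s = σ n) ∧
        (fun n : ℝ => σ n - (S 0 + n * S 1 + n ^ 2 * S 2 + n ^ 3 * S 3))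
          =O[𝓝[≥] (0 : ℝ)] (fun n : ℝ => n ^ 4)) ∧
      S 3 =
        18113 / 324 * Real.pi ^ 2 - 46 / 27 * Real.pi ^ 4
        - (212 / 27 * Real.pi ^ 2 + 14 / 9 * Real.pi ^ 4) * Real.log 2
        - 68 / 9 * Real.pi ^ 2 * Real.log 2 ^ 2
        - 16 / 9 * Real.pi ^ 2 * Real.log 2 ^ 3
        - 47 / 3 * Real.pi ^ 2 * (riemannZeta 3).re
        + (-(257 / 54) * Real.pi ^ 2 + 7 / 18 * Real.pi ^ 4
            + 4 / 9 * Real.pi ^ 2 * Real.log 2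
            + 4 / 3 * Real.pi ^ 2 * Real.log 2 ^ 2) * Real.log (Real.pi ^ 2 / 6)
        + (13 / 36 * Real.pi ^ 2 - 1 / 3 * Real.pi ^ 2 * Real.log 2)
            * Real.log (Real.pi ^ 2 / 6) ^ 2
        + 1 / 36 * Real.pi ^ 2 * Real.log (Real.pi ^ 2 / 6) ^ 3 ∧
      |S 3 - 0.002686585492882264| ≤ 5e-19 := by
  refine ⟨LaneEmden.exists_perturbationSolution, fun S Θ h => ?_⟩
  obtain ⟨h0, h1, h2, h3⟩ := h.coeff_eq
  rw [h0, h1, h2, h3]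
  refine ⟨LaneEmden.exists_scaleFactor_expansion, LaneEmden.green_source₃_zero, ?_⟩
  rw [LaneEmden.green_source₃_zero]
  exact LaneEmden.abs_closedForm_sub_le LaneEmden.pi_mem LaneEmden.log_two_mem
    LaneEmden.zeta_three_mem LaneEmden.log_ratio_mem
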